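/- Let $E$ be a finite-dimensional quaternionic inner product space: a right $\mathbb H$-vector space with a form $\langle\cdot,\cdot\rangle:E\times E\to\mathbb H$, additive in each variable, with $\langle vq,wr\rangle=\bar q\langle v,w\rangle r$, and with $\langle v,v\rangle$ a non-negative real number which vanishes only for $v=0$. Let $\sigma=(E_1,\dots,E_s)$ be an orthogonal splitting of $E$: a sequence of pairwise orthogonal subspaces with $E=E_1\oplus\dots\oplus E_s$. Write $\Pi_F$ for the orthogonal projection on a subspace $F$ of $E$. Let $\mathsf{Gr}(E)$ be the set of all subspaces of $E$, with its usual topology, and $\mathsf{Gr}(E,\sigma)$ the subset of the subspaces $Q$ adapted to $\sigma$, that is, such that $Q=\bigoplus_i (Q\cap E_i)$; such a $Q$ carries the splitting $\sigma_Q=(Q\cap E_1,\dots,Q\cap E_s)$. Let $\nu^{E}$ be the Borel measure on $\mathsf{Gr}(E)$ which is invariant under the isometries of $E$ and gives the set of $n$-dimensional subspaces the mass $\binom{\dim E}{n}$, for every $n$. Let $\nu^{E,\sigma}=\nu^{E_1}\otimes\dots\otimes\nu^{E_s}$ on $\mathsf{Gr}(E,\sigma)\simeq\mathsf{Gr}(E_1)\times\dots\times\mathsf{Gr}(E_s)$.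 The incidence measure of a Borel probability measure $\mu$ on $\mathsf{Gr}(E,\sigma)$ is $Z\mu=\int_{\mathsf{Gr}(E,\sigma)}\nu^{Q,\sigma_Q}\,d\mu(Q)$, where $\nu^{Q,\sigma_Q}$ is seen as a measure on $\mathsf{Gr}(E,\sigma)$. For a quaternionic $d\times d$ matrix $M$, let $$\textstyle\det_{\Re}(M)=\sum_{\pi\in\mathfrak S_d}\varepsilon(\pi)\prod_{(i_1\dots i_r)\text{ cycle of }\pi}\Re(M_{i_1i_2}M_{i_2i_3}\cdots M_{i_ri_1}),$$ where fixed points count as cycles; for a self-adjoint endomorphism, $\det_{\Re}$ is that of its matrix in any orthonormal basis. For a self-adjoint endomorphism $k$ of $E$ with $0\le k\le 1$, the measure $\mu$ is determinantal with kernel $k$ if $$d(Z\mu)(R)=\textstyle\det_{\Re}(k_R^R)\,d\nu^{E,\sigma}(R),$$ where $k_R^R:R\to R$ is $k$ restricted to $R$ and followed by the orthogonal projection on $R$. Theorem. Let $H$ be a subspace of $E$, and let $\mathsf Q$ be a random element of $\mathsf{Gr}(E,\sigma)$ whose distribution is determinantal with kernel $\Pi_H$. Then, almost surely, $E=\mathsf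 Q\oplus H^\perp$. Moreover, if $P^{\mathsf Q}$ denotes the (almost surely defined) projection on $\mathsf Q$ parallel to $H^\perp$, then $P^{\mathsf Q}+(P^{\mathsf Q})^*$ is integrable and $$\mathbb E\big[P^{\mathsf Q}+(P^{\mathsf Q})^*\big]=2\,\Pi_H .$$ -/

import Mathlib

open scoped Quaternion RightActions
open MeasureTheory

namespace QDLP

/-! ### Quaternionic inner product spaces -/

/-- An inner product on a right quaternionic vector space `E` (a module over `ℍᵐᵒᵖ`;
`v <• q` is the product of the vector `v` by the scalar `q` on the right). -/
class QInner (E : Type*) [AddCommGroup E] [Module ℍᵐᵒᵖ E] where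
  /-- The inner product `⟨v, w⟩`. -/
  qinner : E → E → ℍ
  qinner_add_left : ∀ v v' w, qinner (v + v') w = qinner v w + qinner v' w
  qinner_add_right : ∀ v w w', qinner v (w + w') = qinner v w + qinner v w'
  qinner_smul_smul : ∀ (v w : E) (q r : ℍ), qinner (v <• q) (w <• r) = star q * qinner v w * r
  qinner_self_nonneg : ∀ v, ∃ r : ℝ, 0 ≤ r ∧ qinner v v = (r : ℍ)
  qinner_self_eq_zero : ∀ v, qinner v v = 0 → v = 0

open QInner

section Basic

variable {E : Type*} [AddCommGroup E] [Module ℍᵐᵒᵖ E] [QInner E]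

theorem qinner_smul_right (v w : E) (r : ℍ) : qinner v (w <• r) = qinner v w * r := by
  simpa using qinner_smul_smul v w 1 r

theorem qinner_smul_left (v w : E) (q : ℍ) : qinner (v <• q) w = star q * qinner v w := by
  simpa using qinner_smul_smul v w q 1

theorem qinner_zero_right (v : E) : qinner v 0 = 0 := by
  simpa using qinner_smul_right v 0 0

theorem qinner_zero_left (w : E) : qinner 0 w = 0 := by
  simpa using qinner_smul_left 0 w 0

theorem qinner_sum_right {ι : Type*} (s : Finset ι) (v : E) (f : ι → E) :
    qinner v (∑ i ∈ s, f i) = ∑ i ∈ s, qinner v (f i) := by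
  classical
  induction s using Finset.induction_on with
  | empty => simp [qinner_zero_right]
  | insert a s ha ih => rw [Finset.sum_insert ha, Finset.sum_insert ha, qinner_add_right, ih]

theorem qinner_sum_left {ι : Type*} (s : Finset ι) (f : ι → E) (w : E) :
    qinner (∑ i ∈ s, f i) w = ∑ i ∈ s, qinner (f i) w := by
  classical
  induction s using Finset.induction_on with
  | empty => simp [qinner_zero_left]
  | insert a s ha ih => rw [Finset.sum_insert ha, Finset.sum_insert ha, qinner_add_left, ih]

theorem qinner_neg_right (v w : E) : qinner v (-w) = -qinner v w := by
  have h := qinner_add_right v w (-w)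
  rw [add_neg_cancel, qinner_zero_right] at h
  exact (neg_eq_of_add_eq_zero_right h.symm).symm

theorem qinner_sub_right (v w w' : E) : qinner v (w - w') = qinner v w - qinner v w' := by
  rw [sub_eq_add_neg, qinner_add_right, qinner_neg_right, sub_eq_add_neg]

/-- Hermitian symmetry. -/
theorem star_qinner (v w : E) : star (qinner v w) = qinner w v := by
  obtain ⟨rv, -, hv⟩ := qinner_self_nonneg v
  have key : ∀ q : ℍ, ∃ r : ℝ, qinner v w * q + star q * qinner w v = (r : ℍ) := by
    intro q
    obtain ⟨r, -, hr⟩ := qinner_self_nonneg (v + w <• q)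
    obtain ⟨t, -, ht⟩ := qinner_self_nonneg (w <• q)
    refine ⟨r - rv - t, ?_⟩
    have e : qinner (v + w <• q) (v + w <• q)
        = qinner v v + (qinner v w * q + star q * qinner w v) + qinner (w <• q) (w <• q) := by
      rw [qinner_add_left, qinner_add_right, qinner_add_right, qinner_smul_right v,
        qinner_smul_left w v]
      abel
    rw [hr, hv, ht] at e
    push_cast
    rw [e]
    abel
  obtain ⟨r, h⟩ := key 1
  obtain ⟨I, i0, i1, i2, i3⟩ : ∃ I : ℍ, I.re = 0 ∧ I.imI = 1 ∧ I.imJ = 0 ∧ I.imK = 0 :=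
    ⟨⟨0, 1, 0, 0⟩, rfl, rfl, rfl, rfl⟩
  obtain ⟨t, k⟩ := key I
  have h1 := congrArg QuaternionAlgebra.imI h
  have h2 := congrArg QuaternionAlgebra.imJ h
  have h3 := congrArg QuaternionAlgebra.imK h
  have k1 := congrArg QuaternionAlgebra.imI k
  simp at h1 h2 h3
  simp [i0, i1, i2, i3] at k1
  ext <;> simp <;> linarith

/-- `e` is an orthonormal family. -/
def IsOrthonormal {ι : Type*} (e : ι → E) : Prop :=
  (∀ i, qinner (e i) (e i) = 1) ∧ ∀ i j, i ≠ j → qinner (e i) (e j) = 0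

theorem IsOrthonormal.qinner_sum {ι : Type*} [Fintype ι] {e : ι → E} (he : IsOrthonormal e)
    (c : ι → ℍ) (i : ι) : qinner (e i) (∑ j, e j <• c j) = c i := by
  classical
  rw [qinner_sum_right, Finset.sum_eq_single i]
  · rw [qinner_smul_right, he.1 i, one_mul]
  · intro j _ hj
    rw [qinner_smul_right, he.2 i j hj.symm, zero_mul]
  · simp

theorem IsOrthonormal.linearIndependent {ι : Type*} [Fintype ι] {e : ι → E}
    (he : IsOrthonormal e) : LinearIndependent ℍᵐᵒᵖ e := by
  rw [Fintype.linearIndependent_iff]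
  intro g hg i
  have h := he.qinner_sum (fun j => (g j).unop) i
  simp only [MulOpposite.op_unop, hg, qinner_zero_right] at h
  exact MulOpposite.unop_injective h.symm

theorem exists_isOrthonormal [Module.Finite ℍᵐᵒᵖ E] (n : ℕ) (hn : n ≤ Module.finrank ℍᵐᵒᵖ E) :
    ∃ e : Fin n → E, IsOrthonormal e := by
  induction n with
  | zero => exact ⟨Fin.elim0, fun i => i.elim0, fun i => i.elim0⟩
  | succ n ih =>
    obtain ⟨e, he⟩ := ih (by omega)
    have hne : Submodule.span ℍᵐᵒᵖ (Set.range e) ≠ ⊤ := by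
      intro h
      have h1 := finrank_range_le_card (R := ℍᵐᵒᵖ) e
      rw [Set.finrank, h, finrank_top, Fintype.card_fin] at h1
      omega
    obtain ⟨v, hv⟩ : ∃ v, v ∉ Submodule.span ℍᵐᵒᵖ (Set.range e) := by
      by_contra! hc
      exact hne (eq_top_iff.2 fun x _ => hc x)
    set w := v - ∑ j, e j <• qinner (e j) v with hw
    have hw0 : w ≠ 0 := by
      intro h0
      apply hv
      rw [sub_eq_zero.1 (hw.symm.trans h0)]
      exact Submodule.sum_mem _ fun j _ =>
        Submodule.smul_mem _ _ (Submodule.subset_span ⟨j, rfl⟩)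
    have hew : ∀ i, qinner (e i) w = 0 := by
      intro i
      rw [hw, qinner_sub_right, he.qinner_sum, sub_self]
    obtain ⟨r, hr, hwr⟩ := qinner_self_nonneg w
    have hr0 : r ≠ 0 := by
      intro h0
      apply hw0
      apply qinner_self_eq_zero
      rw [hwr, h0]
      simp
    set c : ℍ := (((Real.sqrt r)⁻¹ : ℝ) : ℍ) with hc
    have hcc : star c * (r : ℍ) * c = 1 := by
      rw [hc, Quaternion.star_coe, ← Quaternion.coe_mul, ← Quaternion.coe_mul,
        ← Quaternion.coe_one]
      congr 1
      have : Real.sqrt r ≠ 0 := by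
        rw [Real.sqrt_ne_zero hr]
        exact hr0
      field_simp
      exact (Real.sq_sqrt hr).symm
    have hew' : ∀ i, qinner (e i) (w <• c) = 0 := fun i => by
      rw [qinner_smul_right, hew, zero_mul]
    refine ⟨Fin.snoc e (w <• c), ?_, ?_⟩
    · intro i
      refine Fin.lastCases ?_ (fun i => ?_) i
      · simp only [Fin.snoc_last]
        rw [qinner_smul_smul, hwr, hcc]
      · simp only [Fin.snoc_castSucc]
        exact he.1 i
    · intro i j
      refine Fin.lastCases ?_ (fun i => ?_) i <;> refine Fin.lastCases ?_ (fun j => ?_) j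
      · simp
      · intro _
        simp only [Fin.snoc_last, Fin.snoc_castSucc]
        rw [← star_qinner, hew', star_zero]
      · intro _
        simp only [Fin.snoc_last, Fin.snoc_castSucc]
        exact hew' i
      · intro hij
        simp only [Fin.snoc_castSucc]
        exact he.2 i j fun h => hij (by rw [h])

variable (E) in
/-- An orthonormal basis of `E`, chosen once and for all. -/
noncomputable def onb [Module.Finite ℍᵐᵒᵖ E] : Fin (Module.finrank ℍᵐᵒᵖ E) → E :=
  (exists_isOrthonormal (E := E) _ le_rfl).choose

theorem isOrthonormal_onb [Module.Finite ℍᵐᵒᵖ E] : IsOrthonormal (onb E) :=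
  (exists_isOrthonormal (E := E) _ le_rfl).choose_spec

theorem span_onb [Module.Finite ℍᵐᵒᵖ E] : Submodule.span ℍᵐᵒᵖ (Set.range (onb E)) = ⊤ :=
  isOrthonormal_onb.linearIndependent.span_eq_top_of_card_eq_finrank' (by simp)

theorem sum_onb [Module.Finite ℍᵐᵒᵖ E] (v : E) : ∑ i, onb E i <• qinner (onb E i) v = v := by
  have hv : v ∈ Submodule.span ℍᵐᵒᵖ (Set.range (onb E)) := by rw [span_onb]; trivial
  obtain ⟨c, rfl⟩ := (Submodule.mem_span_range_iff_exists_fun ℍᵐᵒᵖ).1 hv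
  refine Finset.sum_congr rfl fun i _ => ?_
  have h := (isOrthonormal_onb (E := E)).qinner_sum (fun j => (c j).unop) i
  simp only [MulOpposite.op_unop] at h
  rw [h, MulOpposite.op_unop]

/-- A subspace of a quaternionic inner product space, with the induced inner product. -/
instance instQInnerSubmodule (Q : Submodule ℍᵐᵒᵖ E) : QInner Q where
  qinner v w := qinner (v : E) (w : E)
  qinner_add_left v v' w := qinner_add_left (v : E) v' w
  qinner_add_right v w w' := qinner_add_right (v : E) w w'
  qinner_smul_smul v w q r := qinner_smul_smul (v : E) (w : E) q r
  qinner_self_nonneg v := qinner_self_nonneg (v : E)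
  qinner_self_eq_zero v h := Subtype.ext (qinner_self_eq_zero (v : E) h)

/-! ### Orthogonal complements, projections, adjoints -/

/-- The orthogonal complement `Q^⊥`. -/
def orth (Q : Submodule ℍᵐᵒᵖ E) : Submodule ℍᵐᵒᵖ E where
  carrier := {v | ∀ w ∈ Q, qinner w v = 0}
  add_mem' {a b} ha hb w hw := by rw [qinner_add_right, ha w hw, hb w hw, add_zero]
  zero_mem' w _ := qinner_zero_right w
  smul_mem' c v hv w hw := by
    have h := qinner_smul_right w v c.unop
    rwa [MulOpposite.op_unop, hv w hw, zero_mul] at h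

theorem isCompl_orth [Module.Finite ℍᵐᵒᵖ E] (Q : Submodule ℍᵐᵒᵖ E) : IsCompl Q (orth Q) := by
  refine IsCompl.of_eq (eq_bot_iff.2 fun v hv => ?_) (eq_top_iff.2 fun v _ => ?_)
  · exact qinner_self_eq_zero v (hv.2 v hv.1)
  · set p : Q := ∑ i, onb Q i <• qinner (onb Q i : E) v with hp
    have h : v - p ∈ orth Q := by
      intro w hw
      have h1 := sum_onb (⟨w, hw⟩ : Q)
      have h2 : ∀ i, qinner (onb Q i : E) (v - p) = 0 := by
        intro i
        have h3 : qinner (onb Q i : E) (p : E) = qinner (onb Q i : E) v :=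
          isOrthonormal_onb.qinner_sum (fun i => qinner (onb Q i : E) v) i
        rw [qinner_sub_right, h3, sub_self]
      have h4 : w = ∑ i, (onb Q i : E) <• qinner (onb Q i) (⟨w, hw⟩ : Q) := by
        simpa using (congrArg Subtype.val h1).symm
      rw [h4, qinner_sum_left]
      exact Finset.sum_eq_zero fun i _ => by rw [qinner_smul_left, h2, mul_zero]
    have h5 : v = p + (v - p) := by abel
    rw [h5]
    exact Submodule.add_mem_sup p.2 h

open Classical in
/-- The projection on `Q` parallel to `F`. It is only meaningful when `E = Q ⊕ F`; otherwise it is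
set to `0`. -/
noncomputable def projAlong (Q F : Submodule ℍᵐᵒᵖ E) : E →ₗ[ℍᵐᵒᵖ] E :=
  if h : IsCompl Q F then Q.projection F h else 0

/-- The orthogonal projection `1^Q : E → Q`. -/
noncomputable def orthProjOnto [Module.Finite ℍᵐᵒᵖ E] (Q : Submodule ℍᵐᵒᵖ E) : E →ₗ[ℍᵐᵒᵖ] Q :=
  Q.projectionOnto (orth Q) (isCompl_orth Q)

/-- The orthogonal projection `Π_Q` on `Q`, as an endomorphism of `E`. -/
noncomputable def orthProj [Module.Finite ℍᵐᵒᵖ E] (Q : Submodule ℍᵐᵒᵖ E) : E →ₗ[ℍᵐᵒᵖ] E :=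
  Q.subtype ∘ₗ orthProjOnto Q

/-- The compression `a_Q^Q = 1^Q ∘ a ∘ 1_Q` of `a` to `Q`. -/
noncomputable def compress [Module.Finite ℍᵐᵒᵖ E] (a : E →ₗ[ℍᵐᵒᵖ] E) (Q : Submodule ℍᵐᵒᵖ E) :
    Q →ₗ[ℍᵐᵒᵖ] Q :=
  orthProjOnto Q ∘ₗ a ∘ₗ Q.subtype

/-- The adjoint `a^*` of `a`, given by `a^* v = ∑ i, e_i ⟨a e_i, v⟩`. -/
noncomputable def adjoint [Module.Finite ℍᵐᵒᵖ E] (a : E →ₗ[ℍᵐᵒᵖ] E) : E →ₗ[ℍᵐᵒᵖ] E where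
  toFun v := ∑ i, onb E i <• qinner (a (onb E i)) v
  map_add' v w := by
    simp only [qinner_add_right, MulOpposite.op_add, add_smul, Finset.sum_add_distrib]
  map_smul' c v := by
    simp only [RingHom.id_apply, Finset.smul_sum]
    refine Finset.sum_congr rfl fun i _ => ?_
    have h := qinner_smul_right (a (onb E i)) v c.unop
    rw [MulOpposite.op_unop] at h
    rw [h, MulOpposite.op_mul, MulOpposite.op_unop, mul_smul]

theorem adjoint_spec [Module.Finite ℍᵐᵒᵖ E] (a : E →ₗ[ℍᵐᵒᵖ] E) (v w : E) :
    qinner (adjoint a v) w = qinner v (a w) := by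
  have h : a w = ∑ i, a (onb E i) <• qinner (onb E i) w := by
    conv_lhs => rw [← sum_onb w]
    simp
  rw [h, qinner_sum_right]
  simp only [adjoint, LinearMap.coe_mk, AddHom.coe_mk]
  rw [qinner_sum_left]
  refine Finset.sum_congr rfl fun i _ => ?_
  rw [qinner_smul_left, qinner_smul_right, star_qinner]

end Basic

/-! ### The quaternion determinant -/

open Classical in
/-- The quaternion determinant `det_ℜ M`: the sum over permutations `π` of the signature of `π`
times the product, over the cycles `(i_1 … i_r)` of `π` (fixed points included), of
`ℜ(M_{i_1 i_2} M_{i_2 i_3} … M_{i_r i_1})`. Each cycle is listed from its smallest element `i`,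
and its length is the minimal period of `i` under `π`. -/
noncomputable def qdet {n : ℕ} (M : Matrix (Fin n) (Fin n) ℍ) : ℝ :=
  ∑ π : Equiv.Perm (Fin n), (Equiv.Perm.sign π : ℝ) *
    ∏ i with ∀ k : ℕ, i ≤ (π ^ k) i,
      (((List.range (Function.minimalPeriod π i)).map
        fun k => M ((π ^ k) i) ((π ^ (k + 1)) i)).prod).re

section Measure

variable {E : Type*} [AddCommGroup E] [Module ℍᵐᵒᵖ E] [QInner E] [Module.Finite ℍᵐᵒᵖ E]

/-- The determinant `det_ℜ a` of a self-adjoint endomorphism: the quaternion determinant of its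
matrix `⟨e_i, a e_j⟩` in an orthonormal basis. -/
noncomputable def qdetEnd (a : E →ₗ[ℍᵐᵒᵖ] E) : ℝ :=
  qdet (Matrix.of fun i j => qinner (onb E i) (a (onb E j)))

/-! ### The Grassmannian and its invariant measure -/

/-- The topology of the Grassmannian `Gr(E)`, the set of all subspaces of `E`: the coarsest one
for which all the matrix coefficients of `Q ↦ Π_Q` are continuous. -/
noncomputable instance instTopologicalSpaceGr : TopologicalSpace (Submodule ℍᵐᵒᵖ E) :=
  TopologicalSpace.induced (fun Q (v w : E) => qinner v (orthProj Q w)) inferInstance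

noncomputable instance instMeasurableSpaceGr : MeasurableSpace (Submodule ℍᵐᵒᵖ E) := borel _

instance instBorelSpaceGr : BorelSpace (Submodule ℍᵐᵒᵖ E) := ⟨rfl⟩

end Measure

/-- The group of `n × n` quaternionic unitary matrices. It is the group of isometries of any
`n`-dimensional quaternionic inner product space in which an orthonormal basis is chosen. -/
abbrev UMat (n : ℕ) : Type := unitary (Matrix (Fin n) (Fin n) ℍ)

instance instCompactSpaceUMat (n : ℕ) : CompactSpace (UMat n) := by
  refine isCompact_iff_compactSpace.1 ?_
  have hK : IsCompact (Set.univ.pi fun _ : Fin n => Set.univ.pi fun _ : Fin n =>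
      Metric.closedBall (0 : ℍ) 1) :=
    isCompact_univ_pi fun _ => isCompact_univ_pi fun _ => isCompact_closedBall _ _
  refine IsCompact.of_isClosed_subset (X := Matrix (Fin n) (Fin n) ℍ) hK isClosed_unitary ?_
  intro u hu i _ j _
  have h : (star u * u) j j = 1 := by rw [(Unitary.mem_iff.1 hu).1]; simp
  rw [Matrix.mul_apply] at h
  have h2 : ∀ k, star u j k * u k j = ((‖u k j‖ ^ 2 : ℝ) : ℍ) := by
    intro k
    rw [Matrix.star_apply, Quaternion.star_mul_self, Quaternion.normSq_eq_norm_mul_self, sq]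
  have h3 : (((∑ k, ‖u k j‖ ^ 2 : ℝ)) : ℍ) = ((1 : ℝ) : ℍ) := by
    rw [Quaternion.coe_one, ← h]
    simp only [h2]
    simpa only [Quaternion.algebraMap_def] using
      map_sum (algebraMap ℝ ℍ) (fun k => ‖u k j‖ ^ 2) Finset.univ
  have h4 : ∑ k, ‖u k j‖ ^ 2 = 1 := Quaternion.coe_injective h3
  have h5 : ‖u i j‖ ^ 2 ≤ 1 := by
    rw [← h4]
    exact Finset.single_le_sum (f := fun k => ‖u k j‖ ^ 2) (fun k _ => sq_nonneg _)
      (Finset.mem_univ i)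
  rw [mem_closedBall_zero_iff]
  exact (sq_le_one_iff₀ (norm_nonneg _)).1 h5

noncomputable instance instMeasurableSpaceUMat (n : ℕ) : MeasurableSpace (UMat n) := borel _

instance instBorelSpaceUMat (n : ℕ) : BorelSpace (UMat n) := ⟨rfl⟩

/-- The Haar measure of total mass `1` on the group of unitary matrices. -/
noncomputable def haarU (n : ℕ) : Measure (UMat n) := Measure.haarMeasure ⊤

section Measure

variable (E : Type*) [AddCommGroup E] [Module ℍᵐᵒᵖ E] [QInner E] [Module.Finite ℍᵐᵒᵖ E]

/-- The subspace `u(E_J)` of `E`, where `E_J` is spanned by the vectors `e_j`, `j ∈ J`, of an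
orthonormal basis, and `u` is the isometry of `E` with matrix `u` in this basis. -/
noncomputable def rotatedSubspace (J : Finset (Fin (Module.finrank ℍᵐᵒᵖ E)))
    (u : UMat (Module.finrank ℍᵐᵒᵖ E)) : Submodule ℍᵐᵒᵖ E :=
  Submodule.span ℍᵐᵒᵖ
    ((fun j => ∑ k, onb E k <• (u : Matrix (Fin _) (Fin _) ℍ) k j) ''
      (J : Set (Fin (Module.finrank ℍᵐᵒᵖ E))))

/-- The measure `ν^E` on `Gr(E)`: invariant under the isometries of `E`, and giving to the set of
`n`-dimensional subspaces the mass `d choose n`, where `d = dim E`. It is the average over the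
isometries `u` of the measures `∑ J, δ_{u(E_J)}`. -/
noncomputable def invMeasure : Measure (Submodule ℍᵐᵒᵖ E) :=
  ∑ J : Finset (Fin (Module.finrank ℍᵐᵒᵖ E)), (haarU _).map (rotatedSubspace E J)

end Measure

/-! ### Splittings -/

/-- An orthogonal splitting `σ = (E_1, …, E_s)` of `E`. Blocks equal to `0` are allowed, since
they occur in the splittings induced on subspaces. -/
structure Splitting (E : Type*) [AddCommGroup E] [Module ℍᵐᵒᵖ E] [QInner E] (s : ℕ) where
  /-- The blocks of the splitting. -/
  block : Fin s → Submodule ℍᵐᵒᵖ E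
  orthogonal : ∀ i j, i ≠ j → ∀ v ∈ block i, ∀ w ∈ block j, qinner v w = 0
  iSup_block : ⨆ i, block i = ⊤

namespace Splitting

variable {E : Type*} [AddCommGroup E] [Module ℍᵐᵒᵖ E] [QInner E] {s : ℕ} (σ : Splitting E s)

/-- `Q` is adapted to `σ`: it is the (automatically direct) sum of the `Q ∩ E_i`. -/
def Adapted (Q : Submodule ℍᵐᵒᵖ E) : Prop := Q = ⨆ i, Q ⊓ σ.block i

theorem adapted_iSup (Q : Fin s → Submodule ℍᵐᵒᵖ E) (h : ∀ i, Q i ≤ σ.block i) :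
    σ.Adapted (⨆ i, Q i) :=
  le_antisymm (iSup_mono fun i => le_inf (le_iSup Q i) (h i)) (iSup_le fun _ => inf_le_left)

/-- The split Grassmannian `Gr(E, σ)`, the set of all subspaces adapted to `σ`, with the topology
and the Borel sets inherited from `Gr(E)`. -/
abbrev Gr : Type _ := {Q : Submodule ℍᵐᵒᵖ E // σ.Adapted Q}

/-- The map `(Q_1, …, Q_s) ↦ Q_1 ⊕ … ⊕ Q_s` from `Gr(E_1) × … × Gr(E_s)` to `Gr(E, σ)`. -/
noncomputable def assemble (Q : ∀ i, Submodule ℍᵐᵒᵖ (σ.block i)) : σ.Gr :=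
  ⟨⨆ i, (Q i).map (σ.block i).subtype, σ.adapted_iSup _ fun _ => Submodule.map_subtype_le _ _⟩

/-- The splitting `σ_Q = (Q ∩ E_1, …, Q ∩ E_s)` induced on an adapted subspace `Q`. -/
noncomputable def induced (Q : σ.Gr) : Splitting Q.1 s where
  block i := (σ.block i).comap Q.1.subtype
  orthogonal i j hij v hv w hw := σ.orthogonal i j hij v.1 hv w.1 hw
  iSup_block := by
    apply Submodule.map_injective_of_injective Q.1.injective_subtype
    rw [Submodule.map_iSup, Submodule.map_subtype_top]
    simp only [Submodule.map_comap_subtype]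
    exact Q.2.symm

/-- The inclusion of `Gr(Q, σ_Q)` in `Gr(E, σ)`. -/
noncomputable def incl (Q : σ.Gr) (R : (σ.induced Q).Gr) : σ.Gr :=
  ⟨R.1.map Q.1.subtype, by
    have h := congrArg (Submodule.map Q.1.subtype) R.2
    rw [Submodule.map_iSup] at h
    rw [h]
    refine σ.adapted_iSup _ fun i => ?_
    rintro _ ⟨x, hx, rfl⟩
    exact hx.2⟩

variable [Module.Finite ℍᵐᵒᵖ E]

/-- The invariant measure `ν^{E,σ} = ν^{E_1} ⊗ … ⊗ ν^{E_s}` on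
`Gr(E, σ) ≃ Gr(E_1) × … × Gr(E_s)`. -/
noncomputable def invMeasure : Measure σ.Gr :=
  (Measure.pi fun i => QDLP.invMeasure (σ.block i)).map σ.assemble

/-- The incidence measure `Zμ = ∫ ν^{Q,σ_Q} dμ(Q)` of a measure `μ` on `Gr(E, σ)`. -/
noncomputable def incidence (μ : Measure σ.Gr) : Measure σ.Gr :=
  μ.bind fun Q => (σ.induced Q).invMeasure.map (σ.incl Q)

/-- The probability measure `μ` on `Gr(E, σ)` is determinantal with kernel `k`, where `k` is
self-adjoint with `0 ≤ k ≤ 1`: its incidence measure has the density `R ↦ det_ℜ(k_R^R)`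
with respect to `ν^{E,σ}`. -/
structure IsDLP (k : E →ₗ[ℍᵐᵒᵖ] E) (μ : Measure σ.Gr) : Prop where
  isProbabilityMeasure : IsProbabilityMeasure μ
  incidence_eq : σ.incidence μ =
    σ.invMeasure.withDensity fun R => ENNReal.ofReal (qdetEnd (compress k R.1))

end Splitting

/-- The random endomorphism `X` is integrable and its expectation is `m`; that is, all its matrix
coefficients `⟨v, X w⟩` are integrable and have expectation `⟨v, m w⟩`. -/
def HasExpectation {Ω : Type*} [MeasurableSpace Ω] (P : Measure Ω)
    {E : Type*} [AddCommGroup E] [Module ℍᵐᵒᵖ E] [QInner E]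
    (X : Ω → E →ₗ[ℍᵐᵒᵖ] E) (m : E →ₗ[ℍᵐᵒᵖ] E) : Prop :=
  ∀ v w : E, Integrable (fun ω => qinner v (X ω w)) P ∧
    ∫ ω, qinner v (X ω w) ∂P = qinner v (m w)

end QDLP

namespace QDLP

open QInner

/-! ### Orthonormal bases and the real trace -/

/-! The core is an averaging formula that does not see the splitting. For a self-adjoint `a`, the
sum of `det_ℜ` of the compressions of `a` to the `m`-dimensional coordinate subspaces of an
orthonormal basis does not depend on the basis: it is an elementary symmetric function `e_m(a) =
traceSum m a / m!` of the real traces of the powers of `a` (`IsONB.sum_qdetEnd_compress`). Indeed,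
`m!` times this sum equals the sum of `det_ℜ` over all maps from `Fin m` to the index set, because
`det_ℜ` of a self-adjoint matrix with two equal rows vanishes (`qdet_eq_zero_of_row_eq`). Summing
over all maps turns each cycle of length `r` into `ℜ tr(a^r)`. Since `ν^{E,σ}` averages the
coordinate subspaces of the bases adapted to `σ`, the integral of `det_ℜ(a_R^R)` over the `R` of
dimension `m` is `e_m(a)`, for every `σ` (`Splitting.setIntegral_qdetEnd`).

Let `d = dim H`. If `det_ℜ((Π_H)_R^R) ≠ 0`, then `R ∩ H^⊥ = 0`, so `dim R ≤ d`. Hence almost surely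
`dim Q ≤ d`. The only subspace of `Q` whose dimension is at least `dim Q` is `Q` itself, so in
dimension `d` the incidence measure coincides with `μ`. As `e_d(Π_H) = 1`, the measure `μ` is
carried by the dimension `d`, with density `det_ℜ((Π_H)_R^R)` (`Splitting.IsDLP.eq_withDensity`).
This density being almost surely non-zero, `E = Q ⊕ H^⊥`.

For the expectation, perturb `Π_H` into `a_t = Π_H + t(h⟨v, ·⟩ + v⟨h, ·⟩)` with `h = Π_H w`. When
`dim R = d`, the derivative at `0` of `det_ℜ((a_t)_R^R)` is `2 det_ℜ((Π_H)_R^R) ℜ⟨v, P^R w⟩`, as an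
orthonormal basis of `R` that diagonalizes `(Π_H)_R^R` shows. This derivative is a linear
combination, with weights independent of `R`, of finitely many values in `t`
(`exists_perturbedProj_weights`). Integrating and applying the averaging formula expresses `2 E[ℜ⟨v,
P^Q w⟩]` by numbers `e_d(a_t)`, which do not depend on `σ`. They are computed in a basis adapted to
`H ⊕ H^⊥`, where `H` is the only coordinate subspace that contributes, and the result is `2 ℜ⟨v, Π_H
w⟩`.

Replacing `w` by its right multiples recovers the whole quaternion, so that in fact `E[P^Q] = Π_H`;
the symmetrized statement follows by adding adjoints. -/

theorem re_mul_comm (a b : ℍ) : (a * b).re = (b * a).re := by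
  simp only [Quaternion.re_mul]; ring

theorem re_sum {ι : Type*} (s : Finset ι) (f : ι → ℍ) : (∑ i ∈ s, f i).re = ∑ i ∈ s, (f i).re :=
  map_sum (QuaternionAlgebra.reₗ (-1 : ℝ) 0 (-1)) f s

section LinearAlgebra

variable {E : Type*} [AddCommGroup E] [Module ℍᵐᵒᵖ E] [QInner E]
variable {F : Type*} [AddCommGroup F] [Module ℍᵐᵒᵖ F] [QInner F]
variable {ι κ : Type*} [Fintype ι] [Fintype κ]

/-- `e` is an orthonormal basis. -/
structure IsONB (e : ι → E) : Prop where
  orthonormal : IsOrthonormal e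
  sum_eq : ∀ v, ∑ i, e i <• qinner (e i) v = v

theorem isONB_onb [Module.Finite ℍᵐᵒᵖ E] : IsONB (onb E) := ⟨isOrthonormal_onb, sum_onb⟩

theorem IsONB.qinner_eq_sum {e : ι → E} (he : IsONB e) (v w : E) :
    qinner v w = ∑ i, qinner v (e i) * qinner (e i) w := by
  conv_lhs => rw [← he.sum_eq w]
  rw [qinner_sum_right]
  simp only [qinner_smul_right]

theorem IsOrthonormal.isONB_of_span {e : ι → E} (he : IsOrthonormal e)
    (hs : Submodule.span ℍᵐᵒᵖ (Set.range e) = ⊤) : IsONB e := by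
  refine ⟨he, fun v => ?_⟩
  have hv : v ∈ Submodule.span ℍᵐᵒᵖ (Set.range e) := by rw [hs]; trivial
  obtain ⟨c, rfl⟩ := (Submodule.mem_span_range_iff_exists_fun ℍᵐᵒᵖ).1 hv
  refine Finset.sum_congr rfl fun i _ => ?_
  have h := he.qinner_sum (fun j => (c j).unop) i
  simp only [MulOpposite.op_unop] at h
  rw [h, MulOpposite.op_unop]

theorem IsOrthonormal.isONB_of_card [Module.Finite ℍᵐᵒᵖ E] {e : ι → E} (he : IsOrthonormal e)
    (hc : Fintype.card ι = Module.finrank ℍᵐᵒᵖ E) : IsONB e :=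
  he.isONB_of_span (he.linearIndependent.span_eq_top_of_card_eq_finrank' hc)

theorem IsONB.span_eq_top {e : ι → E} (he : IsONB e) :
    Submodule.span ℍᵐᵒᵖ (Set.range e) = ⊤ := by
  refine eq_top_iff.2 fun v _ => ?_
  rw [← he.sum_eq v]
  exact Submodule.sum_mem _ fun j _ => Submodule.smul_mem _ _ (Submodule.subset_span ⟨j, rfl⟩)

theorem IsONB.finrank_eq {e : ι → E} (he : IsONB e) :
    Module.finrank ℍᵐᵒᵖ E = Fintype.card ι := by
  rw [← finrank_span_eq_card he.orthonormal.linearIndependent, he.span_eq_top, finrank_top]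

/-- Quaternions do not commute, but `ℜ(xy) = ℜ(yx)`: only the real part of the trace is cyclic.
Everything that is independent of the basis below rests on this. -/
theorem sum_re_qinner_comp {e : ι → E} {f : κ → F} (he : IsONB e) (hf : IsONB f)
    (u : E →ₗ[ℍᵐᵒᵖ] F) (v : F →ₗ[ℍᵐᵒᵖ] E) :
    ∑ i, (qinner (e i) (v (u (e i)))).re = ∑ j, (qinner (f j) (u (v (f j)))).re := by
  have h1 : ∀ i, (qinner (e i) (v (u (e i)))).re =
      ∑ j, (qinner (e i) (v (f j)) * qinner (f j) (u (e i))).re := by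
    intro i
    conv_lhs => rw [← hf.sum_eq (u (e i))]
    simp only [map_sum, map_smul, qinner_sum_right, qinner_smul_right]
    exact re_sum _ _
  have h2 : ∀ j, (qinner (f j) (u (v (f j)))).re =
      ∑ i, (qinner (f j) (u (e i)) * qinner (e i) (v (f j))).re := by
    intro j
    conv_lhs => rw [← he.sum_eq (v (f j))]
    simp only [map_sum, map_smul, qinner_sum_right, qinner_smul_right]
    exact re_sum _ _
  simp only [h1, h2]
  rw [Finset.sum_comm]
  exact Finset.sum_congr rfl fun j _ => Finset.sum_congr rfl fun i _ => re_mul_comm _ _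

end LinearAlgebra

/-! ### Products of matrix entries along the cycles of a permutation -/

section Loops

variable {α : Type*}

/-- The product `M (h 0) (h 1) * M (h 1) (h 2) * ⋯ * M (h (r - 1)) (h r)`. -/
noncomputable def pathProd (M : Matrix α α ℍ) (h : ℕ → α) (r : ℕ) : ℍ :=
  ((List.range r).map fun k => M (h k) (h (k + 1))).prod

theorem pathProd_zero (M : Matrix α α ℍ) (h : ℕ → α) : pathProd M h 0 = 1 := by simp [pathProd]

theorem pathProd_succ (M : Matrix α α ℍ) (h : ℕ → α) (r : ℕ) :
    pathProd M h (r + 1) = pathProd M h r * M (h r) (h (r + 1)) := by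
  simp [pathProd, List.prod_range_succ]

theorem pathProd_succ' (M : Matrix α α ℍ) (h : ℕ → α) (r : ℕ) :
    pathProd M h (r + 1) = M (h 0) (h 1) * pathProd M (fun k => h (k + 1)) r := by
  simp [pathProd, List.prod_range_succ']

theorem pathProd_add (M : Matrix α α ℍ) (h : ℕ → α) (p q : ℕ) :
    pathProd M h (p + q) = pathProd M h p * pathProd M (fun k => h (p + k)) q := by
  induction q with
  | zero => simp [pathProd_zero]
  | succ q ih => rw [← add_assoc, pathProd_succ, ih, pathProd_succ, mul_assoc]; rfl

theorem pathProd_congr {M : Matrix α α ℍ} {h h' : ℕ → α} {r : ℕ} (H : ∀ k ≤ r, h k = h' k) :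
    pathProd M h r = pathProd M h' r := by
  induction r with
  | zero => simp [pathProd_zero]
  | succ r ih =>
    rw [pathProd_succ, pathProd_succ, ih fun k hk => H k (by omega), H r (by omega),
      H (r + 1) le_rfl]

/-- Conjugation reverses a product and, for a self-adjoint matrix, reverses each edge: the result is
the product along the path run backwards. -/
theorem star_pathProd {M : Matrix α α ℍ} (hM : ∀ i j, star (M i j) = M j i) (h : ℕ → α) (r : ℕ) :
    star (pathProd M h r) = pathProd M (fun k => h (r - k)) r := by
  induction r with
  | zero => simp [pathProd_zero]
  | succ r ih =>
    rw [pathProd_succ, star_mul, hM, ih, pathProd_succ']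
    simp [Nat.succ_sub_succ]

/-- The product of the entries of `M` along the cycle of `π` starting from `x`. -/
noncomputable def loop (M : Matrix α α ℍ) (π : Equiv.Perm α) (x : α) : ℍ :=
  pathProd M (fun k => (π ^ k) x) (Function.minimalPeriod π x)

theorem minimalPeriod_perm_pos [Finite α] (π : Equiv.Perm α) (x : α) :
    0 < Function.minimalPeriod π x :=
  Function.minimalPeriod_pos_of_mem_periodicPts (π.injective.mem_periodicPts x)

theorem pow_minimalPeriod_apply (π : Equiv.Perm α) (x : α) :
    (π ^ Function.minimalPeriod π x) x = x := by
  rw [← Equiv.Perm.iterate_eq_pow]; exact Function.isPeriodicPt_minimalPeriod π x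

theorem eq_of_pow_apply_eq {π : Equiv.Perm α} {x : α} {i j : ℕ}
    (hi : i < Function.minimalPeriod π x) (hj : j < Function.minimalPeriod π x)
    (h : (π ^ i) x = (π ^ j) x) : i = j := by
  rw [← Equiv.Perm.iterate_eq_pow, ← Equiv.Perm.iterate_eq_pow] at h
  exact Function.iterate_injOn_Iio_minimalPeriod hi hj h

theorem minimalPeriod_perm_eq {π : Equiv.Perm α} {x : α} {r : ℕ} (hr : 0 < r)
    (h : (π ^ r) x = x) (hne : ∀ k, 0 < k → k < r → (π ^ k) x ≠ x) :
    Function.minimalPeriod π x = r := by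
  have hp : Function.IsPeriodicPt π r x := by
    rw [Function.IsPeriodicPt, Function.IsFixedPt, Equiv.Perm.iterate_eq_pow]; exact h
  refine le_antisymm (hp.minimalPeriod_le hr) (not_lt.1 fun hlt => ?_)
  exact hne _ (hp.minimalPeriod_pos hr) hlt (pow_minimalPeriod_apply π x)

theorem exists_lt_minimalPeriod [Finite α] {π : Equiv.Perm α} {x y : α} (h : π.SameCycle x y) :
    ∃ k < Function.minimalPeriod π x, (π ^ k) x = y := by
  obtain ⟨k, hk⟩ := h.exists_nat_pow_eq
  refine ⟨k % Function.minimalPeriod π x, Nat.mod_lt _ (minimalPeriod_perm_pos π x), ?_⟩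
  rw [← hk, ← Equiv.Perm.iterate_eq_pow, ← Equiv.Perm.iterate_eq_pow,
    Function.iterate_mod_minimalPeriod_eq]

theorem minimalPeriod_apply_perm [Finite α] (π : Equiv.Perm α) (x : α) :
    Function.minimalPeriod π (π x) = Function.minimalPeriod π x :=
  Function.minimalPeriod_apply (π.injective.mem_periodicPts x)

/-- Moving the base point one step along the cycle moves the first factor to the end, which does not
affect the real part. -/
theorem re_loop_apply [Finite α] (M : Matrix α α ℍ) (π : Equiv.Perm α) (x : α) :
    (loop M π (π x)).re = (loop M π x).re := by
  rw [loop, loop, minimalPeriod_apply_perm]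
  obtain ⟨r, hr⟩ := Nat.exists_eq_succ_of_ne_zero (minimalPeriod_perm_pos π x).ne'
  have hx := pow_minimalPeriod_apply π x
  have h2 : ∀ k, (π ^ k) (π x) = (π ^ (k + 1)) x := fun k => by rw [pow_succ]; rfl
  rw [hr] at hx ⊢
  simp only [Nat.succ_eq_add_one] at hx ⊢
  have h3 : (π ^ (r + 2)) x = π x := by rw [pow_succ', Equiv.Perm.mul_apply, hx]
  rw [pathProd_succ, pathProd_succ', re_mul_comm]
  simp only [h2]
  rw [hx, h3, pow_zero, pow_one, Equiv.Perm.one_apply]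

theorem re_loop_sameCycle [Finite α] (M : Matrix α α ℍ) (π : Equiv.Perm α) {x y : α}
    (h : π.SameCycle x y) : (loop M π x).re = (loop M π y).re := by
  obtain ⟨k, rfl⟩ := h.exists_nat_pow_eq
  induction k with
  | zero => simp
  | succ k ih =>
    rw [pow_succ', Equiv.Perm.mul_apply, re_loop_apply]
    exact ih ⟨k, by simp⟩

/-- `T` contains exactly one point of each cycle of `π`. -/
structure IsTransversal (π : Equiv.Perm α) (T : Finset α) : Prop where
  exists_sameCycle : ∀ y, ∃ x ∈ T, π.SameCycle x y
  eq_of_sameCycle : ∀ x ∈ T, ∀ y ∈ T, π.SameCycle x y → x = y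

theorem IsTransversal.prod_eq {π : Equiv.Perm α} {T T' : Finset α} (hT : IsTransversal π T)
    (hT' : IsTransversal π T') (g : α → ℝ) (hg : ∀ x y, π.SameCycle x y → g x = g y) :
    ∏ x ∈ T, g x = ∏ x ∈ T', g x := by
  choose i hi1 hi2 using hT'.exists_sameCycle
  choose j hj1 hj2 using hT.exists_sameCycle
  refine Finset.prod_bij' (fun x _ => i x) (fun x _ => j x) (fun x _ => hi1 x) (fun x _ => hj1 x)
    (fun x hx => hT.eq_of_sameCycle _ (hj1 _) _ hx ((hj2 _).trans (hi2 _)))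
    (fun x hx => hT'.eq_of_sameCycle _ (hi1 _) _ hx ((hi2 _).trans (hj2 _)))
    (fun x _ => (hg _ _ (hi2 x)).symm)

/-- Used when a permutation is modified on some cycles only: the orbits in the other cycles, and
hence their loops, are unchanged. -/
theorem pow_eq_of_eqOn {π π' : Equiv.Perm α} {S : Set α}
    (hS : ∀ y ∈ S, π y ∈ S ∧ π' y = π y) {x : α} (hx : x ∈ S) (k : ℕ) :
    (π' ^ k) x = (π ^ k) x ∧ (π ^ k) x ∈ S := by
  induction k with
  | zero => exact ⟨rfl, hx⟩
  | succ k ih =>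
    rw [pow_succ', pow_succ', Equiv.Perm.mul_apply, Equiv.Perm.mul_apply, ih.1]
    exact ⟨(hS _ ih.2).2, (hS _ ih.2).1⟩

theorem minimalPeriod_eq_of_pow_eq {π π' : Equiv.Perm α} {x : α}
    (h : ∀ k : ℕ, (π' ^ k) x = (π ^ k) x) :
    Function.minimalPeriod π' x = Function.minimalPeriod π x := by
  refine Function.minimalPeriod_eq_minimalPeriod_iff.2 fun n => ?_
  rw [Function.IsPeriodicPt, Function.IsPeriodicPt, Function.IsFixedPt, Function.IsFixedPt,
    Equiv.Perm.iterate_eq_pow, Equiv.Perm.iterate_eq_pow, h]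

theorem loop_eq_of_pow_eq (M : Matrix α α ℍ) {π π' : Equiv.Perm α} {x : α}
    (h : ∀ k : ℕ, (π' ^ k) x = (π ^ k) x) : loop M π' x = loop M π x := by
  rw [loop, loop, minimalPeriod_eq_of_pow_eq h]
  exact pathProd_congr fun k _ => h k

/-- The points which are the smallest of their cycle. -/
noncomputable def cycleMins {n : ℕ} (π : Equiv.Perm (Fin n)) : Finset (Fin n) :=
  open Classical in Finset.univ.filter fun i => ∀ k : ℕ, i ≤ (π ^ k) i

theorem isTransversal_cycleMins {n : ℕ} (π : Equiv.Perm (Fin n)) :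
    IsTransversal π (cycleMins π) := by
  classical
  constructor
  · intro y
    obtain ⟨x, hx, hmin⟩ := (Finset.univ.filter fun x => π.SameCycle x y).exists_min_image id
      ⟨y, by simp [Equiv.Perm.SameCycle.refl]⟩
    simp only [Finset.mem_filter, Finset.mem_univ, true_and, id] at hx hmin
    refine ⟨x, ?_, hx⟩
    simp only [cycleMins, Finset.mem_filter, Finset.mem_univ, true_and]
    intro k
    exact hmin _ (by rwa [Equiv.Perm.sameCycle_pow_left])
  · intro x hx y hy h
    simp only [cycleMins, Finset.mem_filter, Finset.mem_univ, true_and] at hx hy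
    obtain ⟨k, hk⟩ := h.exists_nat_pow_eq
    obtain ⟨l, hl⟩ := h.symm.exists_nat_pow_eq
    exact le_antisymm (hk ▸ hx k) (hl ▸ hy l)

/-- The contribution of a permutation to the quaternion determinant, without its sign. -/
noncomputable def cycleWeight {n : ℕ} (M : Matrix (Fin n) (Fin n) ℍ) (π : Equiv.Perm (Fin n)) : ℝ :=
  ∏ i ∈ cycleMins π, (loop M π i).re

/-- The real part of a loop depends only on its cycle, so any choice of one base point per cycle may
replace the smallest elements. This frees the arguments below from the order of `Fin n`. -/
theorem cycleWeight_eq {n : ℕ} (M : Matrix (Fin n) (Fin n) ℍ) {π : Equiv.Perm (Fin n)}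
    {T : Finset (Fin n)} (hT : IsTransversal π T) :
    cycleWeight M π = ∏ i ∈ T, (loop M π i).re :=
  (isTransversal_cycleMins π).prod_eq hT _ fun _ _ h => re_loop_sameCycle M π h

theorem qdet_eq {n : ℕ} (M : Matrix (Fin n) (Fin n) ℍ) :
    qdet M = ∑ π : Equiv.Perm (Fin n), (Equiv.Perm.sign π : ℝ) * cycleWeight M π := rfl

/-- The quaternion determinant is invariant under simultaneous permutations of rows and columns. -/
theorem qdet_submatrix_perm {n : ℕ} (M : Matrix (Fin n) (Fin n) ℍ) (τ : Equiv.Perm (Fin n)) :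
    qdet (M.submatrix τ τ) = qdet M := by
  rw [qdet_eq, qdet_eq]
  conv_rhs => rw [← (MulAut.conj τ).toEquiv.sum_comp]
  refine Finset.sum_congr rfl fun π _ => ?_
  have hpow : ∀ (k : ℕ) x, ((MulAut.conj τ π) ^ k) (τ x) = τ ((π ^ k) x) := by
    intro k x
    rw [← map_pow]
    simp
  have hper : ∀ x, Function.minimalPeriod (MulAut.conj τ π) (τ x) = Function.minimalPeriod π x := by
    intro x
    refine Function.minimalPeriod_eq_minimalPeriod_iff.2 fun n => ?_
    rw [Function.IsPeriodicPt, Function.IsPeriodicPt, Function.IsFixedPt, Function.IsFixedPt,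
      Equiv.Perm.iterate_eq_pow, Equiv.Perm.iterate_eq_pow, hpow, τ.injective.eq_iff]
  -- The image by `τ` of the smallest points need not consist of smallest points, but it still meets
  -- each cycle of the conjugate exactly once.
  have hT : IsTransversal (MulAut.conj τ π) ((cycleMins π).map τ.toEmbedding) := by
    have h := isTransversal_cycleMins π
    have hs : ∀ x y, (MulAut.conj τ π).SameCycle (τ x) y ↔ π.SameCycle x (τ⁻¹ y) := by
      intro x y
      rw [MulAut.conj_apply, Equiv.Perm.sameCycle_conj]
      simp
    constructor
    · intro y
      obtain ⟨x, hx, hxy⟩ := h.exists_sameCycle (τ⁻¹ y)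
      exact ⟨τ x, by simpa using hx, (hs _ _).2 hxy⟩
    · intro x hx y hy hxy
      obtain ⟨x, hx', rfl⟩ := Finset.mem_map.1 hx
      obtain ⟨y, hy', rfl⟩ := Finset.mem_map.1 hy
      have := (hs _ _).1 hxy
      simp only [Equiv.coe_toEmbedding, Equiv.Perm.inv_def, Equiv.symm_apply_apply] at this
      rw [h.eq_of_sameCycle x hx' y hy' this]
  have h1 : (MulAut.conj τ).toEquiv π = MulAut.conj τ π := rfl
  rw [h1, cycleWeight_eq _ hT, Finset.prod_map, cycleWeight]
  congr 1
  · rw [MulAut.conj_apply, map_mul, map_mul, map_inv, mul_right_comm, mul_inv_cancel, one_mul]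
  · refine Finset.prod_congr rfl fun x _ => ?_
    rw [loop, loop, Equiv.coe_toEmbedding, hper]
    simp only [hpow]
    rfl

end Loops

/-! ### The quaternion determinant of a self-adjoint matrix with two equal rows -/

section EqualRows

set_option linter.unusedSectionVars false

variable {α : Type*} [Finite α] [DecidableEq α]

/-- From `a`, the permutation `π * swap a b` jumps to `π b`, then follows the cycle of `b` under `π`
until it reaches `b`, meeting neither `a` nor `b` before. -/
theorem pow_mul_swap_apply {π : Equiv.Perm α} {a b : α} (hab : ¬ π.SameCycle a b) {k : ℕ}
    (hk : 0 < k) (hk' : k ≤ Function.minimalPeriod π b) :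
    ((π * Equiv.swap a b) ^ k) a = (π ^ k) b := by
  induction k, hk using Nat.le_induction with
  | base => simp
  | succ k hk ih =>
    rw [pow_succ', pow_succ', Equiv.Perm.mul_apply, ih (by omega), Equiv.Perm.mul_apply,
      Equiv.Perm.mul_apply, Equiv.swap_apply_of_ne_of_ne]
    · intro h
      exact hab (Equiv.Perm.SameCycle.symm ⟨k, by simpa using h⟩)
    · intro h
      have := eq_of_pow_apply_eq (π := π) (x := b) (i := k) (j := 0) (by omega)
        (minimalPeriod_perm_pos _ _) (by simpa using h)
      omega

theorem pow_mul_swap_minimalPeriod {π : Equiv.Perm α} {a b : α} (hab : ¬ π.SameCycle a b) :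
    ((π * Equiv.swap a b) ^ Function.minimalPeriod π b) a = b := by
  rw [pow_mul_swap_apply hab (minimalPeriod_perm_pos _ _) le_rfl, pow_minimalPeriod_apply]

theorem sameCycle_mul_swap {π : Equiv.Perm α} {a b : α} (hab : ¬ π.SameCycle a b) :
    (π * Equiv.swap a b).SameCycle a b :=
  ⟨Function.minimalPeriod π b, by simpa using pow_mul_swap_minimalPeriod hab⟩

/-- If `b = π^k a`, the orbit of `a` under `π * swap a b` is `a, π^(k+1) a, π^(k+2) a, …`, which
closes up at `a` without meeting `b`. -/
theorem not_sameCycle_mul_swap {π : Equiv.Perm α} {a b : α} (hne : a ≠ b)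
    (hab : π.SameCycle a b) : ¬ (π * Equiv.swap a b).SameCycle a b := by
  obtain ⟨k, hk, hkb⟩ := exists_lt_minimalPeriod hab
  have hk0 : 0 < k := by
    rcases Nat.eq_zero_or_pos k with rfl | h
    · exact absurd hkb hne
    · exact h
  -- The point `a` itself is represented by `j` equal to the period rather than by `0`, so that the
  -- invariant `k < j` excludes `b`.
  have key : ∀ n : ℕ, ∃ j, k < j ∧ j ≤ Function.minimalPeriod π a ∧
      ((π * Equiv.swap a b) ^ n) a = (π ^ j) a := by
    intro n
    induction n with
    | zero => exact ⟨_, hk, le_rfl, by simp [pow_minimalPeriod_apply]⟩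
    | succ n ih =>
      obtain ⟨j, hj, hj', h⟩ := ih
      rcases hj'.lt_or_eq with hlt | rfl
      · refine ⟨j + 1, by omega, hlt, ?_⟩
        rw [pow_succ', pow_succ', Equiv.Perm.mul_apply, h, Equiv.Perm.mul_apply,
          Equiv.Perm.mul_apply, Equiv.swap_apply_of_ne_of_ne]
        · intro h0
          have := eq_of_pow_apply_eq (π := π) (x := a) (i := j) (j := 0) hlt
            (minimalPeriod_perm_pos _ _) (by simpa using h0)
          omega
        · intro h0
          have := eq_of_pow_apply_eq (π := π) (x := a) (i := j) (j := k) hlt hk (by rw [h0, hkb])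
          omega
      · refine ⟨k + 1, by omega, hk, ?_⟩
        rw [pow_succ', Equiv.Perm.mul_apply, h, pow_minimalPeriod_apply, Equiv.Perm.mul_apply,
          Equiv.swap_apply_left, pow_succ', Equiv.Perm.mul_apply, hkb]
  intro h
  obtain ⟨n, hn⟩ := h.exists_nat_pow_eq
  obtain ⟨j, hj, hj', hj2⟩ := key n
  rw [hn] at hj2
  rcases hj'.lt_or_eq with hlt | rfl
  · have := eq_of_pow_apply_eq (π := π) (x := a) hlt hk (by rw [← hj2, hkb])
    omega
  · rw [pow_minimalPeriod_apply] at hj2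
    exact hne hj2.symm

/-- After reaching `b`, the orbit jumps to `π a` and follows the cycle of `a` back to `a`. -/
theorem pow_add_mul_swap_apply {π : Equiv.Perm α} {a b : α} (hab : ¬ π.SameCycle a b) {k : ℕ}
    (hk : 0 < k) (hk' : k ≤ Function.minimalPeriod π a) :
    ((π * Equiv.swap a b) ^ (Function.minimalPeriod π b + k)) a = (π ^ k) a := by
  rw [add_comm, pow_add, Equiv.Perm.mul_apply, pow_mul_swap_minimalPeriod hab, Equiv.swap_comm,
    pow_mul_swap_apply (fun h => hab h.symm) hk hk']

theorem minimalPeriod_mul_swap {π : Equiv.Perm α} {a b : α} (hab : ¬ π.SameCycle a b) :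
    Function.minimalPeriod (π * Equiv.swap a b) a =
      Function.minimalPeriod π b + Function.minimalPeriod π a := by
  refine minimalPeriod_perm_eq (by have := minimalPeriod_perm_pos π a; omega) ?_ ?_
  · rw [pow_add_mul_swap_apply hab (minimalPeriod_perm_pos _ _) le_rfl, pow_minimalPeriod_apply]
  · intro k hk hk'
    rcases le_or_gt k (Function.minimalPeriod π b) with h | h
    · rw [pow_mul_swap_apply hab hk h]
      intro h0
      exact hab (Equiv.Perm.SameCycle.symm ⟨k, by simpa using h0⟩)
    · obtain ⟨j, rfl⟩ := Nat.exists_eq_add_of_lt h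
      rw [add_assoc, pow_add_mul_swap_apply hab (by omega) (by omega)]
      intro h0
      have := eq_of_pow_apply_eq (π := π) (x := a) (i := j + 1) (j := 0) (by omega)
        (minimalPeriod_perm_pos _ _) (by simpa using h0)
      omega

/-- The merged cycle runs through the cycle of `b`, then through that of `a`. Its only new edges are
`(a, π b)` and `(b, π a)`; since the rows `a` and `b` are equal, their entries are those of `(b, π
b)` and `(a, π a)`. -/
theorem loop_mul_swap {M : Matrix α α ℍ} {π : Equiv.Perm α} {a b : α}
    (hab : ¬ π.SameCycle a b) (hrow : ∀ j, M a j = M b j) :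
    loop M (π * Equiv.swap a b) a = loop M π b * loop M π a := by
  rw [loop, minimalPeriod_mul_swap hab, pathProd_add]
  congr 1
  · obtain ⟨r, hr⟩ := Nat.exists_eq_succ_of_ne_zero (minimalPeriod_perm_pos π b).ne'
    have h := fun k hk hk' => pow_mul_swap_apply (π := π) hab (k := k) hk hk'
    rw [loop, hr, Nat.succ_eq_add_one, pathProd_succ', pathProd_succ']
    rw [hr] at h
    congr 1
    · rw [h 1 one_pos (by omega)]
      exact hrow _
    · exact pathProd_congr fun k hk => h (k + 1) (by omega) (by omega)
  · obtain ⟨r, hr⟩ := Nat.exists_eq_succ_of_ne_zero (minimalPeriod_perm_pos π a).ne'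
    have h := fun k hk hk' => pow_add_mul_swap_apply (π := π) hab (k := k) hk hk'
    rw [loop, hr, Nat.succ_eq_add_one, pathProd_succ', pathProd_succ']
    rw [hr] at h
    congr 1
    · rw [h 1 one_pos (by omega), add_zero, pow_mul_swap_minimalPeriod hab]
      exact (hrow _).symm
    · exact pathProd_congr fun k hk => h (k + 1) (by omega) (by omega)

/-- The permutation obtained from `π` by reversing the cycle which contains `a`. -/
noncomputable def reverseCycle (π : Equiv.Perm α) (a : α) : Equiv.Perm α :=
  open Classical in (π.cycleOf a)⁻¹ * ((π.cycleOf a)⁻¹ * π)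

theorem reverseCycle_apply_of_sameCycle {π : Equiv.Perm α} {a x : α} (h : π.SameCycle a x) :
    reverseCycle π a x = π⁻¹ x := by
  classical
  have h1 : (π.cycleOf a)⁻¹ (π x) = x := by
    rw [Equiv.Perm.inv_eq_iff_eq, Equiv.Perm.cycleOf_apply, if_pos h]
  have h2 : (π.cycleOf a)⁻¹ x = π⁻¹ x := by
    rw [Equiv.Perm.inv_eq_iff_eq, Equiv.Perm.cycleOf_apply, if_pos]
    · simp
    · exact h.trans ⟨-1, by simp⟩
  rw [reverseCycle, Equiv.Perm.mul_apply, Equiv.Perm.mul_apply, ← h2]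
  congr 1

theorem reverseCycle_apply_of_not_sameCycle {π : Equiv.Perm α} {a x : α}
    (h : ¬ π.SameCycle a x) : reverseCycle π a x = π x := by
  classical
  have h1 : ∀ y, ¬ π.SameCycle a y → (π.cycleOf a)⁻¹ y = y := by
    intro y hy
    rw [Equiv.Perm.inv_eq_iff_eq, Equiv.Perm.cycleOf_apply, if_neg hy]
  have h2 : ¬ π.SameCycle a (π x) := by rwa [Equiv.Perm.sameCycle_apply_right]
  have h3 := h1 _ h2
  rw [reverseCycle, Equiv.Perm.mul_apply, Equiv.Perm.mul_apply]
  convert h3 using 2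

theorem reverseCycle_pow_of_sameCycle {π : Equiv.Perm α} {a x : α} (h : π.SameCycle a x)
    (k : ℕ) : (reverseCycle π a ^ k) x = (π⁻¹ ^ k) x :=
  (pow_eq_of_eqOn (S := {y | π.SameCycle a y}) (fun y hy =>
    ⟨Equiv.Perm.SameCycle.trans hy ⟨-1, by simp⟩, reverseCycle_apply_of_sameCycle hy⟩) h k).1

theorem reverseCycle_pow_of_not_sameCycle {π : Equiv.Perm α} {a x : α}
    (h : ¬ π.SameCycle a x) (k : ℕ) : (reverseCycle π a ^ k) x = (π ^ k) x :=
  (pow_eq_of_eqOn (S := {y | ¬ π.SameCycle a y}) (fun y hy =>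
    ⟨by simpa [Equiv.Perm.sameCycle_apply_right] using hy,
      reverseCycle_apply_of_not_sameCycle hy⟩) h k).1

theorem sameCycle_reverseCycle {π : Equiv.Perm α} {a x y : α} :
    (reverseCycle π a).SameCycle x y ↔ π.SameCycle x y := by
  have hk : ∀ {σ : Equiv.Perm α} {u v : α}, σ.SameCycle u v ↔ ∃ k : ℕ, (σ ^ k) u = v :=
    fun {σ u v} => ⟨fun h => h.exists_nat_pow_eq, fun ⟨k, hk⟩ => ⟨k, by simpa using hk⟩⟩
  by_cases h : π.SameCycle a x
  · rw [← Equiv.Perm.sameCycle_inv (f := π), hk, hk]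
    simp only [reverseCycle_pow_of_sameCycle h]
  · rw [hk, hk]
    simp only [reverseCycle_pow_of_not_sameCycle h]

theorem reverseCycle_reverseCycle (π : Equiv.Perm α) (a : α) :
    reverseCycle (reverseCycle π a) a = π := by
  ext x
  by_cases h : π.SameCycle a x
  · rw [reverseCycle_apply_of_sameCycle (sameCycle_reverseCycle.2 h), Equiv.Perm.inv_eq_iff_eq,
      reverseCycle_apply_of_sameCycle (by rwa [Equiv.Perm.sameCycle_apply_right])]
    simp
  · rw [reverseCycle_apply_of_not_sameCycle (fun h' => h (sameCycle_reverseCycle.1 h')),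
      reverseCycle_apply_of_not_sameCycle h]

theorem inv_pow_apply_eq_of_le {π : Equiv.Perm α} {a : α} {k : ℕ}
    (hk : k ≤ Function.minimalPeriod π a) :
    (π⁻¹ ^ k) a = (π ^ (Function.minimalPeriod π a - k)) a := by
  rw [inv_pow, Equiv.Perm.inv_eq_iff_eq, ← Equiv.Perm.mul_apply, ← pow_add,
    Nat.add_sub_cancel' hk, pow_minimalPeriod_apply]

theorem minimalPeriod_reverseCycle {π : Equiv.Perm α} {a : α} :
    Function.minimalPeriod (reverseCycle π a) a = Function.minimalPeriod π a := by
  refine Function.minimalPeriod_eq_minimalPeriod_iff.2 fun n => ?_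
  rw [Function.IsPeriodicPt, Function.IsPeriodicPt, Function.IsFixedPt, Function.IsFixedPt,
    Equiv.Perm.iterate_eq_pow, Equiv.Perm.iterate_eq_pow,
    reverseCycle_pow_of_sameCycle (Equiv.Perm.SameCycle.refl _ _), inv_pow,
    Equiv.Perm.inv_eq_iff_eq, eq_comm]

/-- For a self-adjoint matrix, running through a cycle backwards conjugates its loop. -/
theorem loop_reverseCycle {M : Matrix α α ℍ} (hM : ∀ i j, star (M i j) = M j i)
    (π : Equiv.Perm α) (a : α) : loop M (reverseCycle π a) a = star (loop M π a) := by
  rw [loop, loop, star_pathProd hM, minimalPeriod_reverseCycle]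
  refine pathProd_congr fun k hk => ?_
  rw [reverseCycle_pow_of_sameCycle (Equiv.Perm.SameCycle.refl _ _), inv_pow_apply_eq_of_le hk]

/-- The reversal multiplies `π` twice by the same permutation, and the two signs cancel. -/
theorem sign_reverseCycle [Fintype α] (π : Equiv.Perm α) (a : α) :
    Equiv.Perm.sign (reverseCycle π a) = Equiv.Perm.sign π := by
  rw [reverseCycle, map_mul, map_mul, map_inv, ← mul_assoc, ← mul_inv, Int.units_mul_self, inv_one,
    one_mul]

end EqualRows

/-- Since `2 ℜ x = x + star x` is real, `2 ℜ x ℜ y = ℜ(y (x + star x))`. This replaces a product of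
two cycle terms by two terms with a single merged cycle. -/
theorem two_mul_re_mul_re (x y : ℍ) :
    2 * (x.re * y.re) = (y * x).re + (y * star x).re := by
  simp [Quaternion.re_mul]; ring

/-- The quaternion determinant of a self-adjoint matrix with two equal rows vanishes. -/
theorem qdet_eq_zero_of_row_eq {n : ℕ} {M : Matrix (Fin n) (Fin n) ℍ}
    (hM : ∀ i j, star (M i j) = M j i) {a b : Fin n} (hne : a ≠ b) (hrow : ∀ j, M a j = M b j) :
    qdet M = 0 := by
  classical
  set S : Finset (Equiv.Perm (Fin n)) := Finset.univ.filter fun π => ¬ π.SameCycle a b with hS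
  have hmem : ∀ π, π ∈ S ↔ ¬ π.SameCycle a b := fun π => by simp [hS]
  -- a transversal which contains `a` and `b`
  have htrans : ∀ π ∈ S, ∃ T : Finset (Fin n), a ∉ T ∧ b ∉ T ∧
      IsTransversal π (insert a (insert b T)) := by
    intro π hπ
    have hab := (hmem π).1 hπ
    have h := isTransversal_cycleMins π
    refine ⟨(cycleMins π).filter fun x => ¬ π.SameCycle x a ∧ ¬ π.SameCycle x b, ?_, ?_, ?_, ?_⟩
    · simp [Equiv.Perm.SameCycle.refl]
    · simp [Equiv.Perm.SameCycle.refl]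
    · intro y
      by_cases ha : π.SameCycle a y
      · exact ⟨a, by simp, ha⟩
      by_cases hb : π.SameCycle b y
      · exact ⟨b, by simp, hb⟩
      obtain ⟨x, hx, hxy⟩ := h.exists_sameCycle y
      refine ⟨x, ?_, hxy⟩
      simp only [Finset.mem_insert, Finset.mem_filter]
      exact Or.inr (Or.inr ⟨hx, fun h => ha (h.symm.trans hxy), fun h => hb (h.symm.trans hxy)⟩)
    · intro x hx y hy hxy
      simp only [Finset.mem_insert, Finset.mem_filter] at hx hy
      rcases hx with rfl | rfl | ⟨hx, hxa, hxb⟩ <;> rcases hy with rfl | rfl | ⟨hy, hya, hyb⟩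
      · rfl
      · exact absurd hxy hab
      · exact absurd hxy.symm hya
      · exact absurd hxy.symm hab
      · rfl
      · exact absurd hxy.symm hyb
      · exact absurd hxy hxa
      · exact absurd hxy hxb
      · exact h.eq_of_sameCycle x hx y hy hxy
  -- With `x` and `y` the loops at `a` and `b`, merging the two cycles gives `yx`, and merging them
  -- after reversing the cycle of `a` gives `y (star x)`; the other cycles contribute a common
  -- factor.
  have hweight : ∀ π ∈ S, 2 * cycleWeight M π =
      cycleWeight M (π * Equiv.swap a b) +
        cycleWeight M (reverseCycle π a * Equiv.swap a b) := by
    intro π hπ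
    have hab := (hmem π).1 hπ
    obtain ⟨T, haT, hbT, hT⟩ := htrans π hπ
    have hTa : ∀ x ∈ T, ¬ π.SameCycle a x := fun x hx h =>
      haT (by rwa [hT.eq_of_sameCycle a (by simp) x (by simp [hx]) h])
    have hTb : ∀ x ∈ T, ¬ π.SameCycle b x := fun x hx h =>
      hbT (by rwa [hT.eq_of_sameCycle b (by simp) x (by simp [hx]) h])
    -- merging the cycles of `a` and `b`, in a permutation with the same cycles as `π`
    have hmerge : ∀ π' : Equiv.Perm (Fin n), (∀ x y, π'.SameCycle x y ↔ π.SameCycle x y) →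
        (∀ x ∈ T, ∀ k : ℕ, (π' ^ k) x = (π ^ k) x) →
        cycleWeight M (π' * Equiv.swap a b) =
          (loop M π' b * loop M π' a).re * ∏ x ∈ T, (loop M π x).re := by
      intro π' hcyc hpow
      have hab' : ¬ π'.SameCycle a b := by rwa [hcyc]
      have hpow' : ∀ x, ¬ π.SameCycle a x → ¬ π.SameCycle b x → ∀ k : ℕ,
          ((π' * Equiv.swap a b) ^ k) x = (π' ^ k) x := by
        intro x hxa hxb k
        refine (pow_eq_of_eqOn (S := {y | ¬ π'.SameCycle a y ∧ ¬ π'.SameCycle b y})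
          (fun y hy => ⟨?_, ?_⟩) (by simpa [hcyc] using ⟨hxa, hxb⟩) k).1
        · simpa [Equiv.Perm.sameCycle_apply_right] using hy
        · rw [Equiv.Perm.mul_apply, Equiv.swap_apply_of_ne_of_ne]
          · rintro rfl
            exact hy.1 (Equiv.Perm.SameCycle.refl _ _)
          · rintro rfl
            exact hy.2 (Equiv.Perm.SameCycle.refl _ _)
      have hT' : IsTransversal (π' * Equiv.swap a b) (insert a T) := by
        have hbase := sameCycle_mul_swap hab'
        constructor
        · intro y
          obtain ⟨x, hx, hxy⟩ := hT.exists_sameCycle y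
          rw [← hcyc] at hxy
          simp only [Finset.mem_insert] at hx
          rcases hx with rfl | rfl | hx
          · refine ⟨_, Finset.mem_insert_self _ _, ?_⟩
            obtain ⟨k, hk, rfl⟩ := exists_lt_minimalPeriod hxy
            rcases Nat.eq_zero_or_pos k with rfl | hk0
            · exact ⟨0, by simp⟩
            · exact ⟨(Function.minimalPeriod π' b + k : ℕ), by
                rw [zpow_natCast, pow_add_mul_swap_apply hab' hk0 hk.le]⟩
          · refine ⟨_, Finset.mem_insert_self _ _, ?_⟩
            obtain ⟨k, hk, rfl⟩ := exists_lt_minimalPeriod hxy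
            rcases Nat.eq_zero_or_pos k with rfl | hk0
            · simpa using hbase
            · exact ⟨(k : ℕ), by rw [zpow_natCast, pow_mul_swap_apply hab' hk0 hk.le]⟩
          · refine ⟨x, by simp [hx], ?_⟩
            obtain ⟨k, hk⟩ := hxy.exists_nat_pow_eq
            exact ⟨k, by rw [zpow_natCast, hpow' x (hTa x hx) (hTb x hx), hk]⟩
        · have hTx : ∀ x ∈ T, ∀ y, (π' * Equiv.swap a b).SameCycle x y → π.SameCycle x y := by
            intro x hx y hxy
            obtain ⟨k, hk⟩ := hxy.exists_nat_pow_eq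
            rw [hpow' x (hTa x hx) (hTb x hx)] at hk
            rw [← hcyc]
            exact ⟨k, by simpa using hk⟩
          intro x hx y hy hxy
          simp only [Finset.mem_insert] at hx hy
          rcases hx with rfl | hx <;> rcases hy with rfl | hy
          · rfl
          · exact absurd (hTx _ hy _ hxy.symm).symm (hTa _ hy)
          · exact absurd (hTx _ hx _ hxy).symm (hTa _ hx)
          · exact hT.eq_of_sameCycle x (by simp [hx]) y (by simp [hy]) (hTx x hx y hxy)
      rw [cycleWeight_eq M hT', Finset.prod_insert haT, loop_mul_swap hab' hrow]
      congr 1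
      refine Finset.prod_congr rfl fun x hx => ?_
      rw [loop_eq_of_pow_eq M (hpow' x (hTa x hx) (hTb x hx)), loop_eq_of_pow_eq M (hpow x hx)]
    rw [hmerge π (fun _ _ => Iff.rfl) (fun _ _ _ => rfl),
      hmerge (reverseCycle π a) (fun _ _ => sameCycle_reverseCycle)
        (fun x hx => reverseCycle_pow_of_not_sameCycle (hTa x hx)),
      loop_reverseCycle hM, loop_eq_of_pow_eq M (reverseCycle_pow_of_not_sameCycle hab),
      cycleWeight_eq M hT, Finset.prod_insert (by simp [hne, haT]), Finset.prod_insert hbT]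
    linear_combination (∏ x ∈ T, (loop M π x).re) * two_mul_re_mul_re (loop M π a) (loop M π b)
  -- Multiplication by `swap a b` exchanges the permutations that separate `a` from `b` with those
  -- that do not, and changes the sign.
  have hsplit : qdet M = ∑ π ∈ S, (Equiv.Perm.sign π : ℝ) * cycleWeight M π -
      ∑ π ∈ S, (Equiv.Perm.sign π : ℝ) * cycleWeight M (π * Equiv.swap a b) := by
    rw [qdet_eq, ← Finset.sum_filter_add_sum_filter_not Finset.univ
      (fun π : Equiv.Perm (Fin n) => ¬ π.SameCycle a b), sub_eq_add_neg, ← Finset.sum_neg_distrib]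
    congr 1
    symm
    refine Finset.sum_bij' (fun π _ => π * Equiv.swap a b) (fun π _ => π * Equiv.swap a b)
      ?_ ?_ ?_ ?_ ?_
    · intro π hπ
      simpa using sameCycle_mul_swap ((hmem π).1 hπ)
    · intro π hπ
      rw [hmem]
      exact not_sameCycle_mul_swap hne (by simpa using hπ)
    · intro π _
      simp [mul_assoc]
    · intro π _
      simp [mul_assoc]
    · intro π _
      simp [Equiv.Perm.sign_swap hne]
  -- Reversing the cycle of `a` is a sign-preserving involution of `S`, so both merged sums are
  -- equal, and each is then equal to the unmerged one.
  have hrev : ∑ π ∈ S, (Equiv.Perm.sign π : ℝ) * cycleWeight M (π * Equiv.swap a b) =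
      ∑ π ∈ S, (Equiv.Perm.sign π : ℝ) * cycleWeight M (reverseCycle π a * Equiv.swap a b) := by
    refine Finset.sum_bij' (fun π _ => reverseCycle π a) (fun π _ => reverseCycle π a)
      ?_ ?_ (fun π _ => reverseCycle_reverseCycle π a) (fun π _ => reverseCycle_reverseCycle π a) ?_
    · intro π hπ
      rw [hmem, sameCycle_reverseCycle]
      exact (hmem π).1 hπ
    · intro π hπ
      rw [hmem, sameCycle_reverseCycle]
      exact (hmem π).1 hπ
    · intro π _
      rw [reverseCycle_reverseCycle, sign_reverseCycle]
  have h2 : 2 * ∑ π ∈ S, (Equiv.Perm.sign π : ℝ) * cycleWeight M π =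
      ∑ π ∈ S, (Equiv.Perm.sign π : ℝ) * cycleWeight M (π * Equiv.swap a b) +
      ∑ π ∈ S, (Equiv.Perm.sign π : ℝ) * cycleWeight M (reverseCycle π a * Equiv.swap a b) := by
    rw [Finset.mul_sum, ← Finset.sum_add_distrib]
    refine Finset.sum_congr rfl fun π hπ => ?_
    linear_combination (Equiv.Perm.sign π : ℝ) * hweight π hπ
  rw [hsplit]
  linarith

/-! ### Sums of principal minors -/

section Traces

set_option linter.unusedSectionVars false

variable {α ι : Type*} [Fintype ι]

/-- The product of the entries of `A` along the path `i, g 0, …, g (r - 1), j`. -/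
noncomputable def finPath (A : Matrix ι ι ℍ) : (r : ℕ) → ι → (Fin r → ι) → ι → ℍ
  | 0, i, _, j => A i j
  | r + 1, i, g, j => A i (g 0) * finPath A r (g 0) (Fin.tail g) j

theorem sum_finPath [DecidableEq ι] (A : Matrix ι ι ℍ) (r : ℕ) (i j : ι) :
    ∑ g : Fin r → ι, finPath A r i g j = (A ^ (r + 1)) i j := by
  induction r generalizing i with
  | zero => simp [finPath]
  | succ r ih =>
    rw [← (Fin.consEquiv fun _ : Fin (r + 1) => ι).sum_comp, Fintype.sum_prod_type, pow_succ',
      Matrix.mul_apply]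
    refine Finset.sum_congr rfl fun k _ => ?_
    rw [← ih, Finset.mul_sum]
    exact Finset.sum_congr rfl fun g _ => by simp [Fin.consEquiv, finPath]

theorem pathProd_eq_finPath (A : Matrix ι ι ℍ) (h : ℕ → ι) (r : ℕ) :
    pathProd A h (r + 1) = finPath A r (h 0) (fun k => h (k + 1)) (h (r + 1)) := by
  induction r generalizing h with
  | zero => simp [pathProd_succ, pathProd_zero, finPath]
  | succ r ih =>
    rw [pathProd_succ', ih, finPath]
    rfl

/-- The product of the entries of `A` along the closed path `g 0, …, g (r - 1), g 0`. -/
noncomputable def closedPath (A : Matrix ι ι ℍ) : (r : ℕ) → (Fin r → ι) → ℍ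
  | 0, _ => 1
  | r + 1, g => finPath A r (g 0) (Fin.tail g) (g 0)

theorem sum_closedPath [DecidableEq ι] (A : Matrix ι ι ℍ) {r : ℕ} (hr : 0 < r) :
    ∑ g : Fin r → ι, closedPath A r g = ∑ i, (A ^ r) i i := by
  obtain ⟨r, rfl⟩ := Nat.exists_eq_succ_of_ne_zero hr.ne'
  rw [Nat.succ_eq_add_one, ← (Fin.consEquiv fun _ : Fin (r + 1) => ι).sum_comp,
    Fintype.sum_prod_type]
  refine Finset.sum_congr rfl fun k _ => ?_
  rw [← sum_finPath]
  exact Finset.sum_congr rfl fun g _ => by simp [Fin.consEquiv, closedPath]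

theorem loop_submatrix [Finite α] (A : Matrix ι ι ℍ) (f : α → ι) (π : Equiv.Perm α) (x : α) :
    loop (A.submatrix f f) π x =
      closedPath A (Function.minimalPeriod π x) fun k => f ((π ^ (k : ℕ)) x) := by
  have h1 : ∀ r, pathProd (A.submatrix f f) (fun k => (π ^ k) x) r =
      pathProd A (fun k => f ((π ^ k) x)) r := fun r => rfl
  have hx := pow_minimalPeriod_apply π x
  rw [loop, h1]
  obtain ⟨r, hr⟩ := Nat.exists_eq_succ_of_ne_zero (minimalPeriod_perm_pos π x).ne'
  generalize Function.minimalPeriod π x = p at hr hx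
  subst hr
  rw [Nat.succ_eq_add_one] at hx ⊢
  rw [pathProd_eq_finPath, closedPath, hx]
  rfl

/-- A point is determined by the representative of its cycle and by its position in this cycle. -/
noncomputable def cycleEquiv [Finite α] {π : Equiv.Perm α} {T : Finset α}
    (hT : IsTransversal π T) : (Σ x : T, Fin (Function.minimalPeriod π (x : α))) ≃ α :=
  Equiv.ofBijective (fun p => (π ^ (p.2 : ℕ)) (p.1 : α)) <| by
    constructor
    · rintro ⟨x, k⟩ ⟨y, l⟩ h
      simp only at h
      have hxy : x = y := by
        refine Subtype.ext (hT.eq_of_sameCycle x x.2 y y.2 ?_)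
        have h1 : π.SameCycle (x : α) ((π ^ (k : ℕ)) (x : α)) := ⟨k, by simp⟩
        have h2 : π.SameCycle (y : α) ((π ^ (l : ℕ)) (y : α)) := ⟨l, by simp⟩
        rw [h] at h1
        exact h1.trans h2.symm
      subst hxy
      rw [Fin.ext (eq_of_pow_apply_eq k.2 l.2 h)]
    · intro y
      obtain ⟨x, hx, hxy⟩ := hT.exists_sameCycle y
      obtain ⟨k, hk, h⟩ := exists_lt_minimalPeriod hxy
      exact ⟨⟨⟨x, hx⟩, ⟨k, hk⟩⟩, h⟩

/-- A map from `α` to `ι` is an independent choice of a closed path for each cycle of `π`. The sum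
of the products is thus a product of sums, and summing over the closed paths of length `r` gives the
trace of `A^r`. -/
theorem sum_prod_re_loop [Fintype α] [DecidableEq α] [DecidableEq ι] (A : Matrix ι ι ℍ)
    {π : Equiv.Perm α} {T : Finset α} (hT : IsTransversal π T) :
    ∑ f : α → ι, ∏ x ∈ T, (loop (A.submatrix f f) π x).re =
      ∏ x ∈ T, (∑ i, (A ^ Function.minimalPeriod π x) i i).re := by
  simp only [loop_submatrix]
  let e : (α → ι) ≃ ∀ x : T, Fin (Function.minimalPeriod π (x : α)) → ι :=
    ((cycleEquiv hT).symm.arrowCongr (Equiv.refl ι)).trans (Equiv.piCurry fun _ _ => ι)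
  have he : ∀ f (x : T), e f x = fun k : Fin (Function.minimalPeriod π (x : α)) => f ((π ^ (k : ℕ)) (x : α)) := fun f x => rfl
  have h1 : ∀ f : α → ι, ∏ x ∈ T, (closedPath A (Function.minimalPeriod π x)
      fun k => f ((π ^ (k : ℕ)) x)).re =
      ∏ x : T, (closedPath A (Function.minimalPeriod π (x : α)) (e f x)).re := by
    intro f
    rw [← Finset.prod_coe_sort]
    simp only [he]
  simp only [h1]
  rw [e.sum_comp fun g => ∏ x : T, (closedPath A (Function.minimalPeriod π (x : α)) (g x)).re]
  rw [← Finset.prod_coe_sort]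
  simp only [← sum_closedPath A (minimalPeriod_perm_pos π _), re_sum]
  rw [Finset.prod_univ_sum, Fintype.piFinset_univ]

/-- The sum of the quaternion determinants of all the matrices extracted from `A` can be expressed
in terms of the real traces of the powers of `A`. -/
theorem sum_qdet_submatrix [DecidableEq ι] (A : Matrix ι ι ℍ) (m : ℕ) :
    ∑ f : Fin m → ι, qdet (A.submatrix f f) =
      ∑ π : Equiv.Perm (Fin m), (Equiv.Perm.sign π : ℝ) *
        ∏ x ∈ cycleMins π, (∑ i, (A ^ Function.minimalPeriod π x) i i).re := by
  simp only [qdet_eq]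
  rw [Finset.sum_comm]
  refine Finset.sum_congr rfl fun π _ => ?_
  rw [← Finset.mul_sum, ← sum_prod_re_loop A (isTransversal_cycleMins π)]
  rfl

/-- The sum of the principal minors of size `m` of a self-adjoint matrix. -/
theorem sum_powersetCard_qdet [DecidableEq ι] {A : Matrix ι ι ℍ}
    (hA : ∀ i j, star (A i j) = A j i) {m : ℕ} (q : Finset ι → ℝ)
    (hq : ∀ f : Fin m → ι, Function.Injective f →
      q (Finset.univ.image f) = qdet (A.submatrix f f)) :
    (m.factorial : ℝ) * ∑ J ∈ Finset.univ.powersetCard m, q J =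
      ∑ f : Fin m → ι, qdet (A.submatrix f f) := by
  classical
  -- A non-injective map extracts a self-adjoint matrix with two equal rows.
  have h0 : ∀ f : Fin m → ι, ¬ Function.Injective f → qdet (A.submatrix f f) = 0 := by
    intro f hf
    obtain ⟨a, b, hab, hne⟩ := Function.not_injective_iff.1 hf
    exact qdet_eq_zero_of_row_eq (fun i j => hA _ _) hne fun j => by simp [hab]
  rw [← Finset.sum_filter_add_sum_filter_not Finset.univ fun f : Fin m → ι => Function.Injective f,
    Finset.sum_eq_zero (s := Finset.univ.filter fun f : Fin m → ι => ¬ Function.Injective f)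
      (fun f hf => h0 f (by simpa using hf)), add_zero]
  have hmaps : ∀ f ∈ Finset.univ.filter (fun f : Fin m → ι => Function.Injective f),
      Finset.univ.image f ∈ Finset.univ.powersetCard m := by
    intro f hf
    rw [Finset.mem_powersetCard]
    exact ⟨Finset.subset_univ _, by
      rw [Finset.card_image_of_injective _ (by simpa using hf)]; simp⟩
  rw [← Finset.sum_fiberwise_of_maps_to hmaps, Finset.mul_sum]
  refine Finset.sum_congr rfl fun J hJ => ?_
  have hJc : J.card = m := (Finset.mem_powersetCard.1 hJ).2
  -- The injective maps with image `J` are the bijections from `Fin m` to `J`.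
  have hcard : ((Finset.univ.filter fun f : Fin m → ι => Function.Injective f).filter
      fun f => Finset.univ.image f = J).card = m.factorial := by
    have e : {f // f ∈ (Finset.univ.filter fun f : Fin m → ι => Function.Injective f).filter
        fun f => Finset.univ.image f = J} ≃ (Fin m ≃ J) :=
      { toFun := fun f => Equiv.ofBijective
          (fun i => ⟨f.1 i, by
            have h := (Finset.mem_filter.1 f.2).2
            exact h.le (by simp)⟩)
          ⟨fun i j hij => by
            have h := (Finset.mem_filter.1 (Finset.mem_filter.1 f.2).1).2
            exact h (congrArg Subtype.val hij),
          fun y => by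
            have h := (Finset.mem_filter.1 f.2).2
            obtain ⟨i, -, hi⟩ := Finset.mem_image.1 (h.ge y.2)
            exact ⟨i, Subtype.ext hi⟩⟩
        invFun := fun e => ⟨fun i => (e i : ι), by
          simp only [Finset.mem_filter, Finset.mem_univ, true_and]
          refine ⟨fun i j hij => e.injective (Subtype.ext hij), ?_⟩
          ext y
          simp only [Finset.mem_image, Finset.mem_univ, true_and]
          exact ⟨fun ⟨i, hi⟩ => hi ▸ (e i).2, fun hy => ⟨e.symm ⟨y, hy⟩, by simp⟩⟩⟩
        left_inv := fun f => rfl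
        right_inv := fun e => by ext; rfl }
    rw [← Fintype.card_coe, Fintype.card_congr e,
      Fintype.card_equiv (J.equivFinOfCardEq hJc).symm, Fintype.card_fin]
  rw [Finset.sum_congr rfl (g := fun _ => q J), Finset.sum_const, hcard, nsmul_eq_mul]
  intro f hf
  simp only [Finset.mem_filter, Finset.mem_univ, true_and] at hf
  rw [← hf.2, hq f hf.1]

end Traces

/-! ### The quaternion determinant of an endomorphism -/

section Endomorphisms

set_option linter.unusedSectionVars false

variable {E : Type*} [AddCommGroup E] [Module ℍᵐᵒᵖ E] [QInner E]
variable {F : Type*} [AddCommGroup F] [Module ℍᵐᵒᵖ F] [QInner F]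
variable {ι : Type*} [Fintype ι]

/-- The endomorphism `a` is self-adjoint. -/
def IsSelfAdj (a : E →ₗ[ℍᵐᵒᵖ] E) : Prop := ∀ v w, qinner v (a w) = qinner (a v) w

/-- The matrix of the endomorphism `a` in the family `e`. -/
noncomputable def mat {κ : Type*} (e : κ → E) (a : E →ₗ[ℍᵐᵒᵖ] E) : Matrix κ κ ℍ :=
  Matrix.of fun i j => qinner (e i) (a (e j))

theorem IsSelfAdj.star_mat {κ : Type*} {a : E →ₗ[ℍᵐᵒᵖ] E} (ha : IsSelfAdj a) (e : κ → E)
    (i j : κ) : star (mat e a i j) = mat e a j i := by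
  simp only [mat, Matrix.of_apply]
  rw [star_qinner, ha]

theorem IsONB.mat_pow [DecidableEq ι] {e : ι → E} (he : IsONB e) (a : Module.End ℍᵐᵒᵖ E) (r : ℕ) :
    mat e (a ^ r) = mat e a ^ r := by
  induction r with
  | zero =>
    ext1 i j
    simp only [pow_zero, mat, Matrix.of_apply, Module.End.one_apply]
    by_cases h : i = j
    · subst h; rw [Matrix.one_apply_eq, he.orthonormal.1]
    · rw [Matrix.one_apply_ne h, he.orthonormal.2 _ _ h]
  | succ r ih =>
    ext1 i j
    rw [pow_succ (mat e a), Matrix.mul_apply, ← ih]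
    simp only [mat, Matrix.of_apply, pow_succ, Module.End.mul_apply]
    conv_lhs => rw [← he.sum_eq (a (e j))]
    simp only [map_sum, map_smul, qinner_sum_right, qinner_smul_right]

variable [Module.Finite ℍᵐᵒᵖ E] [Module.Finite ℍᵐᵒᵖ F]

/-- The real part of the trace of an endomorphism. -/
noncomputable def retr (a : E →ₗ[ℍᵐᵒᵖ] E) : ℝ := ∑ i, (qinner (onb E i) (a (onb E i))).re

theorem retr_comp_comm (u : E →ₗ[ℍᵐᵒᵖ] F) (v : F →ₗ[ℍᵐᵒᵖ] E) : retr (v ∘ₗ u) = retr (u ∘ₗ v) :=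
  sum_re_qinner_comp isONB_onb isONB_onb u v

theorem IsONB.retr_eq {e : ι → E} (he : IsONB e) (a : E →ₗ[ℍᵐᵒᵖ] E) :
    retr a = ∑ i, (qinner (e i) (a (e i))).re :=
  sum_re_qinner_comp isONB_onb he a LinearMap.id

/-- The elementary symmetric function of degree `m`, up to the factor `m!`, expressed in terms of
the real traces of powers. -/
noncomputable def traceSum (m : ℕ) (a : Module.End ℍᵐᵒᵖ E) : ℝ :=
  ∑ π : Equiv.Perm (Fin m), (Equiv.Perm.sign π : ℝ) *
    ∏ x ∈ cycleMins π, retr (a ^ Function.minimalPeriod π x)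

/-- The right-hand side involves only real traces of powers, and thus not the basis. -/
theorem IsONB.sum_qdet_mat {e : ι → E} (he : IsONB e) (a : Module.End ℍᵐᵒᵖ E) (m : ℕ) :
    ∑ f : Fin m → ι, qdet ((mat e a).submatrix f f) = traceSum m a := by
  classical
  rw [sum_qdet_submatrix, traceSum]
  refine Finset.sum_congr rfl fun π _ => ?_
  congr 1
  refine Finset.prod_congr rfl fun x _ => ?_
  rw [← he.mat_pow, he.retr_eq, re_sum]
  rfl

/-- In top degree the only subset is the whole index set, so a single principal minor remains:
`det_ℜ` itself is a function of the real traces of powers. -/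
theorem IsONB.factorial_mul_qdet_mat {m : ℕ} {e : Fin m → E} (he : IsONB e)
    {a : Module.End ℍᵐᵒᵖ E} (ha : IsSelfAdj a) :
    (m.factorial : ℝ) * qdet (mat e a) = traceSum m a := by
  rw [← he.sum_qdet_mat a m, ← sum_powersetCard_qdet (ha.star_mat e) fun _ => qdet (mat e a)]
  · have h : (Finset.univ : Finset (Fin m)).powersetCard m = {Finset.univ} := by
      have h := Finset.powersetCard_self (Finset.univ : Finset (Fin m))
      rwa [Finset.card_fin] at h
    rw [h, Finset.sum_singleton]
  · intro f hf
    exact (qdet_submatrix_perm (mat e a)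
      (Equiv.ofBijective f (Finite.injective_iff_bijective.1 hf))).symm

/-- The independence of `qdetEnd` from the chosen basis `onb E`: the matrices in two orthonormal
bases give the same `traceSum`. -/
theorem IsONB.qdetEnd_eq {m : ℕ} {e : Fin m → E} (he : IsONB e) {a : E →ₗ[ℍᵐᵒᵖ] E}
    (ha : IsSelfAdj a) : qdetEnd a = qdet (mat e a) := by
  have hm : Module.finrank ℍᵐᵒᵖ E = m := by rw [he.finrank_eq, Fintype.card_fin]
  subst hm
  have h1 := he.factorial_mul_qdet_mat ha
  have h2 := (isONB_onb (E := E)).factorial_mul_qdet_mat ha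
  have h3 : qdetEnd a = qdet (mat (onb E) a) := rfl
  rw [h3]
  exact mul_left_cancel₀ (Nat.cast_ne_zero.2 (Nat.factorial_ne_zero _)) (h2.trans h1.symm)

theorem qdetEnd_eq_traceSum {a : Module.End ℍᵐᵒᵖ E} (ha : IsSelfAdj a) :
    qdetEnd a =
      traceSum (Module.finrank ℍᵐᵒᵖ E) a / (Module.finrank ℍᵐᵒᵖ E).factorial := by
  rw [eq_div_iff (Nat.cast_ne_zero.2 (Nat.factorial_ne_zero _)), mul_comm]
  exact (isONB_onb (E := E)).factorial_mul_qdet_mat ha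

/-! ### Orthogonal projections and compressions -/

theorem orthProj_mem (Q : Submodule ℍᵐᵒᵖ E) (w : E) : orthProj Q w ∈ Q :=
  (orthProjOnto Q w).2

theorem sub_orthProj_mem (Q : Submodule ℍᵐᵒᵖ E) (w : E) : w - orthProj Q w ∈ orth Q := by
  have h := Submodule.projection_add_projection_eq_self (isCompl_orth Q) w
  have h2 : w - orthProj Q w = (orth Q).projection Q (isCompl_orth Q).symm w :=
    sub_eq_of_eq_add' h.symm
  rw [h2]
  exact Submodule.projection_apply_mem _ _

theorem qinner_orthProj {Q : Submodule ℍᵐᵒᵖ E} {r : E} (hr : r ∈ Q) (w : E) :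
    qinner r (orthProj Q w) = qinner r w := by
  have h := sub_orthProj_mem Q w r hr
  rw [qinner_sub_right, sub_eq_zero] at h
  exact h.symm

theorem qinner_orthProj_left {Q : Submodule ℍᵐᵒᵖ E} {r : E} (hr : r ∈ Q) (w : E) :
    qinner (orthProj Q w) r = qinner w r := by
  rw [← star_qinner, qinner_orthProj hr, star_qinner]

theorem isSelfAdj_orthProj (Q : Submodule ℍᵐᵒᵖ E) : IsSelfAdj (orthProj Q) := fun v w => by
  rw [← qinner_orthProj (orthProj_mem Q v), qinner_orthProj_left (orthProj_mem Q w)]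

theorem orthProj_eq_of_mem {Q : Submodule ℍᵐᵒᵖ E} {w x : E} (hx : x ∈ Q)
    (h : ∀ r ∈ Q, qinner r x = qinner r w) : orthProj Q w = x := by
  rw [← sub_eq_zero]
  apply qinner_self_eq_zero
  have hm : orthProj Q w - x ∈ Q := Q.sub_mem (orthProj_mem Q w) hx
  rw [qinner_sub_right, qinner_orthProj hm, h _ hm, sub_self]

theorem orthProj_of_mem {Q : Submodule ℍᵐᵒᵖ E} {w : E} (hw : w ∈ Q) : orthProj Q w = w :=
  orthProj_eq_of_mem hw fun _ _ => rfl

theorem orthProj_of_mem_orth {Q : Submodule ℍᵐᵒᵖ E} {w : E} (hw : w ∈ orth Q) :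
    orthProj Q w = 0 :=
  orthProj_eq_of_mem Q.zero_mem fun r hr => by rw [hw r hr, qinner_zero_right]

theorem mem_orth_of_orthProj {Q : Submodule ℍᵐᵒᵖ E} {w : E} (hw : orthProj Q w = 0) :
    w ∈ orth Q := fun r hr => by rw [← qinner_orthProj hr, hw, qinner_zero_right]

theorem coe_orthProjOnto (Q : Submodule ℍᵐᵒᵖ E) (w : E) : (orthProjOnto Q w : E) = orthProj Q w :=
  rfl

theorem coe_qinner (Q : Submodule ℍᵐᵒᵖ E) (v w : Q) : qinner v w = qinner (v : E) (w : E) := rfl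

theorem qinner_orthProjOnto {Q : Submodule ℍᵐᵒᵖ E} (r : Q) (w : E) :
    qinner r (orthProjOnto Q w) = qinner (r : E) w :=
  qinner_orthProj r.2 w

theorem IsSelfAdj.compress {a : E →ₗ[ℍᵐᵒᵖ] E} (ha : IsSelfAdj a) (Q : Submodule ℍᵐᵒᵖ E) :
    IsSelfAdj (compress a Q) := fun v w => by
  have h := fun (v w : Q) => qinner_orthProjOnto v (a w)
  have h1 : qinner v (QDLP.compress a Q w) = qinner (v : E) (a w) := h v w
  have h2 : qinner w (QDLP.compress a Q v) = qinner (w : E) (a v) := h w v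
  rw [h1, ← star_qinner w (QDLP.compress a Q v), h2, star_qinner, ha]

theorem IsOrthonormal.qdetEnd_compress {m : ℕ} {g : Fin m → E} (hg : IsOrthonormal g)
    {R : Submodule ℍᵐᵒᵖ E} (hR : Submodule.span ℍᵐᵒᵖ (Set.range g) = R) {a : E →ₗ[ℍᵐᵒᵖ] E}
    (ha : IsSelfAdj a) : qdetEnd (compress a R) = qdet (mat g a) := by
  subst hR
  set R := Submodule.span ℍᵐᵒᵖ (Set.range g)
  have hmem : ∀ i, g i ∈ R := fun i => Submodule.subset_span ⟨i, rfl⟩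
  have ho : IsOrthonormal (fun i => (⟨g i, hmem i⟩ : R)) := ⟨hg.1, hg.2⟩
  have he : IsONB (fun i => (⟨g i, hmem i⟩ : R)) :=
    ho.isONB_of_card (finrank_span_eq_card hg.linearIndependent).symm
  rw [he.qdetEnd_eq (ha.compress R)]
  congr 1
  ext1 i j
  exact qinner_orthProjOnto (⟨g i, hmem i⟩ : R) (a (g j))

theorem IsOrthonormal.comp {κ ι : Type*} {e : ι → E} (he : IsOrthonormal e) {f : κ → ι}
    (hf : Function.Injective f) : IsOrthonormal (e ∘ f) :=
  ⟨fun _ => he.1 _, fun _ _ hij => he.2 _ _ fun h => hij (hf h)⟩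

/-- The sum of the determinants of the compressions of a self-adjoint endomorphism to the
`m`-dimensional coordinate subspaces of an orthonormal basis does not depend on this basis. -/
theorem IsONB.sum_qdetEnd_compress {e : ι → E} (he : IsONB e)
    {a : Module.End ℍᵐᵒᵖ E} (ha : IsSelfAdj a) (m : ℕ) :
    ∑ J ∈ (Finset.univ : Finset ι).powersetCard m,
      qdetEnd (compress a (Submodule.span ℍᵐᵒᵖ (e '' (J : Set ι)))) =
      traceSum m a / m.factorial := by
  classical
  rw [eq_div_iff (Nat.cast_ne_zero.2 (Nat.factorial_ne_zero _)), mul_comm, ← he.sum_qdet_mat a m]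
  refine sum_powersetCard_qdet (ha.star_mat e)
    (fun J => qdetEnd (compress a (Submodule.span ℍᵐᵒᵖ (e '' (J : Set ι))))) fun f hf => ?_
  rw [(he.orthonormal.comp hf).qdetEnd_compress _ ha]
  · rfl
  · rw [Set.range_comp]
    simp

/-! ### Cyclicity of the trace sums -/

theorem comp_pow_succ_eq (u : E →ₗ[ℍᵐᵒᵖ] F) (v : F →ₗ[ℍᵐᵒᵖ] E) (r : ℕ) :
    ((u ∘ₗ v : Module.End ℍᵐᵒᵖ F) ^ (r + 1)) =
      u ∘ₗ ((v ∘ₗ u : Module.End ℍᵐᵒᵖ E) ^ r) ∘ₗ v := by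
  induction r with
  | zero => ext; simp
  | succ r ih =>
    rw [pow_succ, ih, pow_succ (v ∘ₗ u : Module.End ℍᵐᵒᵖ E) r]
    ext
    simp

/-- The exponent `0` must be excluded, as it would compare the dimensions of `E` and `F`; cycles
always have positive length. -/
theorem retr_pow_comp_comm (u : E →ₗ[ℍᵐᵒᵖ] F) (v : F →ₗ[ℍᵐᵒᵖ] E) {r : ℕ} (hr : 0 < r) :
    retr ((u ∘ₗ v : Module.End ℍᵐᵒᵖ F) ^ r) = retr ((v ∘ₗ u : Module.End ℍᵐᵒᵖ E) ^ r) := by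
  obtain ⟨r, rfl⟩ := Nat.exists_eq_succ_of_ne_zero hr.ne'
  rw [Nat.succ_eq_add_one, comp_pow_succ_eq, retr_comp_comm, pow_succ]
  rfl

theorem traceSum_comp_comm (m : ℕ) (u : E →ₗ[ℍᵐᵒᵖ] F) (v : F →ₗ[ℍᵐᵒᵖ] E) :
    traceSum m (u ∘ₗ v) = traceSum m (v ∘ₗ u) := by
  rw [traceSum, traceSum]
  refine Finset.sum_congr rfl fun π _ => ?_
  congr 1
  exact Finset.prod_congr rfl fun x _ => retr_pow_comp_comm u v (minimalPeriod_perm_pos π x)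

/-- By cyclicity, the compression to `R` may be replaced by `a Π_R`, which acts on the fixed space
`E`. For a fixed dimension of `R`, this makes the determinant a polynomial in the matrix
coefficients of `Π_R`, hence continuous. -/
theorem qdetEnd_compress_eq_traceSum {a : Module.End ℍᵐᵒᵖ E} (ha : IsSelfAdj a)
    (R : Submodule ℍᵐᵒᵖ E) :
    qdetEnd (compress a R) = traceSum (Module.finrank ℍᵐᵒᵖ R) (a * orthProj R) /
      (Module.finrank ℍᵐᵒᵖ R).factorial := by
  rw [qdetEnd_eq_traceSum (ha.compress R), compress, traceSum_comp_comm]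
  rfl

end Endomorphisms

/-! ### The spectral theorem -/

/-- For the real inner product `ℜ⟨v, w⟩`, the map `a` is a symmetric real endomorphism, so it has a
real eigenvalue; a real scalar is also a quaternionic one. -/
theorem IsSelfAdj.exists_eigenvector {E : Type*} [AddCommGroup E] [Module ℍᵐᵒᵖ E] [QInner E]
    [Module.Finite ℍᵐᵒᵖ E] [Nontrivial E] {a : E →ₗ[ℍᵐᵒᵖ] E} (ha : IsSelfAdj a) :
    ∃ (v : E) (c : ℝ), v ≠ 0 ∧ a v = v <• (c : ℍ) := by
  let : Module ℝ E := Module.compHom E (algebraMap ℝ ℍᵐᵒᵖ)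
  have hsmul : ∀ (r : ℝ) (v : E), r • v = v <• (r : ℍ) := fun r v => rfl
  have : IsScalarTower ℝ ℍᵐᵒᵖ E := ⟨fun r q v => by
    rw [Algebra.smul_def, mul_smul]; rfl⟩
  have : Module.Finite ℝ ℍᵐᵒᵖ := Module.Finite.equiv (MulOpposite.opLinearEquiv ℝ : ℍ ≃ₗ[ℝ] ℍᵐᵒᵖ)
  have : Module.Finite ℝ E := Module.Finite.trans ℍᵐᵒᵖ E
  let core : InnerProductSpace.Core ℝ E :=
    { inner := fun v w => (qinner v w).re
      conj_inner_symm := fun v w => by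
        rw [← star_qinner, Quaternion.re_star]; rfl
      re_inner_nonneg := fun v => by
        obtain ⟨r, hr, h⟩ := qinner_self_nonneg v
        rw [h]; exact hr
      add_left := fun v v' w => by rw [qinner_add_left]; rfl
      smul_left := fun v w r => by
        rw [hsmul, qinner_smul_left, Quaternion.star_coe, Quaternion.coe_mul_eq_smul]; rfl
      definite := fun v h => by
        obtain ⟨r, hr, h'⟩ := qinner_self_nonneg v
        rw [h'] at h
        have h0 : r = 0 := h
        exact qinner_self_eq_zero v (by rw [h', h0]; rfl) }
  let : NormedAddCommGroup E := core.toNormedAddCommGroup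
  let : InnerProductSpace ℝ E := InnerProductSpace.ofCore core.toCore
  let T : E →ₗ[ℝ] E :=
    { toFun := a
      map_add' := a.map_add
      map_smul' := fun r v => a.map_smul _ v }
  have hT : T.IsSymmetric := fun v w => congrArg QuaternionAlgebra.re (ha v w).symm
  obtain ⟨v, hv⟩ := hT.hasEigenvalue_iSup_of_finiteDimensional.exists_hasEigenvector
  exact ⟨v, _, hv.2, hv.apply_eq_smul⟩

section Spectral

variable {E : Type*} [AddCommGroup E] [Module ℍᵐᵒᵖ E] [QInner E]

theorem exists_normalize {v : E} (hv : v ≠ 0) :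
    ∃ c : ℝ, qinner (v <• (c : ℍ)) (v <• (c : ℍ)) = 1 := by
  obtain ⟨r, hr, h⟩ := qinner_self_nonneg v
  have hr0 : r ≠ 0 := fun h0 => hv (qinner_self_eq_zero v (by rw [h, h0]; rfl))
  refine ⟨(Real.sqrt r)⁻¹, ?_⟩
  rw [qinner_smul_smul, h, Quaternion.star_coe, ← Quaternion.coe_mul, ← Quaternion.coe_mul,
    ← Quaternion.coe_one]
  congr 1
  have : Real.sqrt r ≠ 0 := (Real.sqrt_ne_zero hr).2 hr0
  field_simp
  exact (Real.sq_sqrt hr).symm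

theorem IsOrthonormal.snoc {n : ℕ} {e : Fin n → E} (he : IsOrthonormal e) {w : E}
    (hw : qinner w w = 1) (hew : ∀ i, qinner (e i) w = 0) :
    IsOrthonormal (Fin.snoc e w : Fin (n + 1) → E) := by
  refine ⟨fun i => ?_, fun i j => ?_⟩
  · refine Fin.lastCases ?_ (fun i => ?_) i
    · simpa only [Fin.snoc_last] using hw
    · simpa only [Fin.snoc_castSucc] using he.1 i
  · refine Fin.lastCases ?_ (fun i => ?_) i <;> refine Fin.lastCases ?_ (fun j => ?_) j
    · simp
    · intro _
      simp only [Fin.snoc_last, Fin.snoc_castSucc]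
      rw [← star_qinner, hew, star_zero]
    · intro _
      simpa only [Fin.snoc_last, Fin.snoc_castSucc] using hew i
    · intro hij
      simpa only [Fin.snoc_castSucc] using he.2 i j fun h => hij (by rw [h])

variable [Module.Finite ℍᵐᵒᵖ E]

theorem IsSelfAdj.exists_orthonormal_eigenvectors {a : E →ₗ[ℍᵐᵒᵖ] E} (ha : IsSelfAdj a) (n : ℕ)
    (hn : n ≤ Module.finrank ℍᵐᵒᵖ E) :
    ∃ (e : Fin n → E) (c : Fin n → ℝ), IsOrthonormal e ∧ ∀ i, a (e i) = e i <• (c i : ℍ) := by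
  induction n with
  | zero => exact ⟨Fin.elim0, Fin.elim0, ⟨fun i => i.elim0, fun i => i.elim0⟩, fun i => i.elim0⟩
  | succ n ih =>
    obtain ⟨e, c, he, hc⟩ := ih (by omega)
    set W := orth (Submodule.span ℍᵐᵒᵖ (Set.range e)) with hW
    have hWe : ∀ w, w ∈ W ↔ ∀ i, qinner (e i) w = 0 := by
      intro w
      refine ⟨fun h i => h _ (Submodule.subset_span ⟨i, rfl⟩), fun h x hx => ?_⟩
      obtain ⟨d, rfl⟩ := (Submodule.mem_span_range_iff_exists_fun ℍᵐᵒᵖ).1 hx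
      rw [qinner_sum_left]
      refine Finset.sum_eq_zero fun i _ => ?_
      have := qinner_smul_left (e i) w (d i).unop
      rw [MulOpposite.op_unop] at this
      rw [this, h, mul_zero]
    have hnt : Nontrivial W := by
      rw [Submodule.nontrivial_iff_ne_bot]
      intro h0
      have h1 := (isCompl_orth (Submodule.span ℍᵐᵒᵖ (Set.range e))).sup_eq_top
      rw [← hW, h0, sup_bot_eq] at h1
      have h2 := finrank_span_eq_card he.linearIndependent
      rw [h1, finrank_top, Fintype.card_fin] at h2
      omega
    obtain ⟨w, r, hw0, hwr⟩ := (ha.compress W).exists_eigenvector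
    -- The complement `W` of the eigenvectors already found is stable under `a`, so an eigenvector
    -- of the compression to `W` is one of `a`.
    have haw : a w = (w : E) <• (r : ℍ) := by
      have h1 : a w ∈ W := by
        rw [hWe]
        intro i
        rw [ha, hc, qinner_smul_left, (hWe w).1 w.2, mul_zero]
      rw [← orthProj_of_mem h1]
      exact congrArg Subtype.val hwr
    have hw0' : (w : E) ≠ 0 := fun h => hw0 (Subtype.ext h)
    obtain ⟨s, hs⟩ := exists_normalize hw0'
    refine ⟨Fin.snoc e ((w : E) <• (s : ℍ)), Fin.snoc c r, he.snoc hs ?_, ?_⟩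
    · intro i
      rw [qinner_smul_right, (hWe w).1 w.2, zero_mul]
    · intro i
      refine Fin.lastCases ?_ (fun i => ?_) i
      · simp only [Fin.snoc_last]
        rw [map_smul, haw, smul_smul, smul_smul, ← MulOpposite.op_mul, ← MulOpposite.op_mul,
          ← Quaternion.coe_mul, ← Quaternion.coe_mul, mul_comm]
      · simpa only [Fin.snoc_castSucc] using hc i

/-- A subspace has an orthonormal basis in which the compression of `a` is diagonal. -/
theorem IsSelfAdj.exists_mat_eq_diagonal {a : E →ₗ[ℍᵐᵒᵖ] E} (ha : IsSelfAdj a)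
    (R : Submodule ℍᵐᵒᵖ E) {m : ℕ} (hm : Module.finrank ℍᵐᵒᵖ R = m) :
    ∃ (g : Fin m → E) (c : Fin m → ℝ), IsOrthonormal g ∧
      Submodule.span ℍᵐᵒᵖ (Set.range g) = R ∧ mat g a = Matrix.diagonal fun i => (c i : ℍ) := by
  obtain ⟨e, c, he, hc⟩ := (ha.compress R).exists_orthonormal_eigenvectors m hm.ge
  have ho : IsOrthonormal (fun i => (e i : E)) := ⟨he.1, he.2⟩
  refine ⟨fun i => (e i : E), c, ho, ?_, ?_⟩
  · refine Submodule.eq_of_le_of_finrank_eq (Submodule.span_le.2 ?_) ?_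
    · rintro _ ⟨i, rfl⟩
      exact (e i).2
    · rw [finrank_span_eq_card ho.linearIndependent, Fintype.card_fin, hm]
  · ext1 i j
    have h1 : qinner (e i : E) (a (e j)) = qinner (e i) (QDLP.compress a R (e j)) :=
      (qinner_orthProjOnto (e i) (a (e j))).symm
    change qinner (e i : E) (a (e j)) = _
    rw [h1, hc, qinner_smul_right]
    by_cases h : i = j
    · subst h
      rw [he.1, one_mul, Matrix.diagonal_apply_eq]
    · rw [he.2 _ _ h, zero_mul, Matrix.diagonal_apply_ne _ h]

end Spectral

/-! ### Perturbation of a diagonal matrix -/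

section Perturbation

open Polynomial

/-- `f` is a polynomial function of degree at most `N`. -/
def IsPoly (N : ℕ) (f : ℝ → ℝ) : Prop := ∃ p : ℝ[X], p.natDegree ≤ N ∧ ∀ t, f t = p.eval t

theorem IsPoly.mono {N N' : ℕ} {f : ℝ → ℝ} (hf : IsPoly N f) (h : N ≤ N') : IsPoly N' f := by
  obtain ⟨p, hp, h'⟩ := hf
  exact ⟨p, hp.trans h, h'⟩

theorem IsPoly.mul {N N' : ℕ} {f g : ℝ → ℝ} (hf : IsPoly N f) (hg : IsPoly N' g) :
    IsPoly (N + N') fun t => f t * g t := by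
  obtain ⟨p, hp, hp'⟩ := hf
  obtain ⟨q, hq, hq'⟩ := hg
  exact ⟨p * q, natDegree_mul_le.trans (add_le_add hp hq), fun t => by simp only [hp', hq', eval_mul]⟩

theorem IsPoly.add {N : ℕ} {f g : ℝ → ℝ} (hf : IsPoly N f) (hg : IsPoly N g) :
    IsPoly N fun t => f t + g t := by
  obtain ⟨p, hp, hp'⟩ := hf
  obtain ⟨q, hq, hq'⟩ := hg
  exact ⟨p + q, natDegree_add_le_of_degree_le hp hq, fun t => by simp only [hp', hq', eval_add]⟩

theorem isPoly_const (c : ℝ) : IsPoly 0 fun _ => c := ⟨C c, by simp, by simp⟩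

theorem isPoly_affine (b c : ℝ) : IsPoly 1 fun t => b + t * c :=
  ⟨C b + X * C c, by compute_degree, fun t => by
    simp only [eval_add, eval_C, eval_mul, eval_X]⟩

theorem IsPoly.const_mul {N : ℕ} {f : ℝ → ℝ} (c : ℝ) (hf : IsPoly N f) :
    IsPoly N fun t => c * f t := by
  simpa using (isPoly_const c).mul hf

theorem IsPoly.sub {N : ℕ} {f g : ℝ → ℝ} (hf : IsPoly N f) (hg : IsPoly N g) :
    IsPoly N fun t => f t - g t := by
  simpa [sub_eq_add_neg] using hf.add (hg.const_mul (-1))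

theorem IsPoly.sum {ι : Type*} (s : Finset ι) {N : ι → ℕ} {f : ι → ℝ → ℝ}
    (hf : ∀ i ∈ s, IsPoly (N i) (f i)) : IsPoly (∑ i ∈ s, N i) fun t => ∑ i ∈ s, f i t := by
  classical
  induction s using Finset.induction_on with
  | empty => simpa using isPoly_const 0
  | insert i s hi ih =>
    simp only [Finset.sum_insert hi]
    exact ((hf i (by simp)).mono (by omega)).add
      ((ih fun j hj => hf j (by simp [hj])).mono (by omega))

theorem IsPoly.prod {ι : Type*} (s : Finset ι) {N : ι → ℕ} {f : ι → ℝ → ℝ}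
    (hf : ∀ i ∈ s, IsPoly (N i) (f i)) : IsPoly (∑ i ∈ s, N i) fun t => ∏ i ∈ s, f i t := by
  classical
  induction s using Finset.induction_on with
  | empty => simpa using isPoly_const 1
  | insert i s hi ih =>
    simp only [Finset.sum_insert hi, Finset.prod_insert hi]
    exact (hf i (by simp)).mul (ih fun j hj => hf j (by simp [hj]))

theorem IsPoly.differentiable {N : ℕ} {f : ℝ → ℝ} (hf : IsPoly N f) : Differentiable ℝ f := by
  obtain ⟨p, -, h⟩ := hf
  rw [funext h]
  exact p.differentiable

/-- The derivative at `0` of a polynomial of degree at most `N` can be computed from finitely many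
values. -/
theorem exists_derivative_weights (N : ℕ) : ∃ w x : Fin (N + 1) → ℝ, ∀ p : ℝ[X], p.natDegree ≤ N →
    p.derivative.eval 0 = ∑ j, w j * p.eval (x j) := by
  have hx : Function.Injective (fun j : Fin (N + 1) => (j : ℝ)) := fun i j h =>
    Fin.ext (Nat.cast_injective h)
  -- The nodes are the integers `0, …, N`, and the weights are the derivatives at `0` of the
  -- Lagrange basis.
  refine ⟨fun j => (Lagrange.basis Finset.univ (fun j : Fin (N + 1) => (j : ℝ)) j).derivative.eval 0,
    fun j => (j : ℝ), fun p hp => ?_⟩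
  have h := Lagrange.eq_interpolate (s := Finset.univ) (v := fun j : Fin (N + 1) => (j : ℝ))
    (f := p) hx.injOn (by
      rw [Finset.card_fin]
      exact lt_of_le_of_lt (degree_le_of_natDegree_le hp) (by exact_mod_cast Nat.lt_succ_self N))
  conv_lhs => rw [h]
  rw [Lagrange.interpolate_apply, derivative_sum, eval_finsetSum]
  refine Finset.sum_congr rfl fun j _ => ?_
  rw [derivative_C_mul, eval_C_mul, mul_comm]

/-- The four components are treated together because the product of quaternions mixes them. -/
theorem isPoly_pathProd {α : Type*} (A B : Matrix α α ℍ) (h : ℕ → α) (r : ℕ) :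
    IsPoly r (fun t => (pathProd (A + t • B) h r).re) ∧
    IsPoly r (fun t => (pathProd (A + t • B) h r).imI) ∧
    IsPoly r (fun t => (pathProd (A + t • B) h r).imJ) ∧
    IsPoly r (fun t => (pathProd (A + t • B) h r).imK) := by
  induction r with
  | zero =>
    simp only [pathProd_zero]
    exact ⟨isPoly_const _, isPoly_const _, isPoly_const _, isPoly_const _⟩
  | succ r ih =>
    obtain ⟨h0, h1, h2, h3⟩ := ih
    have e0 := isPoly_affine (A (h r) (h (r + 1))).re (B (h r) (h (r + 1))).re
    have e1 := isPoly_affine (A (h r) (h (r + 1))).imI (B (h r) (h (r + 1))).imI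
    have e2 := isPoly_affine (A (h r) (h (r + 1))).imJ (B (h r) (h (r + 1))).imJ
    have e3 := isPoly_affine (A (h r) (h (r + 1))).imK (B (h r) (h (r + 1))).imK
    simp only [pathProd_succ, Quaternion.re_mul, Quaternion.imI_mul, Quaternion.imJ_mul,
      Quaternion.imK_mul, Matrix.add_apply, Matrix.smul_apply, Quaternion.re_add,
      Quaternion.imI_add, Quaternion.imJ_add, Quaternion.imK_add, Quaternion.re_smul,
      Quaternion.imI_smul, Quaternion.imJ_smul, Quaternion.imK_smul, smul_eq_mul]
    exact ⟨(((h0.mul e0).sub (h1.mul e1)).sub (h2.mul e2)).sub (h3.mul e3),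
      (((h0.mul e1).add (h1.mul e0)).add (h2.mul e3)).sub (h3.mul e2),
      (((h0.mul e2).sub (h1.mul e3)).add (h2.mul e0)).add (h3.mul e1),
      (((h0.mul e3).add (h1.mul e2)).sub (h2.mul e1)).add (h3.mul e0)⟩

/-- The point is that the bound on the degree depends only on `m`: the interpolation weights can
then be chosen before the subspace is known. -/
theorem isPoly_qdet (m : ℕ) : ∃ N, ∀ A B : Matrix (Fin m) (Fin m) ℍ,
    IsPoly N fun t => qdet (A + t • B) :=
  ⟨∑ π : Equiv.Perm (Fin m), ∑ i ∈ cycleMins π, Function.minimalPeriod π i, fun A B =>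
    IsPoly.sum _ fun _ _ => (IsPoly.prod _ fun _ _ => (isPoly_pathProd A B _ _).1).const_mul _⟩

/-- A nontrivial cycle uses no diagonal entry, and each of its edges contributes a factor `t`. -/
theorem loop_diagonal_add {α : Type*} [DecidableEq α] (c : α → ℍ) (B : Matrix α α ℍ)
    {π : Equiv.Perm α} {x : α} (hx : π x ≠ x) (t : ℝ) :
    loop (Matrix.diagonal c + t • B) π x = t ^ Function.minimalPeriod π x • loop B π x := by
  have key : ∀ r, pathProd (Matrix.diagonal c + t • B) (fun k => (π ^ k) x) r =
      t ^ r • pathProd B (fun k => (π ^ k) x) r := by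
    intro r
    induction r with
    | zero => simp [pathProd_zero]
    | succ r ih =>
      have hne : (π ^ r) x ≠ (π ^ (r + 1)) x := by
        rw [pow_succ, Equiv.Perm.mul_apply]
        exact fun h => hx ((π ^ r).injective h).symm
      rw [pathProd_succ, ih, pathProd_succ, Matrix.add_apply, Matrix.diagonal_apply_ne _ hne,
        zero_add, Matrix.smul_apply, smul_mul_smul_comm, ← pow_succ]
  exact key _

theorem exists_mem_cycleMins_apply_ne {m : ℕ} {π : Equiv.Perm (Fin m)} (hπ : π ≠ 1) :
    ∃ x ∈ cycleMins π, π x ≠ x := by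
  obtain ⟨y, hy⟩ : ∃ y, π y ≠ y := by
    by_contra! h
    exact hπ (Equiv.ext h)
  obtain ⟨x, hx, hxy⟩ := (isTransversal_cycleMins π).exists_sameCycle y
  exact ⟨x, hx, fun h => hy (hxy.apply_eq_self_iff.1 h)⟩

theorem cycleWeight_one {m : ℕ} (M : Matrix (Fin m) (Fin m) ℍ) :
    cycleWeight M 1 = ∏ i, (M i i).re := by
  have h1 : cycleMins (1 : Equiv.Perm (Fin m)) = Finset.univ := by simp [cycleMins]
  rw [cycleWeight, h1]
  refine Finset.prod_congr rfl fun i _ => ?_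
  have h2 : Function.minimalPeriod (1 : Equiv.Perm (Fin m)) i = 1 :=
    Function.minimalPeriod_eq_one_iff_isFixedPt.2 rfl
  rw [loop, h2, pathProd_succ, pathProd_zero, one_mul]
  simp

theorem qdet_diagonal {m : ℕ} (c : Fin m → ℝ) :
    qdet (Matrix.diagonal fun i => (c i : ℍ)) = ∏ i, c i := by
  rw [qdet_eq, Finset.sum_eq_single 1]
  · rw [cycleWeight_one]
    simp
  · intro π _ hπ
    obtain ⟨x, hx, hne⟩ := exists_mem_cycleMins_apply_ne hπ
    have h := loop_diagonal_add (fun i => (c i : ℍ)) 0 hne 0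
    rw [zero_smul, add_zero, zero_pow (minimalPeriod_perm_pos π x).ne', zero_smul] at h
    rw [cycleWeight, Finset.prod_eq_zero hx, mul_zero]
    rw [h]; rfl
  · simp

/-- A permutation other than the identity has a cycle of length at least `2`, so its term is
`O(t^2)`. At first order only the product of the real parts of the diagonal entries matters. -/
theorem hasDerivAt_qdet_diagonal {m : ℕ} (c : Fin m → ℝ) (B : Matrix (Fin m) (Fin m) ℍ) :
    HasDerivAt (fun t : ℝ => qdet (Matrix.diagonal (fun i => (c i : ℍ)) + t • B))
      (∑ i, (∏ j ∈ Finset.univ.erase i, c j) * (B i i).re) 0 := by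
  classical
  have h1 : HasDerivAt (fun t : ℝ => cycleWeight (Matrix.diagonal (fun i => (c i : ℍ)) + t • B) 1)
      (∑ i, (∏ j ∈ Finset.univ.erase i, c j) * (B i i).re) 0 := by
    simp only [cycleWeight_one, Matrix.add_apply, Matrix.diagonal_apply_eq, Matrix.smul_apply,
      Quaternion.re_add, Quaternion.re_coe, Quaternion.re_smul, smul_eq_mul]
    have h := HasDerivAt.fun_finsetProd (u := (Finset.univ : Finset (Fin m))) (x := (0 : ℝ))
      (f := fun i t => c i + t * (B i i).re) (f' := fun i => (B i i).re)
      (fun i _ => by simpa using ((hasDerivAt_id (0 : ℝ)).mul_const (B i i).re).const_add (c i))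
    simpa using h
  have h2 : ∀ π : Equiv.Perm (Fin m), π ≠ 1 →
      HasDerivAt (fun t : ℝ => cycleWeight (Matrix.diagonal (fun i => (c i : ℍ)) + t • B) π) 0 0 := by
    intro π hπ
    obtain ⟨x, hx, hne⟩ := exists_mem_cycleMins_apply_ne hπ
    have hr : 1 < Function.minimalPeriod π x := by
      have h1 := minimalPeriod_perm_pos π x
      have h2 : Function.minimalPeriod π x ≠ 1 := fun h =>
        hne (Function.minimalPeriod_eq_one_iff_isFixedPt.1 h)
      omega
    simp only [cycleWeight, ← Finset.mul_prod_erase _ _ hx]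
    have hd : IsPoly _ fun t : ℝ => ∏ i ∈ (cycleMins π).erase x,
        (loop (Matrix.diagonal (fun i => (c i : ℍ)) + t • B) π i).re :=
      IsPoly.prod _ fun i _ => (isPoly_pathProd _ B _ _).1
    have hp := (hasDerivAt_pow (Function.minimalPeriod π x) (0 : ℝ)).mul_const (loop B π x).re
    have := hp.fun_mul (hd.differentiable 0).hasDerivAt
    simp only [loop_diagonal_add _ B hne, Quaternion.re_smul, smul_eq_mul]
    refine this.congr_deriv ?_
    rw [zero_pow (Nat.sub_ne_zero_of_lt hr), zero_pow (by omega)]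
    simp
  have hs : HasDerivAt (fun t : ℝ => qdet (Matrix.diagonal (fun i => (c i : ℍ)) + t • B))
      (∑ π : Equiv.Perm (Fin m), (Equiv.Perm.sign π : ℝ) * (if π = 1 then
        ∑ i, (∏ j ∈ Finset.univ.erase i, c j) * (B i i).re else 0)) 0 := by
    simp only [qdet_eq]
    refine HasDerivAt.fun_sum fun π _ => HasDerivAt.const_mul _ ?_
    split_ifs with h
    · subst h; exact h1
    · exact h2 π h
  refine hs.congr_deriv ?_
  rw [Finset.sum_eq_single 1]
  · simp
  · intro π _ hπ
    simp [hπ]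
  · simp

end Perturbation

/-! ### Compressions of an orthogonal projection and of its perturbations -/

section Projections

set_option linter.unusedSectionVars false

variable {E : Type*} [AddCommGroup E] [Module ℍᵐᵒᵖ E] [QInner E] [Module.Finite ℍᵐᵒᵖ E]

theorem qinner_orthProj_self (H : Submodule ℍᵐᵒᵖ E) (v : E) :
    qinner v (orthProj H v) = qinner (orthProj H v) (orthProj H v) := by
  rw [qinner_orthProj_left (orthProj_mem H v)]

/-- The data of an orthonormal basis of `R` which diagonalizes the compression of `Π_H`. -/
structure DiagonalBasis (H R : Submodule ℍᵐᵒᵖ E) {m : ℕ} (g : Fin m → E) (c : Fin m → ℝ) :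
    Prop where
  orthonormal : IsOrthonormal g
  span_eq : Submodule.span ℍᵐᵒᵖ (Set.range g) = R
  mat_eq : mat g (orthProj H) = Matrix.diagonal fun i => (c i : ℍ)

theorem exists_diagonalBasis (H R : Submodule ℍᵐᵒᵖ E) {m : ℕ}
    (hm : Module.finrank ℍᵐᵒᵖ R = m) :
    ∃ (g : Fin m → E) (c : Fin m → ℝ), DiagonalBasis H R g c := by
  obtain ⟨g, c, h1, h2, h3⟩ := (isSelfAdj_orthProj H).exists_mat_eq_diagonal R hm
  exact ⟨g, c, h1, h2, h3⟩

namespace DiagonalBasis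

variable {H R : Submodule ℍᵐᵒᵖ E} {m : ℕ} {g : Fin m → E} {c : Fin m → ℝ}

theorem mem (h : DiagonalBasis H R g c) (i : Fin m) : g i ∈ R :=
  h.span_eq ▸ Submodule.subset_span ⟨i, rfl⟩

theorem qinner_apply (h : DiagonalBasis H R g c) (i j : Fin m) :
    qinner (g i) (orthProj H (g j)) = if i = j then (c i : ℍ) else 0 :=
  (congrFun (congrFun h.mat_eq i) j).trans (Matrix.diagonal_apply _ _ _)

theorem coe_eq (h : DiagonalBasis H R g c) (i : Fin m) :
    (c i : ℍ) = qinner (orthProj H (g i)) (orthProj H (g i)) := by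
  rw [← qinner_orthProj_self, h.qinner_apply, if_pos rfl]

theorem nonneg (h : DiagonalBasis H R g c) (i : Fin m) : 0 ≤ c i := by
  obtain ⟨r, hr, hr'⟩ := qinner_self_nonneg (orthProj H (g i))
  rw [← h.coe_eq] at hr'
  rwa [Quaternion.coe_injective hr']

theorem mem_orth (h : DiagonalBasis H R g c) {i : Fin m} (hi : c i = 0) : g i ∈ orth H := by
  refine mem_orth_of_orthProj (qinner_self_eq_zero _ ?_)
  rw [← h.coe_eq, hi]
  rfl

theorem qdetEnd_eq (h : DiagonalBasis H R g c) :
    qdetEnd (compress (orthProj H) R) = ∏ i, c i := by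
  rw [h.orthonormal.qdetEnd_compress h.span_eq (isSelfAdj_orthProj H), h.mat_eq, qdet_diagonal]

theorem exists_eq_sum (h : DiagonalBasis H R g c) {v : E} (hv : v ∈ R) :
    ∃ d : Fin m → ℍ, v = ∑ i, g i <• d i := by
  rw [← h.span_eq] at hv
  obtain ⟨d, rfl⟩ := (Submodule.mem_span_range_iff_exists_fun ℍᵐᵒᵖ).1 hv
  exact ⟨fun i => (d i).unop, by simp⟩

theorem qinner_orthProj_sum (h : DiagonalBasis H R g c) (d : Fin m → ℍ) (i : Fin m) :
    qinner (g i) (orthProj H (∑ j, g j <• d j)) = (c i : ℍ) * d i := by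
  simp only [map_sum, map_smul, qinner_sum_right, qinner_smul_right, h.qinner_apply]
  simp

/-- If `v = ∑ g_i d_i` lies in `H^⊥`, then `0 = ⟨g_i, Π_H v⟩ = c_i d_i` for every `i`. -/
theorem disjoint (h : DiagonalBasis H R g c) (hc : ∀ i, c i ≠ 0) : Disjoint R (orth H) := by
  rw [Submodule.disjoint_def]
  intro v hv hv'
  obtain ⟨d, rfl⟩ := h.exists_eq_sum hv
  refine Finset.sum_eq_zero fun i _ => ?_
  have h1 := h.qinner_orthProj_sum d i
  rw [orthProj_of_mem_orth hv', qinner_zero_right] at h1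
  have h2 : d i = 0 := by
    rcases mul_eq_zero.1 h1.symm with h3 | h3
    · exact absurd (Quaternion.coe_injective h3) (hc i)
    · exact h3
  rw [h2, MulOpposite.op_zero, zero_smul]

end DiagonalBasis

theorem qdetEnd_compress_orthProj_nonneg (H R : Submodule ℍᵐᵒᵖ E) :
    0 ≤ qdetEnd (compress (orthProj H) R) := by
  obtain ⟨g, c, h⟩ := exists_diagonalBasis H R rfl
  rw [h.qdetEnd_eq]
  exact Finset.prod_nonneg fun i _ => h.nonneg i

theorem disjoint_of_qdetEnd_ne_zero {H R : Submodule ℍᵐᵒᵖ E}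
    (hR : qdetEnd (compress (orthProj H) R) ≠ 0) : Disjoint R (orth H) := by
  obtain ⟨g, c, h⟩ := exists_diagonalBasis H R rfl
  rw [h.qdetEnd_eq, Finset.prod_ne_zero_iff] at hR
  exact h.disjoint fun i => hR i (Finset.mem_univ i)

theorem finrank_add_finrank_orth (H : Submodule ℍᵐᵒᵖ E) :
    Module.finrank ℍᵐᵒᵖ H + Module.finrank ℍᵐᵒᵖ (orth H) = Module.finrank ℍᵐᵒᵖ E :=
  Submodule.finrank_add_eq_of_isCompl (isCompl_orth H)

/-- A subspace larger than `H` must meet `H^⊥`, whose dimension is `dim E - dim H`. -/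
theorem qdetEnd_compress_orthProj_eq_zero {H R : Submodule ℍᵐᵒᵖ E}
    (h : Module.finrank ℍᵐᵒᵖ H < Module.finrank ℍᵐᵒᵖ R) :
    qdetEnd (compress (orthProj H) R) = 0 := by
  by_contra h0
  have h1 := Submodule.finrank_add_finrank_le_of_disjoint (disjoint_of_qdetEnd_ne_zero h0)
  have h2 := finrank_add_finrank_orth H
  omega

theorem isCompl_orth_of_qdetEnd_ne_zero {H R : Submodule ℍᵐᵒᵖ E}
    (hR : qdetEnd (compress (orthProj H) R) ≠ 0)
    (hd : Module.finrank ℍᵐᵒᵖ R = Module.finrank ℍᵐᵒᵖ H) : IsCompl R (orth H) := by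
  rw [Submodule.isCompl_iff_disjoint _ _ (by rw [hd, finrank_add_finrank_orth])]
  exact disjoint_of_qdetEnd_ne_zero hR

theorem projAlong_eq {R F : Submodule ℍᵐᵒᵖ E} (h : IsCompl R F) {w x : E} (hx : x ∈ R)
    (hwx : w - x ∈ F) : projAlong R F w = x := by
  rw [projAlong, dif_pos h]
  have h1 : w = x + (w - x) := by abel
  rw [h1, map_add, Submodule.projection_apply_of_mem_left h hx,
    (Submodule.projection_apply_eq_zero_iff h).2 hwx, add_zero]

/-- The coefficients solve `⟨g_i, Π_H x⟩ = ⟨g_i, Π_H w⟩`. Then `Π_H (w - x)` is orthogonal to `R`,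
and also to `H^⊥` since it lies in `H`. It is therefore orthogonal to `E = R ⊕ H^⊥`, and vanishes.
-/
theorem DiagonalBasis.projAlong_apply {H R : Submodule ℍᵐᵒᵖ E} {m : ℕ} {g : Fin m → E}
    {c : Fin m → ℝ} (h : DiagonalBasis H R g c) (hc : ∀ i, c i ≠ 0) (hR : IsCompl R (orth H))
    (w : E) : projAlong R (orth H) w =
      ∑ i, g i <• (((c i)⁻¹ : ℝ) * qinner (g i) (orthProj H w) : ℍ) := by
  refine projAlong_eq hR (Submodule.sum_mem _ fun i _ => Submodule.smul_mem _ _ (h.mem i)) ?_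
  set x := ∑ i, g i <• (((c i)⁻¹ : ℝ) * qinner (g i) (orthProj H w) : ℍ) with hx
  refine mem_orth_of_orthProj ?_
  have h1 : ∀ i, qinner (g i) (orthProj H (w - x)) = 0 := by
    intro i
    rw [map_sub, qinner_sub_right, hx, h.qinner_orthProj_sum, ← mul_assoc, ← Quaternion.coe_mul,
      mul_inv_cancel₀ (hc i), Quaternion.coe_one, one_mul, sub_self]
  have h2 : ∀ r ∈ R, qinner r (orthProj H (w - x)) = 0 := by
    intro r hr
    obtain ⟨d, rfl⟩ := h.exists_eq_sum hr
    rw [qinner_sum_left]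
    exact Finset.sum_eq_zero fun i _ => by rw [qinner_smul_left, h1, mul_zero]
  have hu := orthProj_mem H (w - x)
  obtain ⟨r, hr, s, hs, hrs⟩ := Submodule.mem_sup.1
    (hR.sup_eq_top ▸ Submodule.mem_top : orthProj H (w - x) ∈ R ⊔ orth H)
  apply qinner_self_eq_zero
  conv_lhs => rw [← hrs]
  rw [qinner_add_left, hrs, h2 r hr, ← star_qinner, hs _ hu, star_zero, add_zero]

/-- The self-adjoint endomorphism `x ↦ h⟨v, x⟩ + v⟨h, x⟩`. -/
noncomputable def symRankTwo (h v : E) : E →ₗ[ℍᵐᵒᵖ] E where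
  toFun x := h <• qinner v x + v <• qinner h x
  map_add' x y := by
    simp only [qinner_add_right, MulOpposite.op_add, add_smul]
    abel
  map_smul' q x := by
    have h1 := fun u : E => qinner_smul_right u x q.unop
    simp only [MulOpposite.op_unop] at h1
    simp only [RingHom.id_apply, smul_add, h1, MulOpposite.op_mul, MulOpposite.op_unop, mul_smul]

theorem symRankTwo_apply (h v x : E) :
    symRankTwo h v x = h <• qinner v x + v <• qinner h x := rfl

theorem isSelfAdj_symRankTwo (h v : E) : IsSelfAdj (symRankTwo h v) := fun x y => by
  simp only [symRankTwo_apply, qinner_add_left, qinner_add_right, qinner_smul_left,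
    qinner_smul_right, star_qinner]
  rw [add_comm]

/-- The perturbation `Π_H + t (h⟨v, ·⟩ + v⟨h, ·⟩)` of `Π_H`, with `h = Π_H w`. -/
noncomputable def perturbedProj (H : Submodule ℍᵐᵒᵖ E) (v w : E) (t : ℝ) : E →ₗ[ℍᵐᵒᵖ] E :=
  orthProj H + symRankTwo (orthProj H w <• (t : ℍ)) v

theorem isSelfAdj_perturbedProj (H : Submodule ℍᵐᵒᵖ E) (v w : E) (t : ℝ) :
    IsSelfAdj (perturbedProj H v w t) := fun x y => by
  rw [perturbedProj, LinearMap.add_apply, LinearMap.add_apply, qinner_add_left, qinner_add_right,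
    isSelfAdj_orthProj H x y, isSelfAdj_symRankTwo _ _ x y]

theorem mat_perturbedProj {κ : Type*} (g : κ → E) (H : Submodule ℍᵐᵒᵖ E) (v w : E) (t : ℝ) :
    mat g (perturbedProj H v w t) =
      mat g (orthProj H) + t • mat g (symRankTwo (orthProj H w) v) := by
  ext1 i j
  rw [Matrix.add_apply, Matrix.smul_apply]
  simp only [mat, Matrix.of_apply, perturbedProj, LinearMap.add_apply, symRankTwo_apply,
    qinner_add_right, qinner_smul_right, qinner_smul_left, Quaternion.star_coe, smul_add]
  rw [Quaternion.mul_coe_eq_smul, Quaternion.coe_mul_eq_smul, smul_mul_assoc, mul_smul_comm]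

/-- Both sides are the derivative at `t = 0` of `det_ℜ` of the compression of the perturbed
projection. The weights and nodes depend only on `m`, so the identity can be integrated over `R`
without differentiating under the integral; it also bounds the left-hand side by integrable
functions, although the projection itself is unbounded in general. -/
theorem exists_perturbedProj_weights (m : ℕ) : ∃ (N : ℕ) (x y : Fin N → ℝ),
    ∀ (H R : Submodule ℍᵐᵒᵖ E) (v w : E), Module.finrank ℍᵐᵒᵖ R = m →
      Module.finrank ℍᵐᵒᵖ R = Module.finrank ℍᵐᵒᵖ H →
      2 * (qdetEnd (compress (orthProj H) R) * (qinner v (projAlong R (orth H) w)).re) =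
        ∑ j, x j * qdetEnd (compress (perturbedProj H v w (y j)) R) := by
  obtain ⟨N, hN⟩ := isPoly_qdet m
  obtain ⟨x, y, hxy⟩ := exists_derivative_weights N
  refine ⟨N + 1, x, y, fun H R v w hm hd => ?_⟩
  obtain ⟨g, c, h⟩ := exists_diagonalBasis H R hm
  set B := mat g (symRankTwo (orthProj H w) v) with hB
  have hdet : ∀ t, qdetEnd (compress (perturbedProj H v w t) R) =
      qdet (Matrix.diagonal (fun i => (c i : ℍ)) + t • B) := by
    intro t
    rw [h.orthonormal.qdetEnd_compress h.span_eq (isSelfAdj_perturbedProj H v w t),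
      mat_perturbedProj, h.mat_eq]
  obtain ⟨p, hp, hp'⟩ := hN (Matrix.diagonal fun i => (c i : ℍ)) B
  simp only [hdet, hp', ← hxy p hp]
  -- The same derivative is computed from the diagonal form and from the polynomial `p`.
  have hderiv := (hasDerivAt_qdet_diagonal c B).unique (by
    rw [funext hp']; exact p.hasDerivAt 0)
  -- The two rank-one terms of `symRankTwo` have conjugate diagonal entries; this is the origin of
  -- the factor `2`.
  have hBre : ∀ i, (B i i).re = 2 * (qinner v (g i) * qinner (g i) (orthProj H w)).re := by
    intro i
    simp only [hB, mat, Matrix.of_apply, symRankTwo_apply, qinner_add_right, qinner_smul_right,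
      Quaternion.re_add]
    rw [re_mul_comm (qinner (g i) (orthProj H w))]
    have h1 : (qinner (g i) v * qinner (orthProj H w) (g i)).re =
        (star (qinner (g i) v * qinner (orthProj H w) (g i))).re := (Quaternion.re_star _).symm
    rw [h1, star_mul, star_qinner, star_qinner, re_mul_comm (qinner (g i) (orthProj H w))]
    ring
  rw [← hderiv, h.qdetEnd_eq]
  by_cases hc : ∀ i, c i ≠ 0
  · have hR : IsCompl R (orth H) := isCompl_orth_of_qdetEnd_ne_zero
      (by rw [h.qdetEnd_eq]; exact Finset.prod_ne_zero_iff.2 fun i _ => hc i) hd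
    rw [h.projAlong_apply hc hR, qinner_sum_right, re_sum, Finset.mul_sum, Finset.mul_sum]
    refine Finset.sum_congr rfl fun i _ => ?_
    rw [hBre, qinner_smul_right, Quaternion.coe_mul_eq_smul, mul_smul_comm, Quaternion.re_smul,
      smul_eq_mul, ← Finset.mul_prod_erase _ _ (Finset.mem_univ i)]
    have := hc i
    field_simp
  -- If `c i = 0`, then `g i` lies in `H^⊥` and `B i i` has real part `0`, while every other term of
  -- the derivative contains the factor `c i`. Both sides vanish, whatever the value of `projAlong`.
  · push Not at hc
    obtain ⟨i, hi⟩ := hc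
    rw [Finset.prod_eq_zero (Finset.mem_univ i) hi, zero_mul, mul_zero]
    symm
    refine Finset.sum_eq_zero fun j _ => ?_
    by_cases hij : j = i
    · subst hij
      rw [hBre, ← star_qinner _ (g j), h.mem_orth hi _ (orthProj_mem H w)]
      simp
    · rw [Finset.prod_eq_zero (Finset.mem_erase.2 ⟨Ne.symm hij, Finset.mem_univ i⟩) hi, zero_mul]

/-- The basis of `E` obtained by juxtaposing the bases of `H` and of its orthogonal. -/
noncomputable def adaptedBasis (H : Submodule ℍᵐᵒᵖ E) :
    Fin (Module.finrank ℍᵐᵒᵖ H) ⊕ Fin (Module.finrank ℍᵐᵒᵖ (orth H)) → E :=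
  Sum.elim (fun i => (onb H i : E)) (fun i => (onb (orth H) i : E))

theorem isONB_adaptedBasis (H : Submodule ℍᵐᵒᵖ E) : IsONB (adaptedBasis H) := by
  have ho : IsOrthonormal (adaptedBasis H) := by
    have h1 := isOrthonormal_onb (E := H)
    have h2 := isOrthonormal_onb (E := orth H)
    refine ⟨fun i => ?_, fun i j hij => ?_⟩
    · rcases i with i | i
      · exact h1.1 i
      · exact h2.1 i
    · rcases i with i | i <;> rcases j with j | j
      · exact h1.2 i j fun h => hij (by rw [h])
      · exact (onb (orth H) j).2 _ (onb H i).2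
      · rw [← star_qinner]
        have := (onb (orth H) i).2 _ (onb H j).2
        exact (congrArg star this).trans (star_zero _)
      · exact h2.2 i j fun h => hij (by rw [h])
  refine ho.isONB_of_card ?_
  rw [Fintype.card_sum, Fintype.card_fin, Fintype.card_fin, finrank_add_finrank_orth]

theorem qdetEnd_compress_orthProj_self (H : Submodule ℍᵐᵒᵖ E) :
    qdetEnd (compress (orthProj H) H) = 1 := by
  have h : ∀ i, orthProj H (onb H i : E) = onb H i := fun i => orthProj_of_mem (onb H i).2
  have ho : IsOrthonormal fun i => (onb H i : E) :=
    ⟨(isOrthonormal_onb (E := H)).1, (isOrthonormal_onb (E := H)).2⟩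
  have hs : Submodule.span ℍᵐᵒᵖ (Set.range fun i => (onb H i : E)) = H := by
    have h1 := congrArg (Submodule.map H.subtype) (span_onb (E := H))
    rw [Submodule.map_span, ← Set.range_comp, Submodule.map_subtype_top] at h1
    exact h1
  rw [ho.qdetEnd_compress hs (isSelfAdj_orthProj H)]
  have hm : mat (fun i => (onb H i : E)) (orthProj H) = Matrix.diagonal fun i => ((1 : ℝ) : ℍ) := by
    ext1 i j
    simp only [mat, Matrix.of_apply, h]
    by_cases hij : i = j
    · subst hij
      rw [ho.1, Matrix.diagonal_apply_eq, Quaternion.coe_one]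
    · rw [ho.2 i j hij, Matrix.diagonal_apply_ne _ hij]
  rw [hm, qdet_diagonal]
  simp

theorem span_adaptedBasis_inl (H : Submodule ℍᵐᵒᵖ E) :
    Submodule.span ℍᵐᵒᵖ (adaptedBasis H ''
      ((Finset.univ.map Function.Embedding.inl : Finset (Fin (Module.finrank ℍᵐᵒᵖ H) ⊕
        Fin (Module.finrank ℍᵐᵒᵖ (orth H)))) : Set _)) = H := by
  have h1 := congrArg (Submodule.map H.subtype) (span_onb (E := H))
  rw [Submodule.map_span, ← Set.range_comp, Submodule.map_subtype_top] at h1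
  convert h1 using 2
  rw [Finset.coe_map, Finset.coe_univ, Set.image_univ, ← Set.range_comp]
  rfl

/-- Such a `J` contains the index of a basis vector of `H^⊥`. -/
theorem qdetEnd_span_adaptedBasis_eq_zero (H : Submodule ℍᵐᵒᵖ E)
    {J : Finset (Fin (Module.finrank ℍᵐᵒᵖ H) ⊕ Fin (Module.finrank ℍᵐᵒᵖ (orth H)))}
    (hJ : J.card = Module.finrank ℍᵐᵒᵖ H) (hne : J ≠ Finset.univ.map Function.Embedding.inl) :
    qdetEnd (compress (orthProj H) (Submodule.span ℍᵐᵒᵖ (adaptedBasis H '' (J : Set _)))) = 0 := by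
  by_contra h0
  have hd := disjoint_of_qdetEnd_ne_zero h0
  apply hne
  refine Finset.eq_of_subset_of_card_le (fun i hi => ?_) (by simp [hJ])
  rcases i with i | i
  · simp
  · exfalso
    have h1 := (Submodule.disjoint_def.1 hd) (adaptedBasis H (Sum.inr i))
      (Submodule.subset_span ⟨_, hi, rfl⟩) (onb (orth H) i).2
    have h2 := (isONB_adaptedBasis H).orthonormal.1 (Sum.inr i)
    rw [h1, qinner_zero_right] at h2
    exact zero_ne_one h2

/-- In a basis adapted to `H ⊕ H^⊥`, the only coordinate subspace of dimension `dim H` that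
contributes is `H`. This provides the normalization of the density. -/
theorem traceSum_orthProj (H : Submodule ℍᵐᵒᵖ E) :
    traceSum (Module.finrank ℍᵐᵒᵖ H) (orthProj H) / (Module.finrank ℍᵐᵒᵖ H).factorial = 1 := by
  rw [← (isONB_adaptedBasis H).sum_qdetEnd_compress (isSelfAdj_orthProj H),
    Finset.sum_eq_single (Finset.univ.map Function.Embedding.inl)]
  · rw [span_adaptedBasis_inl, qdetEnd_compress_orthProj_self]
  · intro J hJ hne
    exact qdetEnd_span_adaptedBasis_eq_zero H (Finset.mem_powersetCard.1 hJ).2 hne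
  · intro h
    exact absurd (Finset.mem_powersetCard.2 ⟨Finset.subset_univ _, by simp⟩) h

theorem projAlong_self_orth (H : Submodule ℍᵐᵒᵖ E) (w : E) :
    projAlong H (orth H) w = orthProj H w :=
  projAlong_eq (isCompl_orth H) (orthProj_mem H w) (sub_orthProj_mem H w)

theorem finrank_span_image_coe {ι : Type*} [Fintype ι] {e : ι → E} (he : IsOrthonormal e)
    (J : Finset ι) : Module.finrank ℍᵐᵒᵖ (Submodule.span ℍᵐᵒᵖ (e '' (J : Set ι))) = J.card := by
  have h := finrank_span_eq_card (he.comp (f := fun j : J => (j : ι))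
    Subtype.val_injective).linearIndependent
  rw [Set.range_comp, Subtype.range_coe_subtype, Fintype.card_coe] at h
  exact h

/-- By independence of the basis, each `traceSum` is expanded in a basis adapted to `H ⊕ H^⊥`. The
hypothesis then turns the sum back into derivatives, and only `R = H` survives, for which the
oblique projection is `Π_H`. -/
theorem sum_weights_traceSum {H : Submodule ℍᵐᵒᵖ E} {v w : E} {N : ℕ} {x y : Fin N → ℝ}
    (hxy : ∀ R : Submodule ℍᵐᵒᵖ E, Module.finrank ℍᵐᵒᵖ R = Module.finrank ℍᵐᵒᵖ H →
      2 * (qdetEnd (compress (orthProj H) R) * (qinner v (projAlong R (orth H) w)).re) =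
        ∑ j, x j * qdetEnd (compress (perturbedProj H v w (y j)) R)) :
    ∑ j, x j * (traceSum (Module.finrank ℍᵐᵒᵖ H) (perturbedProj H v w (y j)) /
        (Module.finrank ℍᵐᵒᵖ H).factorial) = 2 * (qinner v (orthProj H w)).re := by
  simp only [← (isONB_adaptedBasis H).sum_qdetEnd_compress (isSelfAdj_perturbedProj H v w _),
    Finset.mul_sum]
  rw [Finset.sum_comm, Finset.sum_eq_single (Finset.univ.map Function.Embedding.inl)]
  · rw [span_adaptedBasis_inl, ← hxy H rfl, qdetEnd_compress_orthProj_self, projAlong_self_orth,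
      one_mul]
  · intro J hJ hne
    have hc := (Finset.mem_powersetCard.1 hJ).2
    rw [← hxy _ (by rw [finrank_span_image_coe (isONB_adaptedBasis H).orthonormal, hc]),
      qdetEnd_span_adaptedBasis_eq_zero H hc hne, zero_mul, mul_zero]
  · intro h
    exact absurd (Finset.mem_powersetCard.2 ⟨Finset.subset_univ _, by simp⟩) h

end Projections

/-! ### Measurability on the Grassmannian -/

noncomputable instance instMeasurableSpaceQuaternion : MeasurableSpace ℍ := borel ℍ

instance instBorelSpaceQuaternion : BorelSpace ℍ := ⟨rfl⟩

/-- Serves to glue functions given by a different formula in each dimension. -/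
theorem measurable_comp_nat {X : Type*} [MeasurableSpace X] {N : X → ℕ} (hN : Measurable N)
    {F : ℕ → X → ℝ} (hF : ∀ m, Measurable (F m)) : Measurable fun x => F (N x) x :=
  (measurable_from_prod_countable_right (f := fun p : ℕ × X => F p.1 p.2) hF).comp
    (hN.prodMk measurable_id)

section Measurability

set_option linter.unusedSectionVars false

variable {E : Type*} [AddCommGroup E] [Module ℍᵐᵒᵖ E] [QInner E] [Module.Finite ℍᵐᵒᵖ E]

variable (E) in
/-- The topology of the Grassmannian is induced by finitely many matrix coefficients. -/
theorem instTopologicalSpaceGr_eq_induced :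
    (instTopologicalSpaceGr : TopologicalSpace (Submodule ℍᵐᵒᵖ E)) =
      TopologicalSpace.induced (fun Q i j => qinner (onb E i) (orthProj Q (onb E j)))
        inferInstance := by
  set Φ : Submodule ℍᵐᵒᵖ E → E → E → ℍ := fun Q v w => qinner v (orthProj Q w) with hΦ
  set Ψ : Submodule ℍᵐᵒᵖ E → Fin (Module.finrank ℍᵐᵒᵖ E) → Fin (Module.finrank ℍᵐᵒᵖ E) → ℍ :=
    fun Q i j => qinner (onb E i) (orthProj Q (onb E j)) with hΨ
  let r : (E → E → ℍ) → Fin (Module.finrank ℍᵐᵒᵖ E) → Fin (Module.finrank ℍᵐᵒᵖ E) → ℍ :=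
    fun M i j => M (onb E i) (onb E j)
  let g : (Fin (Module.finrank ℍᵐᵒᵖ E) → Fin (Module.finrank ℍᵐᵒᵖ E) → ℍ) → E → E → ℍ :=
    fun M v w => ∑ i, ∑ j, qinner v (onb E i) * (M i j * qinner (onb E j) w)
  have hr : Continuous r := by fun_prop
  have hg : Continuous g := by fun_prop
  have h1 : Ψ = r ∘ Φ := rfl
  have h2 : Φ = g ∘ Ψ := by
    funext Q v w
    simp only [hΦ, hΨ, g, Function.comp_apply]
    rw [isONB_onb.qinner_eq_sum v]
    refine Finset.sum_congr rfl fun i _ => ?_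
    conv_lhs => rw [← sum_onb w]
    simp only [map_sum, map_smul, qinner_sum_right, qinner_smul_right, Finset.mul_sum]
  change TopologicalSpace.induced Φ _ = TopologicalSpace.induced Ψ _
  apply le_antisymm
  · rw [h1, ← induced_compose]
    exact induced_mono hr.le_induced
  · conv_rhs => rw [h2, ← induced_compose]
    exact induced_mono hg.le_induced

theorem continuous_qinner_orthProj (v w : E) :
    Continuous fun Q : Submodule ℍᵐᵒᵖ E => qinner v (orthProj Q w) := by
  have h : Continuous fun (Q : Submodule ℍᵐᵒᵖ E) (v w : E) => qinner v (orthProj Q w) :=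
    continuous_induced_dom
  exact (continuous_apply_apply v w).comp h

theorem continuous_gr_iff {X : Type*} [TopologicalSpace X] {f : X → Submodule ℍᵐᵒᵖ E} :
    Continuous f ↔ ∀ v w, Continuous fun x => qinner v (orthProj (f x) w) :=
  ⟨fun h v w => (continuous_qinner_orthProj v w).comp h,
    fun h => continuous_induced_rng.2 (continuous_pi fun v => continuous_pi fun w => h v w)⟩

/-- The Borel sets of an uncountable product are not generated by the coordinates, so the definition
of the topology is first reduced to the finitely many coefficients in `onb E`. -/
theorem measurable_gr_iff {X : Type*} [MeasurableSpace X] {f : X → Submodule ℍᵐᵒᵖ E} :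
    Measurable f ↔ ∀ v w, Measurable fun x => qinner v (orthProj (f x) w) := by
  refine ⟨fun h v w => (continuous_qinner_orthProj v w).measurable.comp h, fun h => ?_⟩
  have hb : (instMeasurableSpaceGr : MeasurableSpace (Submodule ℍᵐᵒᵖ E)) =
      MeasurableSpace.comap (fun Q i j => qinner (onb E i) (orthProj Q (onb E j)))
        inferInstance := by
    change @borel _ instTopologicalSpaceGr = _
    rw [instTopologicalSpaceGr_eq_induced, borel_comap, ← BorelSpace.measurable_eq]
  rw [hb, measurable_comap_iff]
  exact measurable_pi_lambda _ fun i => measurable_pi_lambda _ fun j => h _ _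

theorem retr_orthProj (Q : Submodule ℍᵐᵒᵖ E) : retr (orthProj Q) = Module.finrank ℍᵐᵒᵖ Q := by
  have h1 : orthProjOnto Q ∘ₗ Q.subtype = LinearMap.id := by
    ext x
    exact orthProj_of_mem x.2
  rw [orthProj, retr_comp_comm, h1, retr]
  simp [(isOrthonormal_onb (E := Q)).1]

theorem continuous_retr_orthProj : Continuous fun Q : Submodule ℍᵐᵒᵖ E => retr (orthProj Q) :=
  continuous_finsetSum _ fun _ _ => Quaternion.continuous_re.comp (continuous_qinner_orthProj _ _)

/-- The dimension of `Q` is the real trace of `Π_Q`, a continuous function. -/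
theorem measurable_finrank : Measurable fun Q : Submodule ℍᵐᵒᵖ E => Module.finrank ℍᵐᵒᵖ Q := by
  have h : Measurable fun Q : Submodule ℍᵐᵒᵖ E => (Module.finrank ℍᵐᵒᵖ Q : ℝ) := by
    simp only [← retr_orthProj]
    exact continuous_retr_orthProj.measurable
  refine measurable_to_countable' fun n => ?_
  convert h (measurableSet_singleton (n : ℝ)) using 1
  ext Q
  simp

theorem continuous_qinner_pow (a : Module.End ℍᵐᵒᵖ E) (r : ℕ) (v w : E) :
    Continuous fun Q : Submodule ℍᵐᵒᵖ E => qinner v (((a * orthProj Q) ^ r) w) := by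
  induction r generalizing v with
  | zero => simpa using continuous_const
  | succ r ih =>
    have h : ∀ Q : Submodule ℍᵐᵒᵖ E, qinner v (((a * orthProj Q) ^ (r + 1)) w) =
        ∑ i, qinner (adjoint a v) (orthProj Q (onb E i)) *
          qinner (onb E i) (((a * orthProj Q) ^ r) w) := by
      intro Q
      rw [pow_succ', Module.End.mul_apply, Module.End.mul_apply, ← adjoint_spec]
      conv_lhs => rw [← sum_onb (((a * orthProj Q) ^ r) w)]
      simp only [map_sum, map_smul, qinner_sum_right, qinner_smul_right]
    simp only [h]
    exact continuous_finsetSum _ fun i _ => (continuous_qinner_orthProj _ _).mul (ih _)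

theorem continuous_traceSum (a : Module.End ℍᵐᵒᵖ E) (m : ℕ) :
    Continuous fun Q : Submodule ℍᵐᵒᵖ E => traceSum m (a * orthProj Q) := by
  refine continuous_finsetSum _ fun π _ => continuous_const.mul <| continuous_finsetProd _
    fun x _ => continuous_finsetSum _ fun i _ => Quaternion.continuous_re.comp ?_
  exact continuous_qinner_pow a _ _ _

theorem measurable_qdetEnd_compress {a : Module.End ℍᵐᵒᵖ E} (ha : IsSelfAdj a) :
    Measurable fun Q : Submodule ℍᵐᵒᵖ E => qdetEnd (compress a Q) := by
  have h := measurable_comp_nat (measurable_finrank (E := E))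
    fun m => (continuous_traceSum a m).measurable.div_const (m.factorial : ℝ)
  rwa [← funext fun Q => qdetEnd_compress_eq_traceSum ha Q] at h

/-! ### Coordinate subspaces of rotated bases -/

theorem IsOrthonormal.orthProj_span {ι : Type*} {e : ι → E} (he : IsOrthonormal e)
    (J : Finset ι) (w : E) :
    orthProj (Submodule.span ℍᵐᵒᵖ (e '' (J : Set ι))) w = ∑ j ∈ J, e j <• qinner (e j) w := by
  classical
  refine orthProj_eq_of_mem (Submodule.sum_mem _ fun j hj =>
    Submodule.smul_mem _ _ (Submodule.subset_span ⟨j, hj, rfl⟩)) fun r hr => ?_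
  have h1 : ∀ i ∈ J, qinner (e i) (∑ j ∈ J, e j <• qinner (e j) w) = qinner (e i) w := by
    intro i hi
    rw [qinner_sum_right, Finset.sum_eq_single_of_mem i hi]
    · rw [qinner_smul_right, he.1, one_mul]
    · intro j _ hj
      rw [qinner_smul_right, he.2 i j hj.symm, zero_mul]
  induction hr using Submodule.span_induction with
  | mem x hx =>
    obtain ⟨i, hi, rfl⟩ := hx
    exact h1 i hi
  | zero => rw [qinner_zero_left, qinner_zero_left]
  | add x y _ _ hx hy => rw [qinner_add_left, qinner_add_left, hx, hy]
  | smul q x _ hx =>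
    have h2 := fun u => qinner_smul_left x u q.unop
    simp only [MulOpposite.op_unop] at h2
    rw [h2, h2, hx]

/-- The image of the orthonormal basis `onb E` by the isometry with matrix `u`. -/
noncomputable def rotatedBasis (u : UMat (Module.finrank ℍᵐᵒᵖ E))
    (j : Fin (Module.finrank ℍᵐᵒᵖ E)) : E :=
  ∑ k, onb E k <• (u : Matrix (Fin _) (Fin _) ℍ) k j

theorem isOrthonormal_sum_smul {n : ℕ} {e : Fin n → E} (he : IsOrthonormal e)
    {U : Matrix (Fin n) (Fin n) ℍ} (hU : star U * U = 1) :
    IsOrthonormal fun j => ∑ k, e k <• U k j := by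
  have h : ∀ i j, qinner (∑ k, e k <• U k i) (∑ k, e k <• U k j) = (star U * U) i j := by
    intro i j
    rw [Matrix.mul_apply, qinner_sum_left]
    refine Finset.sum_congr rfl fun k _ => ?_
    rw [qinner_smul_left, he.qinner_sum, Matrix.star_apply]
  constructor
  · intro i
    rw [h, hU, Matrix.one_apply_eq]
  · intro i j hij
    rw [h, hU, Matrix.one_apply_ne hij]

theorem isOrthonormal_rotatedBasis (u : UMat (Module.finrank ℍᵐᵒᵖ E)) :
    IsOrthonormal (rotatedBasis (E := E) u) :=
  isOrthonormal_sum_smul isOrthonormal_onb (Unitary.mem_iff.1 u.2).1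

theorem continuous_qinner_rotatedBasis (v : E) (j : Fin (Module.finrank ℍᵐᵒᵖ E)) :
    Continuous fun u : UMat (Module.finrank ℍᵐᵒᵖ E) => qinner v (rotatedBasis u j) := by
  simp only [rotatedBasis, qinner_sum_right, qinner_smul_right]
  refine continuous_finsetSum _ fun k _ => continuous_const.mul ?_
  exact continuous_subtype_val.matrix_elem k j

theorem rotatedSubspace_eq (J : Finset (Fin (Module.finrank ℍᵐᵒᵖ E)))
    (u : UMat (Module.finrank ℍᵐᵒᵖ E)) :
    rotatedSubspace E J u = Submodule.span ℍᵐᵒᵖ (rotatedBasis (E := E) u '' (J : Set _)) := rfl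

theorem continuous_rotatedSubspace (J : Finset (Fin (Module.finrank ℍᵐᵒᵖ E))) :
    Continuous (rotatedSubspace E J) := by
  refine continuous_gr_iff.2 fun v w => ?_
  simp only [rotatedSubspace_eq, (isOrthonormal_rotatedBasis _).orthProj_span, qinner_sum_right,
    qinner_smul_right]
  refine continuous_finsetSum _ fun j _ => (continuous_qinner_rotatedBasis v j).mul ?_
  simp only [← star_qinner w]
  exact (continuous_qinner_rotatedBasis w j).star

instance (n : ℕ) : IsProbabilityMeasure (haarU n) := ⟨by
  have h := Measure.haarMeasure_self (K₀ := (⊤ : TopologicalSpace.PositiveCompacts (UMat n)))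
  simpa [haarU] using h⟩

variable {s : ℕ} (σ : Splitting E s)

/-- The projection on an orthogonal sum of subspaces of the blocks is the sum of the projections
inside the blocks. -/
theorem qinner_assemble (Q : ∀ i, Submodule ℍᵐᵒᵖ (σ.block i)) (v w : E) :
    qinner v (orthProj (σ.assemble Q).1 w) =
      ∑ i, qinner (orthProjOnto (σ.block i) v) (orthProj (Q i) (orthProjOnto (σ.block i) w)) := by
  have h : orthProj (σ.assemble Q).1 w =
      ∑ i, (orthProj (Q i) (orthProjOnto (σ.block i) w) : E) := by
    refine orthProj_eq_of_mem (Submodule.sum_mem _ fun i _ => ?_) fun r hr => ?_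
    · exact Submodule.mem_iSup_of_mem i ⟨_, orthProj_mem _ _, rfl⟩
    · have hr' : r ∈ ⨆ i, (Q i).map (σ.block i).subtype := hr
      induction hr' using Submodule.iSup_induction' with
      | mem i x hx =>
        obtain ⟨x, hx, rfl⟩ := hx
        rw [qinner_sum_right, Finset.sum_eq_single i]
        · change qinner x (orthProj (Q i) _) = _
          rw [qinner_orthProj hx]
          exact qinner_orthProjOnto x w
        · intro j _ hj
          exact σ.orthogonal i j hj.symm _ x.2 _ (orthProj (Q j) _).2
        · simp
      | zero => rw [qinner_zero_left, qinner_zero_left]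
      | add x y hx' hy' hx hy =>
        rw [qinner_add_left, qinner_add_left, hx hx', hy hy']
  rw [h, qinner_sum_right]
  refine Finset.sum_congr rfl fun i _ => ?_
  rw [coe_qinner, coe_orthProjOnto, qinner_orthProj_left (orthProj (Q i) _).2]

theorem measurable_assemble : Measurable σ.assemble := by
  refine Measurable.subtype_mk (measurable_gr_iff.2 fun v w => ?_)
  have h := qinner_assemble σ
  simp only [Splitting.assemble] at h
  simp only [h]
  exact Finset.measurable_fun_sum _ fun i _ =>
    (measurable_gr_iff.1 measurable_id _ _).comp (measurable_pi_apply i)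

theorem measurable_incl (Q : σ.Gr) : Measurable (σ.incl Q) := by
  refine Measurable.subtype_mk (measurable_gr_iff.2 fun v w => ?_)
  have h : ∀ R : Submodule ℍᵐᵒᵖ Q.1, qinner v (orthProj (R.map Q.1.subtype) w) =
      qinner (orthProjOnto Q.1 v) (orthProj R (orthProjOnto Q.1 w)) := by
    intro R
    have h1 : orthProj (R.map Q.1.subtype) w = orthProj R (orthProjOnto Q.1 w) := by
      refine orthProj_eq_of_mem ⟨_, orthProj_mem _ _, rfl⟩ ?_
      rintro _ ⟨x, hx, rfl⟩
      change qinner x (orthProj R _) = _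
      rw [qinner_orthProj hx]
      exact qinner_orthProjOnto x w
    rw [h1, coe_qinner, coe_orthProjOnto, qinner_orthProj_left (orthProj R _).2]
  simp only [h]
  exact (measurable_gr_iff.1 measurable_id _ _).comp measurable_subtype_coe

end Measurability

/-! ### Integration with respect to the invariant measure of a splitting -/

section Integration

set_option linter.unusedSectionVars false

variable {E : Type*} [AddCommGroup E] [Module ℍᵐᵒᵖ E] [QInner E] [Module.Finite ℍᵐᵒᵖ E]
  {s : ℕ} (σ : Splitting E s)

namespace Splitting

/-- The set which indexes the orthonormal bases adapted to a splitting. -/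
abbrev Index : Type := Σ i : Fin s, Fin (Module.finrank ℍᵐᵒᵖ (σ.block i))

/-- The product of the groups of isometries of the blocks. -/
abbrev Isometries : Type := ∀ i, UMat (Module.finrank ℍᵐᵒᵖ (σ.block i))

/-- The orthonormal basis obtained by rotating the basis of each block. -/
noncomputable def basis (u : σ.Isometries) (p : σ.Index) : E :=
  (rotatedBasis (E := σ.block p.1) (u p.1) p.2 : E)

theorem isONB_basis (u : σ.Isometries) : IsONB (σ.basis u) := by
  have ho := fun i => isOrthonormal_rotatedBasis (E := σ.block i) (u i)
  have h : IsOrthonormal (σ.basis u) := by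
    refine ⟨fun p => (ho p.1).1 p.2, ?_⟩
    rintro ⟨i, j⟩ ⟨i', j'⟩ hne
    by_cases hi : i = i'
    · subst hi
      exact (ho i).2 j j' fun hj => hne (by rw [hj])
    · exact σ.orthogonal i i' hi _ (rotatedBasis (u i) j).2 _ (rotatedBasis (u i') j').2
  refine h.isONB_of_span (eq_top_iff.2 ?_)
  rw [← σ.iSup_block]
  refine iSup_le fun i v hv => ?_
  have h1 := ((ho i).isONB_of_card (by simp)).sum_eq ⟨v, hv⟩
  have h2 := congrArg (σ.block i).subtype h1
  rw [map_sum] at h2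
  have h3 : (σ.block i).subtype ⟨v, hv⟩ = v := rfl
  rw [← h3, ← h2]
  exact Submodule.sum_mem _ fun j _ =>
    Submodule.smul_mem _ _ (Submodule.subset_span ⟨⟨i, j⟩, rfl⟩)

/-- The adapted subspace spanned by the vectors of an adapted basis indexed by `J`. -/
noncomputable def coordSubspace (J : ∀ i, Finset (Fin (Module.finrank ℍᵐᵒᵖ (σ.block i))))
    (u : σ.Isometries) : σ.Gr :=
  σ.assemble fun i => rotatedSubspace (σ.block i) (J i) (u i)

theorem coe_coordSubspace (J : ∀ i, Finset (Fin (Module.finrank ℍᵐᵒᵖ (σ.block i))))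
    (u : σ.Isometries) :
    (σ.coordSubspace J u).1 =
      Submodule.span ℍᵐᵒᵖ (σ.basis u '' ((Finset.univ.sigma J : Finset σ.Index) : Set σ.Index)) := by
  simp only [coordSubspace, assemble, rotatedSubspace_eq, Submodule.map_span]
  rw [← Submodule.span_iUnion]
  congr 1
  ext x
  simp only [Set.mem_iUnion, Set.mem_image, Finset.mem_coe, Finset.mem_sigma, Finset.mem_univ,
    true_and]
  constructor
  · rintro ⟨i, y, ⟨j, hj, rfl⟩, rfl⟩
    exact ⟨⟨i, j⟩, hj, rfl⟩
  · rintro ⟨⟨i, j⟩, hj, rfl⟩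
    exact ⟨i, _, ⟨j, hj, rfl⟩, rfl⟩

theorem finrank_coordSubspace (J : ∀ i, Finset (Fin (Module.finrank ℍᵐᵒᵖ (σ.block i))))
    (u : σ.Isometries) :
    Module.finrank ℍᵐᵒᵖ (σ.coordSubspace J u).1 = (Finset.univ.sigma J : Finset σ.Index).card := by
  rw [coe_coordSubspace, finrank_span_image_coe (σ.isONB_basis u).orthonormal]

theorem continuous_coordSubspace (J : ∀ i, Finset (Fin (Module.finrank ℍᵐᵒᵖ (σ.block i)))) :
    Continuous fun u => (σ.coordSubspace J u).1 := by
  refine continuous_gr_iff.2 fun v w => ?_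
  have h : ∀ (v : E) (p : σ.Index), Continuous fun u => qinner v (σ.basis u p) := by
    intro v p
    have h1 : ∀ u : σ.Isometries, qinner v (σ.basis u p) =
        qinner (orthProjOnto (σ.block p.1) v) (rotatedBasis (u p.1) p.2) := fun u =>
      (qinner_orthProj_left (rotatedBasis (E := σ.block p.1) (u p.1) p.2).2 v).symm
    simp only [h1]
    exact (continuous_qinner_rotatedBasis _ _).comp (continuous_apply p.1)
  simp only [coe_coordSubspace, (σ.isONB_basis _).orthonormal.orthProj_span, qinner_sum_right,
    qinner_smul_right]
  refine continuous_finsetSum _ fun p _ => (h v p).mul ?_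
  simp only [← star_qinner w]
  exact (h w p).star

theorem measurable_coordSubspace (J : ∀ i, Finset (Fin (Module.finrank ℍᵐᵒᵖ (σ.block i)))) :
    Measurable (σ.coordSubspace J) :=
  (measurable_assemble σ).comp <| measurable_pi_lambda _ fun i =>
    (continuous_rotatedSubspace (J i)).measurable.comp (measurable_pi_apply i)

/-- The Haar measure on the product of the groups of isometries of the blocks. -/
noncomputable def haar : Measure σ.Isometries := Measure.pi fun _ => haarU _

instance : IsProbabilityMeasure σ.haar := by unfold haar; infer_instance

/-- Expanding the product of the sums that define the `ν^{E_i}` exhibits `ν^{E,σ}` as the average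
over adapted bases of the sum of Dirac masses at all their coordinate subspaces. -/
theorem invMeasure_eq_sum : σ.invMeasure =
    ∑ J : ∀ i, Finset (Fin (Module.finrank ℍᵐᵒᵖ (σ.block i))), σ.haar.map (σ.coordSubspace J) := by
  have hm : ∀ i (J : Finset (Fin (Module.finrank ℍᵐᵒᵖ (σ.block i)))),
      Measurable (rotatedSubspace (σ.block i) J) := fun i J =>
    (continuous_rotatedSubspace J).measurable
  have hp : ∀ i (J : Finset (Fin (Module.finrank ℍᵐᵒᵖ (σ.block i)))),
      IsProbabilityMeasure ((haarU _).map (rotatedSubspace (σ.block i) J)) := fun i J =>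
    Measure.isProbabilityMeasure_map (hm i J).aemeasurable
  have hf : ∀ i, IsFiniteMeasure (QDLP.invMeasure (σ.block i)) := fun i => by
    unfold QDLP.invMeasure; infer_instance
  have hpi : Measure.pi (fun i => QDLP.invMeasure (σ.block i)) =
      ∑ J : ∀ i, Finset (Fin (Module.finrank ℍᵐᵒᵖ (σ.block i))),
        Measure.pi fun i => (haarU _).map (rotatedSubspace (σ.block i) (J i)) := by
    refine Measure.pi_eq fun t _ => ?_
    simp only [QDLP.invMeasure, Measure.finsetSum_apply, Measure.pi_pi]
    rw [Finset.prod_univ_sum, Fintype.piFinset_univ]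
  rw [invMeasure, hpi, Measure.map_finset_sum (measurable_assemble σ).aemeasurable]
  refine Finset.sum_congr rfl fun J _ => ?_
  rw [← Measure.pi_map_pi fun i => (hm i (J i)).aemeasurable,
    Measure.map_map (measurable_assemble σ)]
  · rfl
  · exact measurable_pi_lambda _ fun i => (hm i (J i)).comp (measurable_pi_apply i)

theorem measurableSet_finrank_eq (m : ℕ) :
    MeasurableSet {R : σ.Gr | Module.finrank ℍᵐᵒᵖ R.1 = m} :=
  (measurable_finrank.comp measurable_subtype_coe) (measurableSet_singleton m)

theorem measurable_qdetEnd {a : E →ₗ[ℍᵐᵒᵖ] E} (ha : IsSelfAdj a) :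
    Measurable fun R : σ.Gr => qdetEnd (compress a R.1) :=
  (measurable_qdetEnd_compress ha).comp measurable_subtype_coe

theorem sum_finset_sigma (G : Finset σ.Index → ℝ) :
    ∑ J : ∀ i, Finset (Fin (Module.finrank ℍᵐᵒᵖ (σ.block i))), G (Finset.univ.sigma J) =
      ∑ K : Finset σ.Index, G K := by
  refine Finset.sum_bij' (fun J _ => Finset.univ.sigma J)
    (fun K _ => fun i => Finset.univ.filter fun j => (⟨i, j⟩ : σ.Index) ∈ K)
    (fun _ _ => Finset.mem_univ _) (fun _ _ => Finset.mem_univ _) ?_ ?_ fun _ _ => rfl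
  · intro J _
    ext i j
    simp
  · intro K _
    ext ⟨i, j⟩
    simp

/-- The dimension is fixed by `J`, so the integrand is continuous on a compact group, hence bounded.
-/
theorem integrable_coordSubspace {a : E →ₗ[ℍᵐᵒᵖ] E} (ha : IsSelfAdj a)
    (J : ∀ i, Finset (Fin (Module.finrank ℍᵐᵒᵖ (σ.block i)))) :
    Integrable (fun u => qdetEnd (compress a (σ.coordSubspace J u).1)) σ.haar := by
  have hc : Continuous fun u => qdetEnd (compress a (σ.coordSubspace J u).1) := by
    simp only [qdetEnd_compress_eq_traceSum ha, finrank_coordSubspace]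
    exact ((continuous_traceSum a _).comp (σ.continuous_coordSubspace J)).div_const _
  obtain ⟨C, hC⟩ := isCompact_univ.exists_bound_of_continuousOn hc.continuousOn
  refine Integrable.of_bound
    ((σ.measurable_qdetEnd ha).comp (σ.measurable_coordSubspace J)).aestronglyMeasurable C ?_
  exact Filter.Eventually.of_forall fun u => hC u (Set.mem_univ u)

theorem integrable_indicator_coordSubspace {a : E →ₗ[ℍᵐᵒᵖ] E} (ha : IsSelfAdj a) (m : ℕ)
    (J : ∀ i, Finset (Fin (Module.finrank ℍᵐᵒᵖ (σ.block i)))) :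
    Integrable (fun u => {R : σ.Gr | Module.finrank ℍᵐᵒᵖ R.1 = m}.indicator
      (fun R => qdetEnd (compress a R.1)) (σ.coordSubspace J u)) σ.haar := by
  by_cases h : (Finset.univ.sigma J : Finset σ.Index).card = m
  · have : ∀ u, {R : σ.Gr | Module.finrank ℍᵐᵒᵖ R.1 = m}.indicator
        (fun R => qdetEnd (compress a R.1)) (σ.coordSubspace J u) =
        qdetEnd (compress a (σ.coordSubspace J u).1) := fun u =>
      Set.indicator_of_mem (s := {R : σ.Gr | Module.finrank ℍᵐᵒᵖ R.1 = m})
        ((σ.finrank_coordSubspace J u).trans h) _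
    simp only [this]
    exact σ.integrable_coordSubspace ha J
  · have : ∀ u, {R : σ.Gr | Module.finrank ℍᵐᵒᵖ R.1 = m}.indicator
        (fun R => qdetEnd (compress a R.1)) (σ.coordSubspace J u) = 0 := fun u =>
      Set.indicator_of_notMem (s := {R : σ.Gr | Module.finrank ℍᵐᵒᵖ R.1 = m})
        (fun h' => h ((σ.finrank_coordSubspace J u).symm.trans h')) _
    simp only [this]
    exact integrable_zero _ _ _

/-- For a fixed `u`, the families `J` are the subsets of the index set of an orthonormal basis of
the whole of `E`, so the sum depends neither on `u` nor on `σ`. -/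
theorem sum_indicator_coordSubspace {a : E →ₗ[ℍᵐᵒᵖ] E} (ha : IsSelfAdj a) (m : ℕ)
    (u : σ.Isometries) :
    ∑ J, {R : σ.Gr | Module.finrank ℍᵐᵒᵖ R.1 = m}.indicator
      (fun R => qdetEnd (compress a R.1)) (σ.coordSubspace J u) = traceSum m a / m.factorial := by
  classical
  rw [← (σ.isONB_basis u).sum_qdetEnd_compress ha m]
  set G : Finset σ.Index → ℝ := fun K => if K.card = m then
    qdetEnd (compress a (Submodule.span ℍᵐᵒᵖ (σ.basis u '' (K : Set σ.Index)))) else 0 with hG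
  have h : ∀ J, {R : σ.Gr | Module.finrank ℍᵐᵒᵖ R.1 = m}.indicator
      (fun R => qdetEnd (compress a R.1)) (σ.coordSubspace J u) = G (Finset.univ.sigma J) := by
    intro J
    rw [Set.indicator_apply]
    simp only [Set.mem_ofPred_eq, finrank_coordSubspace, hG]
    rw [coe_coordSubspace]
  rw [Finset.sum_congr rfl fun J _ => h J, σ.sum_finset_sigma G, hG, ← Finset.sum_filter]
  refine Finset.sum_congr ?_ fun _ _ => rfl
  ext K
  simp

theorem integrable_indicator_qdetEnd {a : E →ₗ[ℍᵐᵒᵖ] E} (ha : IsSelfAdj a) (m : ℕ) :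
    Integrable ({R : σ.Gr | Module.finrank ℍᵐᵒᵖ R.1 = m}.indicator
      fun R => qdetEnd (compress a R.1)) σ.invMeasure := by
  rw [invMeasure_eq_sum, integrable_finsetSum_measure]
  intro J _
  rw [integrable_map_measure _ (σ.measurable_coordSubspace J).aemeasurable]
  · exact σ.integrable_indicator_coordSubspace ha m J
  · exact ((σ.measurable_qdetEnd ha).indicator
      (σ.measurableSet_finrank_eq m)).aestronglyMeasurable

/-- Once the sum over `J` is taken inside the integral, the integrand is constant and the Haar
measure has mass `1`. -/
theorem setIntegral_qdetEnd {a : E →ₗ[ℍᵐᵒᵖ] E} (ha : IsSelfAdj a) (m : ℕ) :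
    ∫ R in {R : σ.Gr | Module.finrank ℍᵐᵒᵖ R.1 = m}, qdetEnd (compress a R.1) ∂σ.invMeasure =
      traceSum m a / m.factorial := by
  have hint := σ.integrable_indicator_qdetEnd ha m
  rw [← integral_indicator (σ.measurableSet_finrank_eq m)]
  rw [invMeasure_eq_sum] at hint ⊢
  rw [integral_finsetSum_measure (integrable_finsetSum_measure.1 hint)]
  have h : ∀ J, ∫ R, {R : σ.Gr | Module.finrank ℍᵐᵒᵖ R.1 = m}.indicator
      (fun R => qdetEnd (compress a R.1)) R ∂(σ.haar.map (σ.coordSubspace J)) =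
      ∫ u, {R : σ.Gr | Module.finrank ℍᵐᵒᵖ R.1 = m}.indicator
        (fun R => qdetEnd (compress a R.1)) (σ.coordSubspace J u) ∂σ.haar := fun J =>
    integral_map (σ.measurable_coordSubspace J).aemeasurable
      ((σ.measurable_qdetEnd ha).indicator
        (σ.measurableSet_finrank_eq m)).aestronglyMeasurable
  rw [Finset.sum_congr rfl fun J _ => h J,
    ← integral_finsetSum _ fun J _ => σ.integrable_indicator_coordSubspace ha m J]
  simp only [σ.sum_indicator_coordSubspace ha m]
  simp

theorem integrableOn_qdetEnd {a : E →ₗ[ℍᵐᵒᵖ] E} (ha : IsSelfAdj a) (m : ℕ) :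
    Integrable (fun R : σ.Gr => qdetEnd (compress a R.1))
      (σ.invMeasure.restrict {R : σ.Gr | Module.finrank ℍᵐᵒᵖ R.1 = m}) :=
  (integrable_indicator_iff (σ.measurableSet_finrank_eq m)).1 (σ.integrable_indicator_qdetEnd ha m)

/-! ### The incidence measure -/

/-- Among the subspaces of `Q`, the only one with at least the dimension of `Q` is `Q` itself. -/
theorem map_incl_invMeasure_apply (Q : σ.Gr) {S : Set σ.Gr} (hS : MeasurableSet S)
    (hd : ∀ R ∈ S, Module.finrank ℍᵐᵒᵖ Q.1 ≤ Module.finrank ℍᵐᵒᵖ R.1) :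
    ((σ.induced Q).invMeasure.map (σ.incl Q)) S = S.indicator 1 Q := by
  set τ := σ.induced Q with hτ
  have hfin : ∀ R : τ.Gr, Module.finrank ℍᵐᵒᵖ (σ.incl Q R).1 = Module.finrank ℍᵐᵒᵖ R.1 := fun R =>
    (Submodule.equivMapOfInjective Q.1.subtype Q.1.injective_subtype R.1).finrank_eq.symm
  rw [Measure.map_apply (measurable_incl σ Q) hS, invMeasure_eq_sum, Measure.finsetSum_apply,
    -- Taking all the basis vectors yields `Q` itself; any other `J` yields a subspace of smaller
    -- dimension, which is not in `S`.
    Finset.sum_eq_single fun _ => Finset.univ]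
  · rw [Measure.map_apply (τ.measurable_coordSubspace _) (measurable_incl σ Q hS)]
    have h : ∀ u, σ.incl Q (τ.coordSubspace (fun _ => Finset.univ) u) = Q := by
      intro u
      have h1 : (τ.coordSubspace (fun _ => Finset.univ) u).1 = ⊤ := by
        rw [coe_coordSubspace, ← (τ.isONB_basis u).span_eq_top]
        simp
      refine Subtype.ext ?_
      change Submodule.map Q.1.subtype _ = Q.1
      rw [h1, Submodule.map_subtype_top]
    by_cases hQ : Q ∈ S
    · have : τ.coordSubspace (fun _ => Finset.univ) ⁻¹' (σ.incl Q ⁻¹' S) = Set.univ := by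
        ext u
        simp [h, hQ]
      rw [this, measure_univ, Set.indicator_of_mem hQ]
      rfl
    · have : τ.coordSubspace (fun _ => Finset.univ) ⁻¹' (σ.incl Q ⁻¹' S) = ∅ := by
        ext u
        simp [h, hQ]
      rw [this, measure_empty, Set.indicator_of_notMem hQ]
  · intro J _ hJ
    rw [Measure.map_apply (τ.measurable_coordSubspace _) (measurable_incl σ Q hS)]
    have : τ.coordSubspace J ⁻¹' (σ.incl Q ⁻¹' S) = ∅ := by
      refine Set.eq_empty_of_forall_notMem fun u hu => hJ ?_
      have h1 := hd _ hu
      rw [hfin, finrank_coordSubspace, (τ.isONB_basis u).finrank_eq] at h1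
      have h2 := (Finset.card_eq_iff_eq_univ _).1 (le_antisymm (Finset.card_le_univ _) h1)
      funext i
      ext j
      have h3 : (⟨i, j⟩ : τ.Index) ∈ Finset.univ.sigma J := h2 ▸ Finset.mem_univ _
      simpa using h3
    rw [this, measure_empty]
  · simp

end Splitting

end Integration

/-! ### Determinantal measures whose kernel is a projection -/

section Determinantal

variable {E : Type*} [AddCommGroup E] [Module ℍᵐᵒᵖ E] [QInner E] [Module.Finite ℍᵐᵒᵖ E]
  {s : ℕ} {σ : Splitting E s} {H : Submodule ℍᵐᵒᵖ E} {μ : Measure σ.Gr}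

variable (σ H) in
theorem lintegral_qdetEnd_orthProj :
    ∫⁻ R in {R : σ.Gr | Module.finrank ℍᵐᵒᵖ R.1 = Module.finrank ℍᵐᵒᵖ H},
      ENNReal.ofReal (qdetEnd (compress (orthProj H) R.1)) ∂σ.invMeasure = 1 := by
  rw [← ofReal_integral_eq_lintegral_ofReal (σ.integrableOn_qdetEnd (isSelfAdj_orthProj H) _)
    (Filter.Eventually.of_forall fun R => qdetEnd_compress_orthProj_nonneg H R.1),
    σ.setIntegral_qdetEnd (isSelfAdj_orthProj H), traceSum_orthProj, ENNReal.ofReal_one]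

namespace Splitting

/-- `Measure.bind` is the zero measure when the family is not almost everywhere measurable. The
incidence measure is not zero, as it gives mass `1` to the subspaces of dimension `dim H`. -/
theorem IsDLP.aemeasurable (h : σ.IsDLP (orthProj H) μ) :
    AEMeasurable (fun Q => (σ.induced Q).invMeasure.map (σ.incl Q)) μ := by
  by_contra hn
  have h1 : σ.incidence μ = 0 := by
    rw [incidence, Measure.bind, Measure.map_of_not_aemeasurable hn, Measure.join_zero]
  have h2 := lintegral_qdetEnd_orthProj σ H
  rw [← withDensity_apply _ (σ.measurableSet_finrank_eq _), ← h.incidence_eq, h1] at h2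
  simp at h2

theorem IsDLP.lintegral_map_incl (h : σ.IsDLP (orthProj H) μ) {S : Set σ.Gr}
    (hS : MeasurableSet S) :
    ∫⁻ Q, ((σ.induced Q).invMeasure.map (σ.incl Q)) S ∂μ =
      ∫⁻ R in S, ENNReal.ofReal (qdetEnd (compress (orthProj H) R.1)) ∂σ.invMeasure := by
  rw [← withDensity_apply _ hS, ← h.incidence_eq, incidence, Measure.bind_apply hS h.aemeasurable]

/-- If `dim Q = m`, then `ν^{Q,σ_Q}` gives mass `1` to the subspaces of dimension `m`. For `m > dim
H` the incidence measure does not charge them, as its density vanishes there. -/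
theorem IsDLP.ae_finrank_le (h : σ.IsDLP (orthProj H) μ) :
    ∀ᵐ Q ∂μ, Module.finrank ℍᵐᵒᵖ Q.1 ≤ Module.finrank ℍᵐᵒᵖ H := by
  have key : ∀ m, Module.finrank ℍᵐᵒᵖ H < m → ∀ᵐ Q ∂μ, Module.finrank ℍᵐᵒᵖ Q.1 ≠ m := by
    intro m hm
    have h1 := h.lintegral_map_incl (σ.measurableSet_finrank_eq m)
    have h2 : ∫⁻ R in {R : σ.Gr | Module.finrank ℍᵐᵒᵖ R.1 = m},
        ENNReal.ofReal (qdetEnd (compress (orthProj H) R.1)) ∂σ.invMeasure = 0 := by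
      rw [setLIntegral_congr_fun (g := fun _ => 0) (σ.measurableSet_finrank_eq m)]
      · simp
      · intro R hR
        have hR' : Module.finrank ℍᵐᵒᵖ R.1 = m := hR
        simp only
        rw [qdetEnd_compress_orthProj_eq_zero (by omega), ENNReal.ofReal_zero]
    have hae : AEMeasurable (fun Q => ((σ.induced Q).invMeasure.map (σ.incl Q))
        {R : σ.Gr | Module.finrank ℍᵐᵒᵖ R.1 = m}) μ :=
      (Measure.measurable_coe (σ.measurableSet_finrank_eq m)).comp_aemeasurable h.aemeasurable
    rw [h2, lintegral_eq_zero_iff' hae] at h1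
    filter_upwards [h1] with Q hQ hm'
    rw [Pi.zero_apply, σ.map_incl_invMeasure_apply Q (σ.measurableSet_finrank_eq m)
      (fun R hR => (hm'.trans (Eq.symm hR)).le), Set.indicator_of_mem (show Q ∈ _ from hm')] at hQ
    exact one_ne_zero hQ
  have h2 : ∀ᵐ Q ∂μ, ∀ m, Module.finrank ℍᵐᵒᵖ H < m → Module.finrank ℍᵐᵒᵖ Q.1 ≠ m := by
    rw [ae_all_iff]
    intro m
    by_cases hm : Module.finrank ℍᵐᵒᵖ H < m
    · filter_upwards [key m hm] with Q hQ _ using hQ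
    · exact Filter.Eventually.of_forall fun Q hm' => absurd hm' hm
  filter_upwards [h2] with Q hQ
  by_contra hlt
  exact hQ _ (not_le.1 hlt) rfl

/-- As `dim Q ≤ dim H` almost surely, `Q` has no subspace of dimension `dim H` except possibly
itself, so the incidence measure reduces to `μ` on this set. -/
theorem IsDLP.measure_inter (h : σ.IsDLP (orthProj H) μ) {S : Set σ.Gr} (hS : MeasurableSet S) :
    μ (S ∩ {R | Module.finrank ℍᵐᵒᵖ R.1 = Module.finrank ℍᵐᵒᵖ H}) =
      ∫⁻ R in S ∩ {R | Module.finrank ℍᵐᵒᵖ R.1 = Module.finrank ℍᵐᵒᵖ H},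
        ENNReal.ofReal (qdetEnd (compress (orthProj H) R.1)) ∂σ.invMeasure := by
  have hS' := hS.inter (σ.measurableSet_finrank_eq (Module.finrank ℍᵐᵒᵖ H))
  rw [← h.lintegral_map_incl hS', ← lintegral_indicator_one hS']
  refine lintegral_congr_ae ?_
  filter_upwards [h.ae_finrank_le] with Q hQ
  rw [σ.map_incl_invMeasure_apply Q hS' fun R hR => hQ.trans (Eq.symm hR.2).le]

/-- A determinantal measure with kernel `Π_H` has the density `R ↦ det_ℜ((Π_H)_R^R)` on the set
of subspaces of the same dimension as `H`. -/
theorem IsDLP.eq_withDensity (h : σ.IsDLP (orthProj H) μ) :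
    μ = (σ.invMeasure.restrict {R | Module.finrank ℍᵐᵒᵖ R.1 = Module.finrank ℍᵐᵒᵖ H}).withDensity
      fun R => ENNReal.ofReal (qdetEnd (compress (orthProj H) R.1)) := by
  have hμ := h.isProbabilityMeasure
  set D : Set σ.Gr := {R | Module.finrank ℍᵐᵒᵖ R.1 = Module.finrank ℍᵐᵒᵖ H} with hD
  have hDm : MeasurableSet D := σ.measurableSet_finrank_eq _
  -- The density has total mass `1` on `D`, and `μ` is a probability measure.
  have h1 : ∀ᵐ Q ∂μ, Q ∈ D := by
    have h2 := h.measure_inter MeasurableSet.univ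
    rw [Set.univ_inter, lintegral_qdetEnd_orthProj] at h2
    exact mem_ae_iff.2 ((prob_compl_eq_zero_iff hDm).2 h2)
  ext S hS
  rw [withDensity_apply _ hS, Measure.restrict_restrict hS, ← h.measure_inter hS]
  refine measure_congr ?_
  filter_upwards [h1] with Q hQ
  exact propext ⟨fun hQS => ⟨hQS, hQ⟩, fun hQS => hQS.1⟩

theorem IsDLP.ae_isCompl (h : σ.IsDLP (orthProj H) μ) : ∀ᵐ Q ∂μ, IsCompl Q.1 (orth H) := by
  rw [h.eq_withDensity,
    ae_withDensity_iff (σ.measurable_qdetEnd (isSelfAdj_orthProj H)).ennreal_ofReal]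
  filter_upwards [ae_restrict_mem (σ.measurableSet_finrank_eq _)] with R hR h0
  refine isCompl_orth_of_qdetEnd_ne_zero (fun h1 => h0 ?_) hR
  rw [h1, ENNReal.ofReal_zero]

/-- Multiplication by the density turns the integrand into a finite combination of determinants of
compressions. Each is integrable, with an integral given by the averaging formula. -/
theorem IsDLP.integral_re_qinner_projAlong (h : σ.IsDLP (orthProj H) μ) (v w : E) :
    Integrable (fun Q => (qinner v (projAlong Q.1 (orth H) w)).re) μ ∧
      ∫ Q, (qinner v (projAlong Q.1 (orth H) w)).re ∂μ = (qinner v (orthProj H w)).re := by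
  obtain ⟨N, x, y, hxy⟩ := exists_perturbedProj_weights (E := E) (Module.finrank ℍᵐᵒᵖ H)
  have hxy' := fun (R : Submodule ℍᵐᵒᵖ E) (hR : Module.finrank ℍᵐᵒᵖ R = Module.finrank ℍᵐᵒᵖ H) =>
    hxy H R v w hR hR
  have hmeas : Measurable fun R : σ.Gr => ENNReal.ofReal (qdetEnd (compress (orthProj H) R.1)) :=
    (σ.measurable_qdetEnd (isSelfAdj_orthProj H)).ennreal_ofReal
  have hlt : ∀ᵐ R ∂(σ.invMeasure.restrict
      {R : σ.Gr | Module.finrank ℍᵐᵒᵖ R.1 = Module.finrank ℍᵐᵒᵖ H}),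
      ENNReal.ofReal (qdetEnd (compress (orthProj H) R.1)) < ⊤ :=
    Filter.Eventually.of_forall fun R => ENNReal.ofReal_lt_top
  have hint : ∀ j, Integrable
      (fun R : σ.Gr => x j * qdetEnd (compress (perturbedProj H v w (y j)) R.1))
      (σ.invMeasure.restrict {R : σ.Gr | Module.finrank ℍᵐᵒᵖ R.1 = Module.finrank ℍᵐᵒᵖ H}) :=
    fun j => (σ.integrableOn_qdetEnd (isSelfAdj_perturbedProj H v w (y j)) _).const_mul _
  have hae : (fun R : σ.Gr => (ENNReal.ofReal (qdetEnd (compress (orthProj H) R.1))).toReal •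
      (qinner v (projAlong R.1 (orth H) w)).re) =ᵐ[σ.invMeasure.restrict
        {R : σ.Gr | Module.finrank ℍᵐᵒᵖ R.1 = Module.finrank ℍᵐᵒᵖ H}]
      fun R => 2⁻¹ * ∑ j, x j * qdetEnd (compress (perturbedProj H v w (y j)) R.1) := by
    filter_upwards [ae_restrict_mem (σ.measurableSet_finrank_eq _)] with R hR
    rw [← hxy' R.1 hR, ENNReal.toReal_ofReal (qdetEnd_compress_orthProj_nonneg H R.1), smul_eq_mul]
    ring
  rw [h.eq_withDensity, integrable_withDensity_iff_integrable_smul' hmeas hlt,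
    integral_withDensity_eq_integral_toReal_smul hmeas hlt, integrable_congr hae,
    integral_congr_ae hae]
  refine ⟨(integrable_finsetSum _ fun j _ => hint j).const_mul _, ?_⟩
  rw [integral_const_mul, integral_finsetSum _ fun j _ => hint j]
  simp only [integral_const_mul, σ.setIntegral_qdetEnd (isSelfAdj_perturbedProj H v w _)]
  rw [sum_weights_traceSum hxy']
  ring

end Splitting

/-- The expectation of a random quaternion is determined by those of the real parts of its right
multiples. -/
theorem integral_quaternion_of_re {Ω : Type*} [MeasurableSpace Ω] {P : Measure Ω} {X : Ω → ℍ}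
    {x : ℍ} (hX : ∀ q : ℍ, Integrable (fun ω => (X ω * q).re) P ∧
      ∫ ω, (X ω * q).re ∂P = (x * q).re) :
    Integrable X P ∧ ∫ ω, X ω ∂P = x := by
  obtain ⟨i, i0, i1, i2, i3⟩ : ∃ i : ℍ, i.re = 0 ∧ i.imI = 1 ∧ i.imJ = 0 ∧ i.imK = 0 :=
    ⟨⟨0, 1, 0, 0⟩, rfl, rfl, rfl, rfl⟩
  obtain ⟨j, j0, j1, j2, j3⟩ : ∃ j : ℍ, j.re = 0 ∧ j.imI = 0 ∧ j.imJ = 1 ∧ j.imK = 0 :=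
    ⟨⟨0, 0, 1, 0⟩, rfl, rfl, rfl, rfl⟩
  obtain ⟨k, k0, k1, k2, k3⟩ : ∃ k : ℍ, k.re = 0 ∧ k.imI = 0 ∧ k.imJ = 0 ∧ k.imK = 1 :=
    ⟨⟨0, 0, 0, 1⟩, rfl, rfl, rfl, rfl⟩
  -- Multiplication by `-i`, `-j` or `-k` moves the corresponding imaginary component to the real
  -- part.
  have hdec : ∀ z : ℍ, z = (z * 1).re • (1 : ℍ) + (z * -i).re • i + (z * -j).re • j +
      (z * -k).re • k := by
    intro z
    ext <;> simp [i0, i1, i2, i3, j0, j1, j2, j3, k0, k1, k2, k3]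
  have h1 := hX 1
  have h2 := hX (-i)
  have h3 := hX (-j)
  have h4 := hX (-k)
  have e1 := h1.1.smul_const (1 : ℍ)
  have e2 := h2.1.smul_const i
  have e3 := h3.1.smul_const j
  have e4 := h4.1.smul_const k
  have e12 : Integrable (fun ω => (X ω * 1).re • (1 : ℍ) + (X ω * -i).re • i) P := e1.add e2
  have e123 : Integrable (fun ω => (X ω * 1).re • (1 : ℍ) + (X ω * -i).re • i +
      (X ω * -j).re • j) P := e12.add e3
  have hXeq : X = fun ω => (X ω * 1).re • (1 : ℍ) + (X ω * -i).re • i + (X ω * -j).re • j +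
      (X ω * -k).re • k := funext fun ω => hdec (X ω)
  refine ⟨hXeq ▸ e123.add e4, (congrArg (integral P) hXeq).trans
    ((integral_add e123 e4).trans ?_)⟩
  rw [integral_add e12 e3, integral_add e1 e2,
    integral_smul_const, integral_smul_const, integral_smul_const, integral_smul_const,
    h1.2, h2.2, h3.2, h4.2]
  exact (hdec x).symm

theorem Splitting.IsDLP.integral_qinner_projAlong (h : σ.IsDLP (orthProj H) μ) (v w : E) :
    Integrable (fun Q => qinner v (projAlong Q.1 (orth H) w)) μ ∧
      ∫ Q, qinner v (projAlong Q.1 (orth H) w) ∂μ = qinner v (orthProj H w) := by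
  refine integral_quaternion_of_re fun q => ?_
  -- Both projections are linear on the right, so the factor `q` comes out of the inner products.
  have h1 := h.integral_re_qinner_projAlong v (w <• q)
  simpa only [map_smul, qinner_smul_right] using h1

end Determinantal

end QDLP

theorem mainTheorem12 {E : Type*} [AddCommGroup E] [Module ℍᵐᵒᵖ E] [QDLP.QInner E]
    [Module.Finite ℍᵐᵒᵖ E] {s : ℕ} (σ : QDLP.Splitting E s) (H : Submodule ℍᵐᵒᵖ E)
    {Ω : Type*} [MeasurableSpace Ω] (P : MeasureTheory.Measure Ω)
    [MeasureTheory.IsProbabilityMeasure P]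
    (Q : Ω → σ.Gr) (hQ : AEMeasurable Q P)
    (hlaw : σ.IsDLP (QDLP.orthProj H) (P.map Q)) :
    (∀ᵐ ω ∂P, IsCompl (Q ω).1 (QDLP.orth H)) ∧
      QDLP.HasExpectation P
        (fun ω => QDLP.projAlong (Q ω).1 (QDLP.orth H) +
          QDLP.adjoint (QDLP.projAlong (Q ω).1 (QDLP.orth H)))
        (2 • QDLP.orthProj H) := by
  refine ⟨ae_of_ae_map hQ hlaw.ae_isCompl, fun v w => ?_⟩
  have hproj : ∀ v w : E,
      Integrable (fun ω => QDLP.QInner.qinner v (QDLP.projAlong (Q ω).1 (QDLP.orth H) w)) P ∧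
      ∫ ω, QDLP.QInner.qinner v (QDLP.projAlong (Q ω).1 (QDLP.orth H) w) ∂P =
        QDLP.QInner.qinner v (QDLP.orthProj H w) := by
    intro v w
    have h := hlaw.integral_qinner_projAlong v w
    refine ⟨h.1.comp_aemeasurable hQ, ?_⟩
    rw [← h.2, integral_map hQ h.1.aestronglyMeasurable]
  -- The coefficients of the adjoint are conjugates of coefficients of the projection itself, with
  -- `v` and `w` exchanged; their expectation then follows from `hproj w v`.
  have hadj : ∀ ω, QDLP.QInner.qinner v
      (QDLP.adjoint (QDLP.projAlong (Q ω).1 (QDLP.orth H)) w) =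
      star (QDLP.QInner.qinner w (QDLP.projAlong (Q ω).1 (QDLP.orth H) v)) := by
    intro ω
    rw [← QDLP.star_qinner (QDLP.adjoint _ w) v, QDLP.adjoint_spec]
  obtain ⟨h1, h2⟩ := hproj v w
  obtain ⟨h3, h4⟩ := hproj w v
  simp only [LinearMap.add_apply, QDLP.QInner.qinner_add_right, hadj]
  have hstar : StarModule ℝ ℍ := ⟨fun r z => by ext <;> simp⟩
  have h5 : Integrable (fun ω =>
      star (QDLP.QInner.qinner w (QDLP.projAlong (Q ω).1 (QDLP.orth H) v))) P :=
    (starL' ℝ : ℍ ≃L[ℝ] ℍ).toContinuousLinearMap.integrable_comp h3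
  refine ⟨h1.add h5, ?_⟩
  have h6 : ∫ ω, star (QDLP.QInner.qinner w (QDLP.projAlong (Q ω).1 (QDLP.orth H) v)) ∂P =
      star (QDLP.QInner.qinner w (QDLP.orthProj H v)) := by
    rw [← h4]
    exact (starL' ℝ : ℍ ≃L[ℝ] ℍ).integral_comp_comm _
  rw [integral_add h1 h5, h2, h6, QDLP.star_qinner, ← QDLP.isSelfAdj_orthProj H v w, two_smul,
    LinearMap.add_apply, QDLP.QInner.qinner_add_right]
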